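/- **Setting.** Let $G$ be a finite group and $A=A^{-1}$, $B=B^{-1}$ subsets of $G$ with $|A|=|B|=\Delta$, such that the left Cayley graph $\mathrm{Cay}(G,A)$ and the right Cayley graph $\mathrm{Cay}(G,B)$ are connected non-bipartite Ramanujan graphs (every adjacency eigenvalue $\ne\pm\Delta$ has absolute value at most $2\sqrt{\Delta-1}$). Put $V_{ij}=G\times\{ij\}$ for $i,j\in\{0,1\}$, $V_0=V_{00}\cup V_{11}$, $V_1=V_{01}\cup V_{10}$, and let $Q$ be the set of squares $\{(g,00),(ag,01),(gb,10),(agb,11)\}$ with $g\in G$, $a\in A$, $b\in B$. The set $Q(v)$ of squares containing a vertex $v$ is identified with $A\times B$ through the labels $(a,b)$. $|\cdot|$ is Hamming weight. Let $\delta>0$, $0<\rho<1/2$, $0<\varepsilon<1/4$, $\gamma=1-\varepsilon$, $w=\Delta^{3/2-\varepsilon}$. Let $C_A\subset\mathbb F_2^A$, $C_B\subset\mathbb F_2^B$ be linear codes with $0<\dim C_A\le\rho\Delta$, $\dim C_B=\Delta-\dim C_A$, such that $C_A,C_B,C_A^\perp,C_B^\perp$ have minimum distance at least $\delta\Delta$,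 and such that the dual tensor codes $C_A\otimes\mathbb F_2^B+\mathbb F_2^A\otimes C_B$ and $C_A^\perp\otimes\mathbb F_2^B+\mathbb F_2^A\otimes C_B^\perp$ are $w$-robust with $\Delta^\gamma$-resistance to puncturing. Here $D_A\otimes\mathbb F_2^B+\mathbb F_2^A\otimes D_B$ is $w$-robust if the support of each of its codewords $x$ with $|x|\le w$ is covered by at most $|x|/d(D_B)$ rows and at most $|x|/d(D_A)$ columns ($d$ is the minimum distance), and it is so with $p$-resistance to puncturing if for all $A'\subset A$, $B'\subset B$ with $|A'|=|B'|=\Delta-w'$, $w'\le p$, the dual tensor code of the restrictions of $D_A$ to $A'$ and of $D_B$ to $B'$ is $w$-robust. A decomposition of $\hat Z\in\mathbb F_2^Q$ is a tuple $\mathcal Z=(C_0,R_0,C_1,R_1)$ with $\hat Z=C_0+R_0+C_1+R_1$, where the columns of $C_j$ on $Q(v)$, $v\in V_{1-j,j}$, are in $C_A$ and the rows of $R_i$ on $Q(v)$, $v\in V_{i,1-i}$, are in $C_B$. Its norm is the total number of non-zero such columns and rows. Let $\mathcal Z$ be a decomposition of $\hat Z$ of minimal norm, and let $S_0$ be the set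 of vertices $v\in V_{ii}$, $i=0,1$, such that $R_i+C_i$ is non-zero on $Q(v)$. The sequential decoder is stalled at $\hat Z$ if for no $v\in V_0$, $c\in C_A\otimes\mathbb F_2^B$, $r\in\mathbb F_2^A\otimes C_B$ does adding $c+r$ on $Q(v)$ decrease $|\hat Z|$. *First parallel step*, $\hat Z\mapsto\hat Z'$: simultaneously, for each $v\in V_1$ for which there are $A_0\subset A$, $B_0\subset B$ with $|A\setminus A_0|,|B\setminus B_0|\le\Delta^\gamma/2$ and $r\in\mathbb F_2^A\otimes C_B$, $c\in C_A\otimes\mathbb F_2^B$ such that, on $A_0\times B_0$ in $Q(v)$, $|\hat Z|>w/2$, $|r+c|>w$ and $|\hat Z+r+c|<w/2$, choose such data, add $r+c$ on $Q(v)$, and then add single columns in $C_A$ or single rows in $C_B$ on $Q(v)$ as long as this can decrease the weight on $Q(v)$; all vertices are treated starting from the original $\hat Z$, and the increments are added up. *Second parallel step*, $\hat Z'\mapsto\hat Z''$: simultaneously, for each $v\in V_0$ for which some $r+c$, $r\in\mathbb F_2^A\otimes C_B$, $c\in C_A\otimes\mathbb F_2^B$, added on $Q(v)$ decreases $|\hat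 Z'|$, add one with the largest decrease. **Theorem.** For every $\delta>0$ there are constants $\kappa,\kappa'>0$ depending only on $\delta$ such that for all $\rho\in(0,1/2)$, $\varepsilon\in(0,1/4)$ and all $\Delta$ large enough (in terms of $\delta,\rho,\varepsilon$) the following holds in the setting above. If the sequential decoder is stalled at $\hat Z$ and $|S_0|\le\frac{\delta}{8\Delta}|V_0|$, then for every possible outcome of the two parallel decoding steps $$|\hat Z''|\le\kappa|S_0|\Delta^{4\varepsilon}.$$ Moreover $|\hat Z|\ge\kappa'|S_0|\Delta^{1/2-\varepsilon}$, and hence $|\hat Z''|\le\frac{\kappa}{\kappa'}\Delta^{-(1/2-5\varepsilon)}|\hat Z|$. -/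

import Mathlib

open scoped Finset

universe u

noncomputable section

namespace QTanner

/-! ### Binary codes, tensor codes, robustness -/

section Codes

variable {ι κ : Type*} [Fintype ι] [Fintype κ]

/-- Binary linear codes with coordinate set `ι`. -/
abbrev Code (ι : Type*) := Submodule (ZMod 2) (ι → ZMod 2)

/-- Minimum distance: the least weight of a nonzero codeword (`0` for the zero code). -/
def minDist (C : Code ι) : ℕ := sInf {n | ∃ x ∈ C, x ≠ 0 ∧ hammingNorm x = n}

/-- The dual code. -/
def dualCode (C : Code ι) : Code ι where
  carrier := {x | ∀ y ∈ C, x ⬝ᵥ y = 0}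
  add_mem' := fun hx hy z hz => by rw [add_dotProduct, hx z hz, hy z hz, add_zero]
  zero_mem' := fun z _ => zero_dotProduct z
  smul_mem' := fun t x hx z hz => by rw [smul_dotProduct, hx z hz, smul_zero]

/-- The punctured code: restriction of the codewords to the coordinates in `S`. -/
def puncture (C : Code ι) (S : Finset ι) : Code S :=
  C.map (LinearMap.funLeft (ZMod 2) (ZMod 2) (Subtype.val : S → ι))

/-- `C_A ⊗ F₂^B`: arrays all of whose columns are in `C_A`. -/
def colCode (κ : Type*) (CA : Code ι) : Code (ι × κ) where
  carrier := {x | ∀ b, (fun a => x (a, b)) ∈ CA}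
  add_mem' := fun hx hy b => CA.add_mem (hx b) (hy b)
  zero_mem' := fun _ => CA.zero_mem
  smul_mem' := fun t _ hx b => CA.smul_mem t (hx b)

/-- `F₂^A ⊗ C_B`: arrays all of whose rows are in `C_B`. -/
def rowCode (ι : Type*) (CB : Code κ) : Code (ι × κ) where
  carrier := {x | ∀ a, (fun b => x (a, b)) ∈ CB}
  add_mem' := fun hx hy a => CB.add_mem (hx a) (hy a)
  zero_mem' := fun _ => CB.zero_mem
  smul_mem' := fun t _ hx a => CB.smul_mem t (hx a)

/-- The dual tensor code `C_A ⊗ F₂^B + F₂^A ⊗ C_B`. -/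
def dualTensor (CA : Code ι) (CB : Code κ) : Code (ι × κ) :=
  colCode κ CA ⊔ rowCode ι CB

/-- `w`-robustness of the dual tensor code of `C_A` and `C_B`. -/
def IsRobust (CA : Code ι) (CB : Code κ) (w : ℝ) : Prop :=
  ∀ x ∈ dualTensor CA CB, (hammingNorm x : ℝ) ≤ w →
    ∃ (A' : Finset ι) (B' : Finset κ),
      (#A' : ℝ) ≤ hammingNorm x / minDist CB ∧
      (#B' : ℝ) ≤ hammingNorm x / minDist CA ∧
      ∀ a b, a ∉ A' → b ∉ B' → x (a, b) = 0

/-- `w`-robustness with `p`-resistance to puncturing. -/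
def IsRobustPunctured (CA : Code ι) (CB : Code κ) (w p : ℝ) : Prop :=
  ∀ (A' : Finset ι) (B' : Finset κ) (n : ℕ), (n : ℝ) ≤ p →
    #A' + n = Fintype.card ι → #B' + n = Fintype.card κ →
    IsRobust (puncture CA A') (puncture CB B') w

/-- The standing conditions on the component codes of length `Δ`. The dual tensor codes
`(C_A ⊗ C_B)^⊥` and `(C_A^⊥ ⊗ C_B^⊥)^⊥` are those built from the pairs `C_A^⊥, C_B^⊥` and
`C_A, C_B` respectively. -/
structure GoodCodes (ρ δ ε γ : ℝ) (Δ : ℕ) (CA : Code ι) (CB : Code κ) : Prop where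
  dim_pos : 0 < Module.finrank (ZMod 2) CA
  dim_le : (Module.finrank (ZMod 2) CA : ℝ) ≤ ρ * Δ
  dim_add : Module.finrank (ZMod 2) CA + Module.finrank (ZMod 2) CB = Δ
  dist_A : δ * Δ ≤ minDist CA
  dist_B : δ * Δ ≤ minDist CB
  dist_dualA : δ * Δ ≤ minDist (dualCode CA)
  dist_dualB : δ * Δ ≤ minDist (dualCode CB)
  robust_zero : IsRobustPunctured (dualCode CA) (dualCode CB)
    ((Δ : ℝ) ^ (3 / 2 - ε)) ((Δ : ℝ) ^ γ)
  robust_one : IsRobustPunctured CA CB ((Δ : ℝ) ^ (3 / 2 - ε)) ((Δ : ℝ) ^ γ)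

/-- Number of nonzero columns of an array. -/
def numCols (x : ι × κ → ZMod 2) : ℕ := by
  classical exact #{b : κ | ∃ a, x (a, b) ≠ 0}

/-- Number of nonzero rows of an array. -/
def numRows (x : ι × κ → ZMod 2) : ℕ := by
  classical exact #{a : ι | ∃ b, x (a, b) ≠ 0}

/-- Hamming weight of an array on the restricted coordinate set `A₀ × B₀`. -/
def weightOn (A₀ : Finset ι) (B₀ : Finset κ) (x : ι × κ → ZMod 2) : ℕ :=
  #{p ∈ A₀ ×ˢ B₀ | x p ≠ 0}

/-- The array with row `a` equal to `r` and zero elsewhere. -/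
def singleRow (a : ι) (r : κ → ZMod 2) : ι × κ → ZMod 2 := by
  classical exact fun p => if p.1 = a then r p.2 else 0

/-- The array with column `b` equal to `c` and zero elsewhere. -/
def singleCol (b : κ) (c : ι → ZMod 2) : ι × κ → ZMod 2 := by
  classical exact fun p => if p.2 = b then c p.1 else 0

/-! ### Local part of the first parallel decoding step -/

/-- Decreasing the weight by adding one row codeword of `C_B` or one column codeword of `C_A`. -/
def CleanStep (CA : Code ι) (CB : Code κ) (y y' : ι × κ → ZMod 2) : Prop :=
  ((∃ a, ∃ r ∈ CB, y' = y + singleRow a r) ∨ (∃ b, ∃ c ∈ CA, y' = y + singleCol b c)) ∧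
    hammingNorm y' < hammingNorm y

/-- The criterion of the tweaked decoder on the local view `z`, for the sets `A₀`, `B₀` and the
dual tensor codeword `r + c`. The elements of the punctured dual tensor code on `A₀ × B₀` are
the restrictions of such `r + c`. -/
def TweakedCriterion (ε : ℝ) (Δ : ℕ) (CA : Code ι) (CB : Code κ) (z : ι × κ → ZMod 2)
    (A₀ : Finset ι) (B₀ : Finset κ) (r c : ι × κ → ZMod 2) : Prop :=
  (Fintype.card ι : ℝ) - #A₀ ≤ (Δ : ℝ) ^ (1 - ε) / 2 ∧
  (Fintype.card κ : ℝ) - #B₀ ≤ (Δ : ℝ) ^ (1 - ε) / 2 ∧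
  r ∈ rowCode ι CB ∧ c ∈ colCode κ CA ∧
  (Δ : ℝ) ^ (3 / 2 - ε) / 2 < weightOn A₀ B₀ z ∧
  (Δ : ℝ) ^ (3 / 2 - ε) < weightOn A₀ B₀ (r + c) ∧
  (weightOn A₀ B₀ (z + r + c) : ℝ) < (Δ : ℝ) ^ (3 / 2 - ε) / 2

/-- `u` is a possible total increment made by the tweaked decoder on a `Q`-neighbourhood with
local view `z`: if the criterion can be met, some admissible `r + c` is added, and then single
rows and columns are corrected until none can be; otherwise nothing is done. -/
def IsTweakedUpdate (ε : ℝ) (Δ : ℕ) (CA : Code ι) (CB : Code κ)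
    (z u : ι × κ → ZMod 2) : Prop :=
  (∃ A₀ B₀ r c, TweakedCriterion ε Δ CA CB z A₀ B₀ r c ∧
    Relation.ReflTransGen (CleanStep CA CB) (z + r + c) (z + u) ∧
    ∀ y, ¬ CleanStep CA CB (z + u) y) ∨
  ((¬ ∃ A₀ B₀ r c, TweakedCriterion ε Δ CA CB z A₀ B₀ r c) ∧ u = 0)

end Codes

/-! ### Cayley graphs -/

section Graphs

variable {V : Type*}

/-- Adjacency matrix of a graph, possibly with loops, given by its adjacency relation. -/
def adjMatrix (Adj : V → V → Prop) : Matrix V V ℝ := by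
  classical exact Matrix.of fun x y => if Adj x y then 1 else 0

/-- Connected non-bipartite Ramanujan graphs of degree `Δ` (for a symmetric `Δ`-regular
adjacency relation): every eigenvalue other than `±Δ` has absolute value at most
`2√(Δ-1)`. -/
structure IsNonbipartiteRamanujan [Fintype V] (Adj : V → V → Prop) (Δ : ℕ) : Prop where
  connected : ∀ x y, Relation.ReflTransGen Adj x y
  nonbipartite : ¬ ∃ f : V → Bool, ∀ x y, Adj x y → f x ≠ f y
  eigenvalue_le : ∀ μ : ℝ,
    (by classical exact Module.End.HasEigenvalue (Matrix.toLin' (adjMatrix Adj)) μ) →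
      μ ≠ Δ → μ ≠ -Δ → |μ| ≤ 2 * √((Δ : ℝ) - 1)

variable {G : Type*} [Group G]

/-- Left Cayley graph: `g` is joined to `a g` for `a ∈ A`. -/
def leftCayley (A : Finset G) (g h : G) : Prop := ∃ a ∈ A, h = a * g

/-- Right Cayley graph: `g` is joined to `g b` for `b ∈ B`. -/
def rightCayley (B : Finset G) (g h : G) : Prop := ∃ b ∈ B, h = g * b

end Graphs

/-! ### The quadripartite left-right Cayley complex -/

section Complex

variable {G : Type*} [Group G]

/-- Vertices: `(g, i, j)` is the vertex `g` of `V_{ij}`, with `false = 0` and `true = 1`. -/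
abbrev Vertex (G : Type*) := G × Bool × Bool

/-- Squares: `(g, a, b)` stands for `{(g,00), (ag,01), (gb,10), (agb,11)}`. -/
abbrev Square (A B : Finset G) := G × A × B

variable {A B : Finset G}

/-- The vertex of a square in `V_{ij}`. -/
def corner (q : Square A B) : Bool → Bool → Vertex G
  | false, false => (q.1, false, false)
  | false, true => (q.2.1 * q.1, false, true)
  | true, false => (q.1 * q.2.2, true, false)
  | true, true => (q.2.1 * q.1 * q.2.2, true, true)

/-- A square is determined by its set of four vertices. -/
theorem square_ext (q q' : Square A B)
    (h : {v | ∃ i j, v = corner q i j} = {v | ∃ i j, v = corner q' i j}) : q = q' := by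
  have key : ∀ i j, corner q i j = corner q' i j := by
    intro i j
    have hm : corner q i j ∈ {v | ∃ i j, v = corner q i j} := ⟨i, j, rfl⟩
    rw [h] at hm
    obtain ⟨k, l, hkl⟩ := hm
    cases i <;> cases j <;> cases k <;> cases l <;> simp_all [corner]
  obtain ⟨g, a, b⟩ := q
  obtain ⟨g', a', b'⟩ := q'
  have h0 := key false false
  have h1 := key false true
  have h2 := key true false
  simp only [corner, Prod.mk.injEq, and_true] at h0 h1 h2
  subst h0
  rw [mul_left_inj] at h1
  rw [mul_right_inj] at h2
  rw [Subtype.ext h1, Subtype.ext h2]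

/-- The labelling `φ_v` of the `Q`-neighbourhood of `v` by `A × B`. -/
def phi : Vertex G → A × B → Square A B
  | (g, false, false), (a, b) => (g, a, b)
  | (g, false, true), (a, b) => ((a : G)⁻¹ * g, a, b)
  | (g, true, false), (a, b) => (g * (b : G)⁻¹, a, b)
  | (g, true, true), (a, b) => ((a : G)⁻¹ * g * (b : G)⁻¹, a, b)

/-- The image of `φ_v` is the set of squares incident to `v`, and the label of `(g, a, b)` in
each of its four `Q`-neighbourhoods is `(a, b)`. -/
theorem phi_eq_iff (v : Vertex G) (p : A × B) (q : Square A B) :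
    phi v p = q ↔ corner q v.2.1 v.2.2 = v ∧ q.2 = p := by
  obtain ⟨g, i, j⟩ := v
  obtain ⟨a, b⟩ := p
  obtain ⟨h, a', b'⟩ := q
  cases i <;> cases j <;> simp only [phi, corner, Prod.mk.injEq, and_true] <;> constructor <;>
    rintro ⟨h1, h2, h3⟩ <;> subst_vars <;> simp [mul_assoc]

/-- Local view of `x` on the `Q`-neighbourhood of `v`. -/
def localView (v : Vertex G) (x : Square A B → ZMod 2) : A × B → ZMod 2 :=
  fun p => x (phi v p)

/-- A vector on the `Q`-neighbourhood of `v`, extended by zero to all squares. -/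
def pad (v : Vertex G) (u : A × B → ZMod 2) : Square A B → ZMod 2 := by
  classical exact fun q => if corner q v.2.1 v.2.2 = v then u q.2 else 0

variable [Fintype G]

/-- `V_0 = V_{00} ∪ V_{11}`. -/
def V0 (G : Type*) [Fintype G] : Finset (Vertex G) := {v | v.2.1 = v.2.2}

/-- `V_1 = V_{01} ∪ V_{10}`. -/
def V1 (G : Type*) [Fintype G] : Finset (Vertex G) := {v | v.2.1 ≠ v.2.2}

/-! ### Decompositions of a mismatch -/

/-- Decompositions `(C_0, R_0, C_1, R_1)`, where `C_j` is a sum of column codewords over the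
vertices of `V_{ij}`, `i ≠ j`, and `R_i` a sum of row codewords over those of `V_{ij}`, `j ≠ i`.
`C false` is `C_0`, and so on. -/
structure Decomp (CA : Code A) (CB : Code B) where
  C : Bool → Square A B → ZMod 2
  R : Bool → Square A B → ZMod 2
  mem_C : ∀ (j : Bool) (g : G), localView (g, !j, j) (C j) ∈ colCode B CA
  mem_R : ∀ (i : Bool) (g : G), localView (g, i, !i) (R i) ∈ rowCode A CB

namespace Decomp

variable {CA : Code A} {CB : Code B}

/-- The mismatch `C_0 + R_0 + C_1 + R_1`. -/
def mismatch (Z : Decomp CA CB) : Square A B → ZMod 2 :=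
  Z.C false + Z.R false + Z.C true + Z.R true

/-- The norm `‖C_0‖ + ‖R_0‖ + ‖C_1‖ + ‖R_1‖`. -/
def norm (Z : Decomp CA CB) : ℕ :=
  ∑ i : Bool, ((∑ g : G, numCols (localView (g, !i, i) (Z.C i))) +
    ∑ g : G, numRows (localView (g, i, !i) (Z.R i)))

/-- `Z` has minimal norm among the decompositions of the same mismatch. -/
def IsMinimal (Z : Decomp CA CB) : Prop :=
  ∀ Y : Decomp CA CB, Y.mismatch = Z.mismatch → Z.norm ≤ Y.norm

/-- The active vertices of `V_0`: those `v ∈ V_{ii}` with `R_i + C_i` nonzero on `Q(v)`. -/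
def active (Z : Decomp CA CB) : Finset (Vertex G) := by
  classical exact {v ∈ V0 G | localView v (Z.R v.2.1 + Z.C v.2.2) ≠ 0}

end Decomp

/-! ### The decoder -/

/-- The sequential decoder is stalled: no local change at a vertex of `V_0` decreases the
weight. -/
def IsStalled (CA : Code A) (CB : Code B) (z : Square A B → ZMod 2) : Prop :=
  ∀ v ∈ V0 G, ∀ c ∈ colCode B CA, ∀ r ∈ rowCode A CB,
    ¬ hammingNorm (z + pad v (c + r)) < hammingNorm z

/-- `z'` is a possible outcome of the first parallel decoding step applied to `z`. -/
def FirstStep (ε : ℝ) (Δ : ℕ) (CA : Code A) (CB : Code B) (z z' : Square A B → ZMod 2) : Prop :=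
  ∃ u : Vertex G → A × B → ZMod 2,
    (∀ v ∈ V1 G, IsTweakedUpdate ε Δ CA CB (localView v z) (u v)) ∧
    z' = z + ∑ v ∈ V1 G, pad v (u v)

/-- `u` is a possible increment on `Q(v)` in the second parallel decoding step: a dual tensor
codeword decreasing the weight of `z` as much as possible, or zero if no decrease is possible. -/
def IsBestUpdate (CA : Code A) (CB : Code B) (z : Square A B → ZMod 2) (v : Vertex G)
    (u : A × B → ZMod 2) : Prop :=
  (u ∈ dualTensor CA CB ∧ hammingNorm (z + pad v u) < hammingNorm z ∧
    ∀ u' ∈ dualTensor CA CB, hammingNorm (z + pad v u) ≤ hammingNorm (z + pad v u')) ∨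
  ((∀ u' ∈ dualTensor CA CB, ¬ hammingNorm (z + pad v u') < hammingNorm z) ∧ u = 0)

/-- `z'` is a possible outcome of the second parallel decoding step applied to `z`. -/
def SecondStep (CA : Code A) (CB : Code B) (z z' : Square A B → ZMod 2) : Prop :=
  ∃ u : Vertex G → A × B → ZMod 2,
    (∀ v ∈ V0 G, IsBestUpdate CA CB z v (u v)) ∧
    z' = z + ∑ v ∈ V0 G, pad v (u v)

end Complex

end QTanner

end

open QTanner

/-!
A decomposition of the mismatch is studied through the local parts it has at the vertices of the
complex. The local view of the mismatch at a vertex `v` is the sum of an *own* part, a dual tensor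
codeword made of the rows and columns meeting at `v`, and a *foreign* part. The foreign part is read
off from the own parts of the vertices opposite to `v` in the squares, so its weight is at most the
number of active vertices opposite to `v`. Everything else is robustness at single vertices, where
light dual tensor codewords have few rows and columns, combined with expansion: when the set `T` has
a small share of all vertices, few vertices see many elements of `T` (`Expands.card_le`). Since the
graph of opposite vertices inherits its expansion from both Cayley graphs, the spectral assumptions
enter only through three instances of `Expands`. Write `s = √Δ` and `c = Δ ^ ε`; vertices of `V₀`
are called even and those of `V₁` odd.

*Structure of a stalled mismatch.* At an even vertex stalling bounds the weight of the own part by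
twice that of the foreign part, so few even vertices are *exceptional*, that is, have an own part
heavier than a fraction of `w`. At the other ones robustness and minimality of the norm leave at
most `m = s / (8 c)` rows and columns. Stalling with respect to a single row of such a vertex shows
that a nonzero row must be compensated by a foreign part of weight about `δ Δ / 2`; hence an odd
vertex sharing the row has many active neighbours, and such odd vertices (`oddRows`) are rare. *Bad*
odd vertices, with more than `Δ ^ (1 - ε) / 2` exceptional neighbours, are rarer still.

*First step* (`exists_residual`). Let `u` be an odd vertex that is not bad. Away from its exceptional
neighbours the foreign part at `u` is light, so the local view is close to the own part, and
puncturing the exceptional rows and columns brings robustness to bear. If the decoder acts, what is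
left is a dual tensor codeword with few rows and columns which no single row or column improves; if
it does not act, the own part itself is of this kind. In both cases a row left over, unless shared
with an exceptional vertex, is protected by a foreign row of weight at least `δ Δ / 4`
(`crossWeight`). The even vertex on such a row has at least `δ Δ / 8` neighbours in `oddRows`, so
expansion applied once more leaves `O(c ^ 4 / Δ)` times the initial number of active vertices
(`card_activeSet_after_le`).

*Second step* (`sum_residual_mul_le`). An even vertex is corrected exactly unless its foreign part
weighs at least half the minimum distance, and at most twice the foreign weight remains; by
expansion the sum of these weights is `O(Δ)` times the number of vertices still active.

*Lower bound* (`card_active_le`). An active vertex that is not exceptional passes a nonzero row or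
column to an odd neighbour. The exceptional vertices, the odd ones that are bad and those in
`oddRows` with a light own part account for at most half of the active vertices; any other odd vertex
receiving a row or column has a local view of weight at least `3 w / 4`, and it receives at most
`2 Δ` of them.
-/

namespace QTanner

/-! ### Arrays given by their rows and columns -/

section Arrays

variable {ι κ : Type*}

/-- The array with rows `r a` plus the array with columns `c b`. -/
def arr (r : ι → κ → ZMod 2) (c : κ → ι → ZMod 2) : ι × κ → ZMod 2 :=
  fun p => r p.1 p.2 + c p.2 p.1

theorem mem_dualTensor_iff {CA : Code ι} {CB : Code κ} {x : ι × κ → ZMod 2} :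
    x ∈ dualTensor CA CB ↔ ∃ (r : ι → κ → ZMod 2) (c : κ → ι → ZMod 2),
      (∀ a, r a ∈ CB) ∧ (∀ b, c b ∈ CA) ∧ x = arr r c := by
  constructor
  · intro hx
    obtain ⟨c, hc, r, hr, rfl⟩ := Submodule.mem_sup.1 hx
    exact ⟨fun a b => r (a, b), fun b a => c (a, b), hr, hc, funext fun p => add_comm _ _⟩
  · rintro ⟨r, c, hr, hc, rfl⟩
    refine Submodule.mem_sup.2 ⟨fun p => c p.2 p.1, hc, fun p => r p.1 p.2, hr, ?_⟩
    exact funext fun p => add_comm _ _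

theorem mem_dualTensor_swap {CA : Code ι} {CB : Code κ} {x : κ × ι → ZMod 2}
    (hx : x ∈ dualTensor CB CA) : (fun p : ι × κ => x (p.2, p.1)) ∈ dualTensor CA CB := by
  obtain ⟨r, c, hr, hc, rfl⟩ := mem_dualTensor_iff.1 hx
  exact mem_dualTensor_iff.2 ⟨c, r, hc, hr, funext fun p => add_comm _ _⟩

theorem weightOn_add_le (A₀ : Finset ι) (B₀ : Finset κ) (x y : ι × κ → ZMod 2) :
    weightOn A₀ B₀ (x + y) ≤ weightOn A₀ B₀ x + weightOn A₀ B₀ y := by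
  classical
  refine le_trans (Finset.card_le_card ?_) (Finset.card_union_le _ _)
  intro i hi
  simp only [Finset.mem_filter, Finset.mem_union, Pi.add_apply] at hi ⊢
  by_contra! h
  exact hi.2 (by rw [h.1 hi.1, h.2 hi.1, add_zero])

theorem weightOn_mono {A₀ A₁ : Finset ι} {B₀ B₁ : Finset κ} (hA : A₀ ⊆ A₁) (hB : B₀ ⊆ B₁)
    (x : ι × κ → ZMod 2) : weightOn A₀ B₀ x ≤ weightOn A₁ B₁ x :=
  Finset.card_le_card (Finset.filter_subset_filter _ (Finset.product_subset_product hA hB))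

end Arrays

/-! ### Hamming weights and minimum distance -/

section Weights

variable {ι κ : Type*} [Fintype ι] [Fintype κ]

theorem add_self_zmodTwo {α : Type*} (x : α → ZMod 2) : x + x = 0 :=
  funext fun i => CharTwo.add_self_eq_zero (x i)

theorem hammingNorm_add_le (x y : ι → ZMod 2) :
    hammingNorm (x + y) ≤ hammingNorm x + hammingNorm y := by
  classical
  refine le_trans (Finset.card_le_card ?_) (Finset.card_union_le _ _)
  intro i hi
  simp only [Finset.mem_filter, Finset.mem_univ, true_and, Finset.mem_union, Pi.add_apply] at hi ⊢
  by_contra! h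
  exact hi (by rw [h.1, h.2, add_zero])

theorem hammingNorm_le_card_of_support (x : ι → ZMod 2) (S : Finset ι)
    (h : ∀ i, i ∉ S → x i = 0) : hammingNorm x ≤ #S := by
  refine Finset.card_le_card fun i hi => ?_
  by_contra hS
  exact (Finset.mem_filter.1 hi).2 (h i hS)

theorem hammingNorm_apply_le (f : κ → ι → ZMod 2) (a : ι) :
    hammingNorm (fun b => f b a) ≤ hammingNorm f := by
  refine Finset.card_le_card fun b hb => ?_
  simp only [Finset.mem_filter, Finset.mem_univ, true_and] at hb ⊢
  exact fun h => hb (congrFun h a)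

theorem minDist_le {C : Code ι} {x : ι → ZMod 2} (hx : x ∈ C) (h0 : x ≠ 0) :
    minDist C ≤ hammingNorm x :=
  Nat.sInf_le ⟨x, hx, h0, rfl⟩

theorem exists_hammingNorm_eq_minDist {C : Code ι} (h : 0 < minDist C) :
    ∃ x ∈ C, x ≠ 0 ∧ hammingNorm x = minDist C :=
  Nat.sInf_mem (Nat.nonempty_of_pos_sInf h)

theorem eq_zero_of_support {C : Code ι} {x : ι → ZMod 2} (hx : x ∈ C) (S : Finset ι)
    (h : ∀ i, i ∉ S → x i = 0) (hS : #S < minDist C) : x = 0 := by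
  by_contra h0
  exact absurd (minDist_le hx h0)
    (not_le.2 (lt_of_le_of_lt (hammingNorm_le_card_of_support x S h) hS))

/-- If adding a nonzero codeword `r` to `r + e` does not decrease the weight, the error `e`
weighs at least half the minimum distance. -/
theorem minDist_le_two_mul {C : Code ι} {r e : ι → ZMod 2} (hr : r ∈ C) (h0 : r ≠ 0)
    (h : hammingNorm (r + e) ≤ hammingNorm e) : minDist C ≤ 2 * hammingNorm e := by
  have h1 := minDist_le hr h0
  have h2 := hammingNorm_add_le (r + e) e
  rw [add_assoc, add_self_zmodTwo, add_zero] at h2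
  omega

/-- Puncturing `n` coordinates lowers the minimum distance by at most `n`. -/
theorem minDist_le_minDist_puncture_add (C : Code ι) (S : Finset ι) {n : ℕ}
    (hn : #S + n = Fintype.card ι) (hd : n < minDist C) :
    minDist C ≤ minDist (puncture C S) + n := by
  classical
  have key : ∀ x : ι → ZMod 2,
      hammingNorm x ≤ hammingNorm (fun i : S => x i) + n := by
    intro x
    have hc : #(Sᶜ) = n := by rw [Finset.card_compl]; omega
    have h1 : hammingNorm (fun i : S => x i) = #{i ∈ S | x i ≠ 0} := by
      refine Finset.card_bij (fun i _ => i.1) ?_ ?_ ?_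
      · intro i hi
        simpa using hi
      · intro i _ j _ hij
        exact Subtype.ext hij
      · intro i hi
        rw [Finset.mem_filter] at hi
        exact ⟨⟨i, hi.1⟩, by simpa using hi.2, rfl⟩
    rw [h1, ← hc]
    refine le_trans (Finset.card_le_card ?_) (Finset.card_union_le _ _)
    intro i hi
    by_cases hS : i ∈ S <;> simp_all
  obtain ⟨x, hx, hx0, hxd⟩ := exists_hammingNorm_eq_minDist (pos_of_gt hd)
  have hne : {m | ∃ y ∈ puncture C S, y ≠ 0 ∧ hammingNorm y = m}.Nonempty := by
    refine ⟨_, fun i : S => x i, ⟨x, hx, rfl⟩, ?_, rfl⟩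
    rw [← hammingNorm_ne_zero_iff]
    have := key x
    omega
  obtain ⟨y, ⟨z, hz, rfl⟩, hy0, hyd⟩ := Nat.sInf_mem hne
  have hz0 : z ≠ 0 := by
    rintro rfl
    exact hy0 (map_zero _)
  have h1 := minDist_le hz hz0
  have h2 := key z
  have h3 : hammingNorm (fun i : S => z i) = minDist (puncture C S) := hyd
  omega

theorem hammingNorm_eq_sum_rows (x : ι × κ → ZMod 2) :
    hammingNorm x = ∑ a, hammingNorm (fun b => x (a, b)) := by
  classical
  simp only [hammingNorm, Finset.card_filter]
  exact Fintype.sum_prod_type _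

theorem hammingNorm_eq_sum_cols (x : ι × κ → ZMod 2) :
    hammingNorm x = ∑ b, hammingNorm (fun a => x (a, b)) := by
  classical
  simp only [hammingNorm, Finset.card_filter]
  exact Fintype.sum_prod_type_right _

theorem hammingNorm_comp_swap (x : ι × κ → ZMod 2) :
    hammingNorm (fun p : κ × ι => x (p.2, p.1)) = hammingNorm x := by
  rw [hammingNorm_eq_sum_rows, hammingNorm_eq_sum_cols x]

theorem IsRobustPunctured.swap {CA : Code ι} {CB : Code κ} {w p : ℝ}
    (h : IsRobustPunctured CA CB w p) : IsRobustPunctured CB CA w p := by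
  intro B₁ A₁ n hn hB hA x hx hw
  obtain ⟨A', B', hA', hB', h0⟩ := h A₁ B₁ n hn hA hB _ (mem_dualTensor_swap hx)
    (by rwa [hammingNorm_comp_swap])
  rw [hammingNorm_comp_swap] at hA' hB'
  exact ⟨B', A', hB', hA', fun b a hb ha => h0 a b ha hb⟩

theorem hammingNorm_add_singleRow (y : ι × κ → ZMod 2) (a : ι) (r : κ → ZMod 2) :
    hammingNorm (y + singleRow a r) + hammingNorm (fun b => y (a, b)) =
      hammingNorm y + hammingNorm ((fun b => y (a, b)) + r) := by
  classical
  rw [hammingNorm_eq_sum_rows, hammingNorm_eq_sum_rows y,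
    ← Finset.add_sum_erase _ _ (Finset.mem_univ a),
    ← Finset.add_sum_erase _ (fun a => hammingNorm fun b => y (a, b)) (Finset.mem_univ a)]
  have h1 : (fun b => (y + singleRow a r) (a, b)) = (fun b => y (a, b)) + r := by
    ext b; simp [singleRow]
  have h2 : ∀ a' ∈ Finset.univ.erase a,
      hammingNorm (fun b => (y + singleRow a r) (a', b)) = hammingNorm (fun b => y (a', b)) := by
    intro a' ha'
    congr 1
    ext b
    simp [singleRow, (Finset.mem_erase.1 ha').1]
  rw [Finset.sum_congr rfl h2, h1]
  ring

theorem hammingNorm_add_singleCol (y : ι × κ → ZMod 2) (b : κ) (c : ι → ZMod 2) :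
    hammingNorm (y + singleCol b c) + hammingNorm (fun a => y (a, b)) =
      hammingNorm y + hammingNorm ((fun a => y (a, b)) + c) := by
  classical
  rw [hammingNorm_eq_sum_cols, hammingNorm_eq_sum_cols y,
    ← Finset.add_sum_erase _ _ (Finset.mem_univ b),
    ← Finset.add_sum_erase _ (fun b => hammingNorm fun a => y (a, b)) (Finset.mem_univ b)]
  have h1 : (fun a => (y + singleCol b c) (a, b)) = (fun a => y (a, b)) + c := by
    ext a; simp [singleCol]
  have h2 : ∀ b' ∈ Finset.univ.erase b,
      hammingNorm (fun a => (y + singleCol b c) (a, b')) = hammingNorm (fun a => y (a, b')) := by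
    intro b' hb'
    congr 1
    ext a
    simp [singleCol, (Finset.mem_erase.1 hb').1]
  rw [Finset.sum_congr rfl h2, h1]
  ring

theorem weightOn_le_hammingNorm (A₀ : Finset ι) (B₀ : Finset κ) (x : ι × κ → ZMod 2) :
    weightOn A₀ B₀ x ≤ hammingNorm x :=
  Finset.card_le_card (Finset.filter_subset_filter _ (Finset.subset_univ _))

/-! ### Covering by few rows and columns -/

/-- A dual tensor codeword of small weight on a large subrectangle vanishes outside few rows and
few columns: the deleted ones, and those provided by robustness of the punctured code. -/
theorem exists_cover {CA : Code ι} {CB : Code κ} {w p d : ℝ} {n : ℕ}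
    (hrob : IsRobustPunctured CA CB w p) (hnp : (n : ℝ) ≤ p) (hnd : (n : ℝ) < d)
    (hdA : d ≤ minDist CA) (hdB : d ≤ minDist CB)
    {A₀ : Finset ι} {B₀ : Finset κ} (hA : Fintype.card ι ≤ #A₀ + n)
    (hB : Fintype.card κ ≤ #B₀ + n) (hnι : n ≤ Fintype.card ι) (hnκ : n ≤ Fintype.card κ)
    {x : ι × κ → ZMod 2} (hx : x ∈ dualTensor CA CB) (hw : (weightOn A₀ B₀ x : ℝ) ≤ w) :
    ∃ (A' : Finset ι) (B' : Finset κ), (#A' : ℝ) ≤ n + weightOn A₀ B₀ x / (d - n) ∧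
      (#B' : ℝ) ≤ n + weightOn A₀ B₀ x / (d - n) ∧
      ∀ a b, a ∉ A' → b ∉ B' → x (a, b) = 0 := by
  classical
  obtain ⟨A₁, hA₁, hA₁c⟩ := Finset.exists_subset_card_eq (s := A₀)
    (n := Fintype.card ι - n) (by omega)
  obtain ⟨B₁, hB₁, hB₁c⟩ := Finset.exists_subset_card_eq (s := B₀)
    (n := Fintype.card κ - n) (by omega)
  have hAn : #A₁ + n = Fintype.card ι := by omega
  have hBn : #B₁ + n = Fintype.card κ := by omega
  have hnA : n < minDist CA := by exact_mod_cast lt_of_lt_of_le hnd hdA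
  have hnB : n < minDist CB := by exact_mod_cast lt_of_lt_of_le hnd hdB
  have hpA : d - n ≤ minDist (puncture CA A₁) := by
    have := minDist_le_minDist_puncture_add CA A₁ hAn hnA
    have : (minDist CA : ℝ) ≤ minDist (puncture CA A₁) + n := by exact_mod_cast this
    linarith
  have hpB : d - n ≤ minDist (puncture CB B₁) := by
    have := minDist_le_minDist_puncture_add CB B₁ hBn hnB
    have : (minDist CB : ℝ) ≤ minDist (puncture CB B₁) + n := by exact_mod_cast this
    linarith
  set x₁ : A₁ × B₁ → ZMod 2 := fun p => x (p.1.1, p.2.1) with hx₁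
  have hxm : x₁ ∈ dualTensor (puncture CA A₁) (puncture CB B₁) := by
    obtain ⟨r, c, hr, hc, rfl⟩ := mem_dualTensor_iff.1 hx
    exact mem_dualTensor_iff.2 ⟨fun a b => r a b, fun b a => c b a,
      fun a => ⟨r a, hr a, rfl⟩, fun b => ⟨c b, hc b, rfl⟩, rfl⟩
  have hle : hammingNorm x₁ ≤ weightOn A₀ B₀ x := by
    refine Finset.card_le_card_of_injOn (fun p => (p.1.1, p.2.1)) ?_ ?_
    · intro p hp
      simp only [Finset.coe_filter, Finset.mem_univ, true_and, Set.mem_ofPred_eq,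
        Finset.mem_product] at hp ⊢
      exact ⟨⟨hA₁ p.1.2, hB₁ p.2.2⟩, hp⟩
    · intro p _ q _ hpq
      simp only [Prod.mk.injEq] at hpq
      exact Prod.ext (Subtype.ext hpq.1) (Subtype.ext hpq.2)
  have hleR : (hammingNorm x₁ : ℝ) ≤ weightOn A₀ B₀ x := by exact_mod_cast hle
  obtain ⟨A', B', hA', hB', hz⟩ := hrob A₁ B₁ n hnp hAn hBn x₁ hxm (hleR.trans hw)
  have hpos : 0 < d - n := by linarith
  refine ⟨A₁ᶜ ∪ A'.map (Function.Embedding.subtype _),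
    B₁ᶜ ∪ B'.map (Function.Embedding.subtype _), ?_, ?_, ?_⟩
  · have h1 : #(A₁ᶜ ∪ A'.map (Function.Embedding.subtype _)) ≤ n + #A' := by
      refine (Finset.card_union_le _ _).trans ?_
      rw [Finset.card_map, Finset.card_compl]
      omega
    have h2 : (#(A₁ᶜ ∪ A'.map (Function.Embedding.subtype _)) : ℝ) ≤ n + #A' := by
      exact_mod_cast h1
    refine h2.trans (add_le_add le_rfl (hA'.trans ?_))
    gcongr
  · have h1 : #(B₁ᶜ ∪ B'.map (Function.Embedding.subtype _)) ≤ n + #B' := by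
      refine (Finset.card_union_le _ _).trans ?_
      rw [Finset.card_map, Finset.card_compl]
      omega
    have h2 : (#(B₁ᶜ ∪ B'.map (Function.Embedding.subtype _)) : ℝ) ≤ n + #B' := by
      exact_mod_cast h1
    refine h2.trans (add_le_add le_rfl (hB'.trans ?_))
    gcongr
  · intro a b ha hb
    simp only [Finset.mem_union, Finset.mem_compl, Finset.mem_map, not_or, not_not,
      Function.Embedding.subtype_apply, Subtype.exists, exists_and_right, exists_eq_right,
      not_exists] at ha hb
    exact hz ⟨a, ha.1⟩ ⟨b, hb.1⟩ (ha.2 ha.1) (hb.2 hb.1)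

/-- A dual tensor codeword vanishing outside few rows and columns is a sum of codewords of the
component codes on these rows and columns. The two given parts `r` and `c` agree off the rows `A'`
and columns `B'`; the codeword of the tensor code that extends this common part moves one onto the
other. -/
theorem exists_rows_cols_of_cover {CA : Code ι} {CB : Code κ}
    {r : ι → κ → ZMod 2} {c : κ → ι → ZMod 2} (hr : ∀ a, r a ∈ CB) (hc : ∀ b, c b ∈ CA)
    {A' : Finset ι} {B' : Finset κ} (hA : #A' < minDist CA) (hB : #B' < minDist CB)
    (h0 : ∀ a b, a ∉ A' → b ∉ B' → arr r c (a, b) = 0) :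
    ∃ (r' : ι → κ → ZMod 2) (c' : κ → ι → ZMod 2), (∀ a, r' a ∈ CB) ∧ (∀ b, c' b ∈ CA) ∧
      (∀ a, a ∉ A' → r' a = 0) ∧ (∀ b, b ∉ B' → c' b = 0) ∧ arr r' c' = arr r c := by
  classical
  -- `π` erases the coordinates in `A'`; on `C_A` it is injective.
  let π : (ι → ZMod 2) →ₗ[ZMod 2] (ι → ZMod 2) :=
    LinearMap.pi fun a => if a ∈ A' then 0 else LinearMap.proj a
  have hπ : ∀ x a, π x a = if a ∈ A' then 0 else x a := by
    intro x a
    by_cases h : a ∈ A' <;> simp [π, h]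
  have hker : (π.domRestrict CA).ker = ⊥ := by
    rw [LinearMap.ker_eq_bot']
    rintro ⟨x, hx⟩ h
    refine Subtype.ext (eq_zero_of_support hx A' (fun a ha => ?_) hA)
    have := congrFun h a
    simpa [hπ, ha] using this
  obtain ⟨g, hg⟩ := LinearMap.exists_leftInverse_of_injective _ hker
  let L : (ι → ZMod 2) →ₗ[ZMod 2] (ι → ZMod 2) := CA.subtype ∘ₗ g ∘ₗ π
  have hLmem : ∀ x, L x ∈ CA := fun x => (g (π x)).2
  have hLid : ∀ x ∈ CA, L x = x := by
    intro x hx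
    have := LinearMap.congr_fun hg ⟨x, hx⟩
    exact congrArg Subtype.val this
  have hLcongr : ∀ x y, (∀ a, a ∉ A' → x a = y a) → L x = L y := by
    intro x y hxy
    have : π x = π y := by
      ext a
      rw [hπ, hπ]
      split_ifs with h
      · rfl
      · exact hxy a h
    simp only [L, LinearMap.comp_apply, this]
  let t : ι → κ → ZMod 2 := fun a b => L (fun a' => r a' b) a
  have htrow : ∀ a, t a ∈ CB := by
    intro a
    have : t a = ∑ a', L (Pi.single a' 1) a • r a' := by
      ext b
      have h1 : (fun a' => r a' b) = ∑ a', r a' b • (Pi.single a' 1 : ι → ZMod 2) := by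
        ext i
        simp [Finset.sum_apply, Pi.single_apply]
      simp only [t]
      rw [h1, map_sum, Finset.sum_apply, Finset.sum_apply]
      refine Finset.sum_congr rfl fun a' _ => ?_
      rw [map_smul]
      simp [mul_comm]
    rw [this]
    exact Submodule.sum_mem _ fun a' _ => Submodule.smul_mem _ _ (hr a')
  have hagree : ∀ a b, a ∉ A' → b ∉ B' → r a b = c b a := by
    intro a b ha hb
    exact CharTwo.add_eq_zero.1 (h0 a b ha hb)
  have htc : ∀ b, b ∉ B' → (fun a => t a b) = c b := by
    intro b hb
    have h1 : L (fun a' => r a' b) = L (c b) := hLcongr _ _ fun a ha => hagree a b ha hb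
    rw [hLid _ (hc b)] at h1
    exact h1
  refine ⟨fun a => r a + t a, fun b a => c b a + t a b, fun a => CB.add_mem (hr a) (htrow a),
    fun b => CA.add_mem (hc b) (hLmem _), ?_, ?_, ?_⟩
  · intro a ha
    refine eq_zero_of_support (CB.add_mem (hr a) (htrow a)) B' (fun b hb => ?_) hB
    have h1 : t a b = c b a := congrFun (htc b hb) a
    change r a b + t a b = 0
    rw [h1, hagree a b ha hb, CharTwo.add_self_eq_zero]
  · intro b hb
    ext a
    have h1 : t a b = c b a := congrFun (htc b hb) a
    simp only [h1, CharTwo.add_self_eq_zero, Pi.zero_apply]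
  · ext ⟨a, b⟩
    simp only [arr, Pi.add_apply]
    linear_combination CharTwo.add_self_eq_zero (t a b)

/-! ### Cleaning by single rows and columns -/

/-- Suppose that the weight of a row of `y` outside `A'` is too small for a row correction to pay,
even in the presence of errors on the columns in `B'`, and symmetrically. Then cleaning keeps the
dual tensor codeword added to `y` supported on the rows `A'` and the columns `B'`. -/
theorem exists_rows_cols_of_clean {CA : Code ι} {CB : Code κ} {A' : Finset ι} {B' : Finset κ}
    {y : ι × κ → ZMod 2}
    (hrow : ∀ a, a ∉ A' → 2 * (hammingNorm (fun b => y (a, b)) + #B') < minDist CB)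
    (hcol : ∀ b, b ∉ B' → 2 * (hammingNorm (fun a => y (a, b)) + #A') < minDist CA)
    {z z' : ι × κ → ZMod 2} (hz : Relation.ReflTransGen (CleanStep CA CB) z z')
    (h : ∃ r c, (∀ a, r a ∈ CB) ∧ (∀ b, c b ∈ CA) ∧ (∀ a, a ∉ A' → r a = 0) ∧
      (∀ b, b ∉ B' → c b = 0) ∧ z = y + arr r c) :
    ∃ r c, (∀ a, r a ∈ CB) ∧ (∀ b, c b ∈ CA) ∧ (∀ a, a ∉ A' → r a = 0) ∧
      (∀ b, b ∉ B' → c b = 0) ∧ z' = y + arr r c := by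
  classical
  induction hz with
  | refl => exact h
  | @tail z₁ z₂ _ hstep ih =>
    obtain ⟨r, c, hr, hc, hrA, hcB, hz₁⟩ := ih
    obtain ⟨⟨a, ρ, hρ, rfl⟩ | ⟨b, ρ, hρ, rfl⟩, hlt⟩ := hstep
    · have ha : a ∈ A' := by
        by_contra ha
        have hw := hammingNorm_add_singleRow z₁ a ρ
        have hρ0 : ρ ≠ 0 := by
          rintro rfl
          rw [add_zero] at hw
          omega
        have h1 := minDist_le_two_mul (e := fun b => z₁ (a, b)) hρ hρ0 (by
          rw [add_comm]
          omega)
        have h2 : (fun b => z₁ (a, b)) = (fun b => y (a, b)) + fun b => c b a := by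
          ext b
          simp [hz₁, arr, hrA a ha]
        have h3 := hammingNorm_add_le (fun b => y (a, b)) fun b => c b a
        have h4 := hammingNorm_le_card_of_support (fun b => c b a) B'
          fun b hb => congrFun (hcB b hb) a
        have h5 := hrow a ha
        rw [h2] at h1
        omega
      refine ⟨fun a' => r a' + if a' = a then ρ else 0, c, fun a' => ?_, hc, fun a' ha' => ?_,
        hcB, ?_⟩
      · refine CB.add_mem (hr a') ?_
        split_ifs
        exacts [hρ, CB.zero_mem]
      · have : a' ≠ a := fun h => ha' (h ▸ ha)
        simp [this, hrA a' ha']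
      · rw [hz₁]
        ext ⟨a', b'⟩
        by_cases h : a' = a
        · simp [arr, singleRow, h]
          ring
        · simp [arr, singleRow, h]
    · have hb : b ∈ B' := by
        by_contra hb
        have hw := hammingNorm_add_singleCol z₁ b ρ
        have hρ0 : ρ ≠ 0 := by
          rintro rfl
          rw [add_zero] at hw
          omega
        have h1 := minDist_le_two_mul (e := fun a => z₁ (a, b)) hρ hρ0 (by
          rw [add_comm]
          omega)
        have h2 : (fun a => z₁ (a, b)) = (fun a => y (a, b)) + fun a => r a b := by
          ext a
          simp [hz₁, arr, hcB b hb]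
        have h3 := hammingNorm_add_le (fun a => y (a, b)) fun a => r a b
        have h4 := hammingNorm_le_card_of_support (fun a => r a b) A'
          fun a ha => congrFun (hrA a ha) b
        have h5 := hcol b hb
        rw [h2] at h1
        omega
      refine ⟨r, fun b' => c b' + if b' = b then ρ else 0, hr, fun b' => ?_, hrA, fun b' hb' => ?_,
        ?_⟩
      · refine CA.add_mem (hc b') ?_
        split_ifs
        exacts [hρ, CA.zero_mem]
      · have : b' ≠ b := fun h => hb' (h ▸ hb)
        simp [this, hcB b' hb']
      · rw [hz₁]
        ext ⟨a', b'⟩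
        by_cases h : b' = b
        · simp [arr, singleCol, h]
          ring
        · simp [arr, singleCol, h]

/-- A row codeword that survives the cleaning is protected by a heavy error on its row. -/
theorem minDist_le_of_clean_row {CA : Code ι} {CB : Code κ} {B' : Finset κ}
    {y : ι × κ → ZMod 2} {r : ι → κ → ZMod 2} {c : κ → ι → ZMod 2} {a : ι}
    (hfinal : ∀ z, ¬ CleanStep CA CB (y + arr r c) z) (hr : r a ∈ CB) (h0 : r a ≠ 0)
    (hcB : ∀ b, b ∉ B' → c b = 0) :
    minDist CB ≤ 2 * (hammingNorm (fun b => y (a, b)) + #B') := by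
  have h1 : ¬ hammingNorm (y + arr r c + singleRow a (r a)) < hammingNorm (y + arr r c) :=
    fun h => hfinal _ ⟨Or.inl ⟨a, r a, hr, rfl⟩, h⟩
  have hw := hammingNorm_add_singleRow (y + arr r c) a (r a)
  have h2 : (fun b => (y + arr r c) (a, b)) = r a + ((fun b => y (a, b)) + fun b => c b a) := by
    ext b
    simp only [Pi.add_apply, arr]
    ring
  have h3 := hammingNorm_add_le (fun b => y (a, b)) fun b => c b a
  have h4 := hammingNorm_le_card_of_support (fun b => c b a) B' fun b hb => congrFun (hcB b hb) a
  rw [h2, add_comm (r a + _) (r a), ← add_assoc (r a) (r a), add_self_zmodTwo, zero_add] at hw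
  have h5 := minDist_le_two_mul hr h0
    (e := (fun b => y (a, b)) + fun b => c b a) (by omega)
  omega

/-- A column codeword that survives the cleaning is protected by a heavy error on its column. -/
theorem minDist_le_of_clean_col {CA : Code ι} {CB : Code κ} {A' : Finset ι}
    {y : ι × κ → ZMod 2} {r : ι → κ → ZMod 2} {c : κ → ι → ZMod 2} {b : κ}
    (hfinal : ∀ z, ¬ CleanStep CA CB (y + arr r c) z) (hc : c b ∈ CA) (h0 : c b ≠ 0)
    (hrA : ∀ a, a ∉ A' → r a = 0) :
    minDist CA ≤ 2 * (hammingNorm (fun a => y (a, b)) + #A') := by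
  have h1 : ¬ hammingNorm (y + arr r c + singleCol b (c b)) < hammingNorm (y + arr r c) :=
    fun h => hfinal _ ⟨Or.inr ⟨b, c b, hc, rfl⟩, h⟩
  have hw := hammingNorm_add_singleCol (y + arr r c) b (c b)
  have h2 : (fun a => (y + arr r c) (a, b)) = c b + ((fun a => y (a, b)) + fun a => r a b) := by
    ext a
    simp only [Pi.add_apply, arr]
    ring
  have h3 := hammingNorm_add_le (fun a => y (a, b)) fun a => r a b
  have h4 := hammingNorm_le_card_of_support (fun a => r a b) A' fun a ha => congrFun (hrA a ha) b
  rw [h2, add_comm (c b + _) (c b), ← add_assoc (c b) (c b), add_self_zmodTwo, zero_add] at hw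
  have h5 := minDist_le_two_mul hc h0
    (e := (fun a => y (a, b)) + fun a => r a b) (by omega)
  omega

end Weights

/-! ### Spectral bounds for Ramanujan graphs -/

section Spectral

variable {V : Type*} [Fintype V] {Adj : V → V → Prop} {Δ : ℕ}

/-- An eigenvector for `±Δ` of a connected `Δ`-regular graph is constant along edges, up to the
sign of the eigenvalue. This is seen at a vertex where it is largest in absolute value. -/
theorem eq_mul_of_extremal_eigenvector (hreg : ∀ x, ∑ y, adjMatrix Adj x y = Δ)
    (hconn : ∀ x y, Relation.ReflTransGen Adj x y) {f : V → ℝ} {σ : ℝ} (hσ : σ ^ 2 = 1)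
    (hf : ∀ x, ∑ y, adjMatrix Adj x y * f y = σ * Δ * f x) :
    ∀ x y, Adj x y → f y = σ * f x := by
  classical
  intro x₁ y₁ hxy₁
  obtain ⟨x₀, -, hx₀⟩ := Finset.exists_max_image Finset.univ (fun x => f x ^ 2)
    ⟨x₁, Finset.mem_univ _⟩
  have hmax : ∀ y, f y ^ 2 ≤ f x₀ ^ 2 := fun y => hx₀ y (Finset.mem_univ _)
  have hstep : ∀ x y, f x ^ 2 = f x₀ ^ 2 → Adj x y → f y = σ * f x := by
    intro x y hx hxy
    have hterm : ∀ y, 0 ≤ adjMatrix Adj x y * (f x * (f x - σ * f y)) := by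
      intro y
      refine mul_nonneg ?_ ?_
      · simp only [adjMatrix, Matrix.of_apply]
        split_ifs <;> norm_num
      · have h1 := hmax y
        rw [← hx] at h1
        nlinarith [sq_nonneg (f x - σ * f y)]
    have hsum : ∑ y, adjMatrix Adj x y * (f x * (f x - σ * f y)) = 0 := by
      have : ∀ y, adjMatrix Adj x y * (f x * (f x - σ * f y)) =
          f x ^ 2 * adjMatrix Adj x y - f x * σ * (adjMatrix Adj x y * f y) := by
        intro y; ring
      simp only [this]
      rw [Finset.sum_sub_distrib, ← Finset.mul_sum, ← Finset.mul_sum, hreg, hf]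
      linear_combination (-(f x ^ 2 * Δ)) * hσ
    have h0 := (Finset.sum_eq_zero_iff_of_nonneg fun y _ => hterm y).1 hsum y (Finset.mem_univ _)
    have h1 : adjMatrix Adj x y = 1 := by simp [adjMatrix, hxy]
    rw [h1, one_mul] at h0
    have h2 := hmax y
    rw [← hx] at h2
    have h3 : (f y - σ * f x) ^ 2 ≤ 0 := by nlinarith
    have h4 : f y - σ * f x = 0 := by
      have := le_antisymm h3 (sq_nonneg _)
      exact pow_eq_zero_iff (two_ne_zero) |>.1 this
    linarith
  have hall : ∀ x, f x ^ 2 = f x₀ ^ 2 := by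
    intro x
    induction hconn x₀ x with
    | refl => rfl
    | @tail b c _ hbc ih => rw [hstep b c ih hbc, mul_pow, hσ, one_mul, ih]
  exact hstep x₁ y₁ (hall x₁) hxy₁

/-- On functions of mean zero, the adjacency operator of a Ramanujan graph has norm at most
`2√(Δ-1) ≤ 2√Δ`. -/
theorem sum_sq_adjMatrix_le (hΔ : 1 ≤ Δ) (hsymm : ∀ x y, Adj x y → Adj y x)
    (hreg : ∀ x, ∑ y, adjMatrix Adj x y = Δ) (h : IsNonbipartiteRamanujan Adj Δ)
    (f : V → ℝ) (hf : ∑ x, f x = 0) :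
    ∑ x, (∑ y, adjMatrix Adj x y * f y) ^ 2 ≤ 4 * Δ * ∑ x, f x ^ 2 := by
  classical
  set M : Matrix V V ℝ := adjMatrix Adj with hM
  have hH : M.IsHermitian := by
    rw [Matrix.isHermitian_iff_isSymm]
    ext x y
    have : Adj y x ↔ Adj x y := ⟨hsymm _ _, hsymm _ _⟩
    simp [hM, adjMatrix, this]
  let b := hH.eigenvectorBasis
  let F : EuclideanSpace ℝ V := WithLp.toLp 2 f
  let MF : EuclideanSpace ℝ V := WithLp.toLp 2 (M.mulVec f)
  have hnF : ‖F‖ ^ 2 = ∑ x, f x ^ 2 := by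
    rw [EuclideanSpace.norm_sq_eq]; simp [F]
  have hnMF : ‖MF‖ ^ 2 = ∑ x, (∑ y, M x y * f y) ^ 2 := by
    rw [EuclideanSpace.norm_sq_eq]; simp [MF, Matrix.mulVec, dotProduct]
  have hinner : ∀ i, inner ℝ (b i) MF = hH.eigenvalues i * inner ℝ (b i) F := by
    intro i
    have h1 : inner ℝ (b i) MF = M.mulVec f ⬝ᵥ (b i).ofLp := by
      simp [EuclideanSpace.inner_eq_star_dotProduct, MF]
    have h2 : inner ℝ (b i) F = f ⬝ᵥ (b i).ofLp := by
      simp [EuclideanSpace.inner_eq_star_dotProduct, F]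
    have h3 : M.mulVec (b i).ofLp = hH.eigenvalues i • (b i).ofLp :=
      hH.mulVec_eigenvectorBasis i
    have hT : M.transpose = M := (Matrix.isHermitian_iff_isSymm.1 hH)
    rw [h1, h2, dotProduct_comm, Matrix.dotProduct_mulVec, ← Matrix.mulVec_transpose, hT, h3,
      smul_dotProduct, smul_eq_mul, dotProduct_comm]
  have hΔ' : (1 : ℝ) ≤ Δ := by exact_mod_cast hΔ
  rw [← hnF, ← hnMF, ← b.sum_sq_norm_inner_right, ← b.sum_sq_norm_inner_right, Finset.mul_sum]
  refine Finset.sum_le_sum fun i _ => ?_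
  rw [hinner, norm_mul, mul_pow]
  have hev : ∀ x, ∑ y, M x y * (b i).ofLp y = hH.eigenvalues i * (b i).ofLp x := by
    intro x
    have := congrFun (hH.mulVec_eigenvectorBasis i) x
    simpa [Matrix.mulVec, dotProduct] using this
  have hbi : (b i).ofLp ≠ 0 := by
    intro h0
    have h1 : b i = 0 := by ext x; exact congrFun h0 x
    exact b.orthonormal.ne_zero i h1
  obtain ⟨x₀, hx₀⟩ := Function.ne_iff.1 hbi
  by_cases h1 : hH.eigenvalues i = Δ
  · -- the eigenvector is constant, hence orthogonal to `f`
    have hc := eq_mul_of_extremal_eigenvector hreg h.connected (f := (b i).ofLp) (σ := 1)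
      (by norm_num) (fun x => by rw [hev, h1]; ring)
    have hconst : ∀ x, (b i).ofLp x = (b i).ofLp x₀ := by
      intro x
      induction h.connected x₀ x with
      | refl => rfl
      | @tail y z _ hyz ih => rw [hc y z hyz, one_mul, ih]
    have h0 : inner ℝ (b i) F = 0 := by
      have h2 : inner ℝ (b i) F = ∑ x, f x * (b i).ofLp x := by
        simp [EuclideanSpace.inner_eq_star_dotProduct, F, dotProduct]
      rw [h2]
      simp only [hconst]
      rw [← Finset.sum_mul, hf, zero_mul]
    simp [h0]
  by_cases h2 : hH.eigenvalues i = -Δ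
  · -- the sign of the eigenvector is a proper two-colouring
    exfalso
    have hc := eq_mul_of_extremal_eigenvector hreg h.connected (f := (b i).ofLp) (σ := -1)
      (by norm_num) (fun x => by rw [hev, h2]; ring)
    have hne : ∀ x, (b i).ofLp x ≠ 0 := by
      intro x
      induction h.connected x₀ x with
      | refl => exact hx₀
      | @tail y z _ hyz ih =>
        rw [hc y z hyz]
        simpa using ih
    refine h.nonbipartite ⟨fun x => decide (0 < (b i).ofLp x), fun x y hxy heq => ?_⟩
    have h3 := hc x y hxy
    have h4 := hne x
    rw [decide_eq_decide] at heq
    rcases lt_or_gt_of_ne h4 with h5 | h5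
    · exact absurd (heq.2 (by linarith)) (not_lt.2 h5.le)
    · have := heq.1 h5
      linarith
  have hvec : Module.End.HasEigenvalue (Matrix.toLin' M) (hH.eigenvalues i) := by
    refine Module.End.hasEigenvalue_of_hasEigenvector (x := (b i).ofLp)
      ⟨Module.End.mem_eigenspace_iff.2 ?_, hbi⟩
    rw [Matrix.toLin'_apply]
    exact hH.mulVec_eigenvectorBasis i
  have hle := h.eigenvalue_le _ hvec h1 h2
  have h3 : ‖hH.eigenvalues i‖ ^ 2 ≤ 4 * Δ := by
    rw [Real.norm_eq_abs]
    calc (|hH.eigenvalues i| ^ 2 : ℝ) ≤ (2 * √((Δ : ℝ) - 1)) ^ 2 := by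
          exact pow_le_pow_left₀ (abs_nonneg _) hle 2
      _ = 4 * ((Δ : ℝ) - 1) := by rw [mul_pow, Real.sq_sqrt (by linarith)]; norm_num
      _ ≤ 4 * (Δ : ℝ) := by linarith
  gcongr

end Spectral

/-! ### Expansion in terms of neighbour counts -/

section Expansion

variable {V L : Type*} [Fintype V] [Fintype L]

/-- Number of labels leading from `v` into `T`. -/
noncomputable def deg (nbr : L → V → V) (T : Finset V) (v : V) : ℕ := by
  classical exact #{l : L | nbr l v ∈ T}

/-- A quantitative form of expansion: up to an error that is small in mean square, the number of
neighbours in a set `T` is at most the expected one, which is proportional to the size of `T`. -/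
def Expands (nbr : L → V → V) (θ Λ : ℝ) : Prop :=
  ∀ T : Finset V, ∃ q : V → ℝ, (∀ v, q v ≤ θ * #T) ∧
    ∑ v, ((deg nbr T v : ℝ) - q v) ^ 2 ≤ Λ * #T

variable {nbr : L → V → V} {θ Λ k : ℝ} {S T : Finset V}

theorem Expands.sum_deg_le (h : Expands nbr θ Λ)
    (hS : ∀ v ∈ S, k ≤ deg nbr T v) (hT : θ * #T ≤ k / 2) :
    k * ∑ v ∈ S, (deg nbr T v : ℝ) ≤ 4 * Λ * #T := by
  obtain ⟨q, hq, hsum⟩ := h T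
  have h1 : ∀ v ∈ S, k * (deg nbr T v : ℝ) ≤ 4 * ((deg nbr T v : ℝ) - q v) ^ 2 := by
    intro v hv
    have h2 := hS v hv
    have h3 := hq v
    have h4 : (deg nbr T v : ℝ) / 2 ≤ deg nbr T v - q v := by linarith
    nlinarith
  calc k * ∑ v ∈ S, (deg nbr T v : ℝ) = ∑ v ∈ S, k * (deg nbr T v : ℝ) := Finset.mul_sum ..
    _ ≤ ∑ v ∈ S, 4 * ((deg nbr T v : ℝ) - q v) ^ 2 := Finset.sum_le_sum h1
    _ ≤ ∑ v, 4 * ((deg nbr T v : ℝ) - q v) ^ 2 :=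
        Finset.sum_le_univ_sum_of_nonneg fun v => by positivity
    _ = 4 * ∑ v, ((deg nbr T v : ℝ) - q v) ^ 2 := (Finset.mul_sum ..).symm
    _ ≤ 4 * Λ * #T := by linarith

/-- In an expander, few vertices have many neighbours in a small set. -/
theorem Expands.card_le (h : Expands nbr θ Λ) (hk : 0 < k)
    (hS : ∀ v ∈ S, k ≤ deg nbr T v) (hT : θ * #T ≤ k / 2) :
    (#S : ℝ) * k ^ 2 ≤ 4 * Λ * #T := by
  refine le_trans ?_ (h.sum_deg_le hS hT)
  have : #S * k ≤ ∑ v ∈ S, (deg nbr T v : ℝ) := by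
    rw [← nsmul_eq_mul]
    exact Finset.card_nsmul_le_sum S _ k hS
  nlinarith

end Expansion

/-! ### Cayley graphs -/

section Cayley

variable {G : Type*} [Group G] [Fintype G] {A B : Finset G} {Δ : ℕ}

theorem sum_leftCayley (A : Finset G) (f : G → ℝ) (g : G) :
    ∑ h, adjMatrix (leftCayley A) g h * f h = ∑ a : A, f (a * g) := by
  classical
  have h1 : ∀ h, adjMatrix (leftCayley A) g h * f h = if h * g⁻¹ ∈ A then f h else 0 := by
    intro h
    have : leftCayley A g h ↔ h * g⁻¹ ∈ A := by
      constructor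
      · rintro ⟨a, ha, rfl⟩; simpa using ha
      · intro hh; exact ⟨_, hh, by simp⟩
    simp [adjMatrix, this]
  simp only [h1]
  rw [← Equiv.sum_comp (Equiv.mulRight g), Finset.sum_coe_sort A fun a => f (a * g)]
  simp

theorem sum_rightCayley (B : Finset G) (f : G → ℝ) (g : G) :
    ∑ h, adjMatrix (rightCayley B) g h * f h = ∑ b : B, f (g * b) := by
  classical
  have h1 : ∀ h, adjMatrix (rightCayley B) g h * f h = if g⁻¹ * h ∈ B then f h else 0 := by
    intro h
    have : rightCayley B g h ↔ g⁻¹ * h ∈ B := by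
      constructor
      · rintro ⟨a, ha, rfl⟩; simpa using ha
      · intro hh; exact ⟨_, hh, by simp⟩
    simp [adjMatrix, this]
  simp only [h1]
  rw [← Equiv.sum_comp (Equiv.mulLeft g), Finset.sum_coe_sort B fun b => f (g * b)]
  simp

theorem sum_sq_left_le (hΔ : 1 ≤ Δ) (hA : #A = Δ) (hinv : ∀ a ∈ A, a⁻¹ ∈ A)
    (h : IsNonbipartiteRamanujan (leftCayley A) Δ) (f : G → ℝ) (hf : ∑ g, f g = 0) :
    ∑ g, (∑ a : A, f (a * g)) ^ 2 ≤ 4 * Δ * ∑ g, f g ^ 2 := by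
  simp only [← sum_leftCayley]
  refine sum_sq_adjMatrix_le hΔ ?_ ?_ h f hf
  · rintro x y ⟨a, ha, rfl⟩
    exact ⟨a⁻¹, hinv a ha, by simp⟩
  · intro x
    have := sum_leftCayley A (fun _ => 1) x
    simpa [hA] using this

theorem sum_sq_right_le (hΔ : 1 ≤ Δ) (hB : #B = Δ) (hinv : ∀ b ∈ B, b⁻¹ ∈ B)
    (h : IsNonbipartiteRamanujan (rightCayley B) Δ) (f : G → ℝ) (hf : ∑ g, f g = 0) :
    ∑ g, (∑ b : B, f (g * b)) ^ 2 ≤ 4 * Δ * ∑ g, f g ^ 2 := by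
  simp only [← sum_rightCayley]
  refine sum_sq_adjMatrix_le hΔ ?_ ?_ h f hf
  · rintro x y ⟨a, ha, rfl⟩
    exact ⟨a⁻¹, hinv a ha, by simp⟩
  · intro x
    have := sum_rightCayley B (fun _ => 1) x
    simpa [hB] using this

end Cayley

/-! ### Local views of a decomposition -/

/-- The neighbourhood structure of the left-right Cayley complex. A row `a` of the local view of a
vertex `v` is also a row of the local view of `row a v`, a column `b` is also a column of the local
view of `col b v`, and `even` is the bipartition `V₀ ∪ V₁`. Exchanging rows and columns is a
symmetry of this notion. -/
structure SquareComplex (V A B : Type*) where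
  row : A → V → V
  col : B → V → V
  even : V → Prop
  row_row : ∀ a v, row a (row a v) = v
  col_col : ∀ b v, col b (col b v) = v
  row_col : ∀ a b v, row a (col b v) = col b (row a v)
  even_row : ∀ a v, even (row a v) ↔ ¬ even v
  even_col : ∀ b v, even (col b v) ↔ ¬ even v

namespace SquareComplex

variable {V A B : Type*}

/-- The complex with rows and columns exchanged. -/
def swap (X : SquareComplex V A B) : SquareComplex V B A where
  row := X.col
  col := X.row
  even := X.even
  row_row := X.col_col
  col_col := X.row_row
  row_col := fun b a v => (X.row_col a b v).symm
  even_row := X.even_col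
  even_col := X.even_row

end SquareComplex

/-- A decomposition of a mismatch seen locally: at each vertex the row codewords `R v a` and the
column codewords `C v b` meeting there, where a row or column shared by two vertices carries the
same codeword at both. -/
structure LocalDecomp {V A B : Type*} (X : SquareComplex V A B) (CA : Code A) (CB : Code B) where
  R : V → A → B → ZMod 2
  C : V → B → A → ZMod 2
  mem_R : ∀ v a, R v a ∈ CB
  mem_C : ∀ v b, C v b ∈ CA
  R_row : ∀ a v, R (X.row a v) a = R v a
  C_col : ∀ b v, C (X.col b v) b = C v b

namespace LocalDecomp

section Views

variable {V A B : Type*} {X : SquareComplex V A B} {CA : Code A} {CB : Code B}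

/-- The decomposition with rows and columns exchanged. -/
def swap (D : LocalDecomp X CA CB) : LocalDecomp X.swap CB CA where
  R := D.C
  C := D.R
  mem_R := D.mem_C
  mem_C := D.mem_R
  R_row := D.C_col
  C_col := D.R_row

/-- The part of the mismatch at `v` that comes from the rows and columns meeting at `v`. -/
def own (D : LocalDecomp X CA CB) (v : V) : A × B → ZMod 2 := arr (D.R v) (D.C v)

/-- The part of the mismatch at `v` that comes from rows and columns not meeting at `v`. -/
def foreign (D : LocalDecomp X CA CB) (v : V) : A × B → ZMod 2 :=
  fun p => D.R (X.col p.2 v) p.1 p.2 + D.C (X.row p.1 v) p.2 p.1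

/-- The local view of the mismatch at `v`. -/
def view (D : LocalDecomp X CA CB) (v : V) : A × B → ZMod 2 := D.own v + D.foreign v

variable (D : LocalDecomp X CA CB)

theorem own_mem (v : V) : D.own v ∈ dualTensor CA CB :=
  mem_dualTensor_iff.2 ⟨_, _, D.mem_R v, D.mem_C v, rfl⟩

theorem foreign_eq_own (v : V) (a : A) (b : B) :
    D.foreign v (a, b) = D.own (X.row a (X.col b v)) (a, b) := by
  have h1 : D.R (X.row a (X.col b v)) a = D.R (X.col b v) a := D.R_row a _
  have h2 : D.C (X.row a (X.col b v)) b = D.C (X.row a v) b := by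
    rw [X.row_col]
    exact D.C_col b _
  simp only [foreign, own, arr, h1, h2]

theorem view_eq (v : V) (a : A) (b : B) :
    D.view v (a, b) = D.own (X.row a v) (a, b) + D.own (X.col b v) (a, b) := by
  simp only [view, Pi.add_apply, foreign, own, arr, D.R_row, D.C_col]
  ring

theorem own_swap (v : V) (a : A) (b : B) : D.swap.own v (b, a) = D.own v (a, b) :=
  add_comm _ _

theorem foreign_swap (v : V) (a : A) (b : B) : D.swap.foreign v (b, a) = D.foreign v (a, b) :=
  add_comm _ _

theorem view_swap (v : V) (a : A) (b : B) : D.swap.view v (b, a) = D.view v (a, b) := by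
  simp only [view, Pi.add_apply, own_swap, foreign_swap]

/-- A decomposition may be prescribed freely at the odd vertices. -/
theorem exists_of_odd (r : V → A → B → ZMod 2) (c : V → B → A → ZMod 2)
    (hr : ∀ v a, r v a ∈ CB) (hc : ∀ v b, c v b ∈ CA) :
    ∃ D' : LocalDecomp X CA CB, ∀ u, ¬ X.even u → D'.R u = r u ∧ D'.C u = c u := by
  classical
  refine ⟨⟨fun v a => if X.even v then r (X.row a v) a else r v a,
    fun v b => if X.even v then c (X.col b v) b else c v b, fun v a => ?_, fun v b => ?_,
    fun a v => ?_, fun b v => ?_⟩, fun u hu => ⟨?_, ?_⟩⟩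
  · split_ifs <;> exact hr _ _
  · split_ifs <;> exact hc _ _
  · by_cases h : X.even v <;> simp [X.even_row, h, X.row_row]
  · by_cases h : X.even v <;> simp [X.even_col, h, X.col_col]
  · simp [hu]
  · simp [hu]

end Views

/-! ### Heavy rows -/

section Rows

variable {V A B : Type*} {X : SquareComplex V A B} {CA : Code A} {CB : Code B}
  [Fintype A] [Fintype B] (D : LocalDecomp X CA CB) {Se S₀ : Finset V}
  {d m : ℝ}

/-- No row codeword at an even vertex can be removed with a gain. -/
def RowStalled : Prop :=
  ∀ v, X.even v → ∀ a, hammingNorm (fun b => D.view v (a, b)) ≤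
    hammingNorm ((fun b => D.view v (a, b)) + D.R v a)

/-- The weight that the row parts of the column neighbours of `u` have on row `a`. -/
def crossWeight (u : V) (a : A) : ℕ := hammingNorm fun b => D.R (X.col b u) a b

/-- At an even vertex a nonzero row is compensated by an error of weight half the distance. -/
theorem minDist_le_of_rowStalled (hst : D.RowStalled) {v : V} (hv : X.even v) {a : A}
    (ha : D.R v a ≠ 0) (hd : d ≤ minDist CB) :
    d ≤ 2 * (hammingNorm (D.C v) + hammingNorm fun b => D.foreign v (a, b) : ℕ) := by
  have h1 := hst v hv a
  have h2 : (fun b => D.view v (a, b)) =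
      D.R v a + ((fun b => D.C v b a) + fun b => D.foreign v (a, b)) := by
    ext b
    simp only [view, own, arr, Pi.add_apply]
    ring
  rw [h2, add_comm (D.R v a + _) (D.R v a), ← add_assoc (D.R v a) (D.R v a),
    add_self_zmodTwo, zero_add] at h1
  have h3 := minDist_le_two_mul (D.mem_R v a) ha h1
  have h4 := hammingNorm_add_le (fun b => D.C v b a) fun b => D.foreign v (a, b)
  have h5 : hammingNorm (fun b => D.C v b a) ≤ hammingNorm (D.C v) :=
    hammingNorm_apply_le _ _
  have h6 : minDist CB ≤
      2 * (hammingNorm (D.C v) + hammingNorm fun b => D.foreign v (a, b)) := by omega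
  exact hd.trans (by exact_mod_cast h6)

/-- If an odd vertex `u` has few nonzero columns, a nonzero row that it shares with an even vertex
outside `Se` has large cross weight. -/
theorem le_crossWeight_of_rowStalled (hst : D.RowStalled) (hd : d ≤ minDist CB)
    (hm : ∀ v, X.even v → v ∉ Se → (hammingNorm (D.C v) : ℝ) ≤ m)
    {u : V} (hodd : ¬ X.even u) {a : A} (haS : X.row a u ∉ Se) (ha : D.R u a ≠ 0) :
    d / 2 - m - hammingNorm (D.C u) ≤ D.crossWeight u a := by
  have hv : X.even (X.row a u) := (X.even_row a u).2 hodd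
  have h1 := D.minDist_le_of_rowStalled hst hv (a := a) (by rwa [D.R_row]) hd
  have h2 : (fun b => D.foreign (X.row a u) (a, b)) =
      (fun b => D.R (X.col b u) a b) + fun b => D.C u b a := by
    ext b
    have : D.R (X.col b (X.row a u)) a = D.R (X.col b u) a := by
      rw [← X.row_col]
      exact D.R_row a _
    simp only [foreign, Pi.add_apply, this, X.row_row]
  have h3 := hammingNorm_add_le (fun b => D.R (X.col b u) a b) fun b => D.C u b a
  rw [← h2] at h3
  have h4 : hammingNorm (fun b => D.C u b a) ≤ hammingNorm (D.C u) :=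
    hammingNorm_apply_le _ _
  have h5 : ((hammingNorm fun b => D.foreign (X.row a u) (a, b) : ℕ) : ℝ) ≤
      D.crossWeight u a + hammingNorm (D.C u) := by
    have : (hammingNorm fun b => D.foreign (X.row a u) (a, b)) ≤
      D.crossWeight u a + hammingNorm (D.C u) := h3.trans (Nat.add_le_add_left h4 _)
    exact_mod_cast this
  have h6 := hm _ hv haS
  push_cast at h1
  linarith

/-- The row part of the foreign mismatch on the columns shared with vertices outside `Se` is
light. -/
theorem sum_crossWeight_le {Δ : ℕ} (hB : Fintype.card B = Δ) (hm0 : 0 ≤ m)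
    (hm : ∀ v, X.even v → v ∉ Se → (hammingNorm (D.R v) : ℝ) ≤ m)
    {u : V} (hodd : ¬ X.even u) (B₀ : Finset B) (hB₀ : ∀ b ∈ B₀, X.col b u ∉ Se) :
    (∑ a, #{b ∈ B₀ | D.R (X.col b u) a b ≠ 0} : ℝ) ≤ Δ * m := by
  classical
  have h1 : (∑ a, #{b ∈ B₀ | D.R (X.col b u) a b ≠ 0}) =
      ∑ b ∈ B₀, #{a | D.R (X.col b u) a b ≠ 0} := by
    simp only [Finset.card_filter]
    exact Finset.sum_comm
  have h2 : ∀ b ∈ B₀, (#{a | D.R (X.col b u) a b ≠ 0} : ℝ) ≤ m := by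
    intro b hb
    refine le_trans ?_ (hm _ ((X.even_col b u).2 hodd) (hB₀ b hb))
    exact_mod_cast hammingNorm_apply_le (D.R (X.col b u)) b
  have h3 : (∑ a, #{b ∈ B₀ | D.R (X.col b u) a b ≠ 0} : ℝ) =
      ∑ b ∈ B₀, (#{a | D.R (X.col b u) a b ≠ 0} : ℝ) := by exact_mod_cast h1
  rw [h3]
  refine (Finset.sum_le_card_nsmul _ _ _ h2).trans ?_
  rw [nsmul_eq_mul, ← hB]
  have : (#B₀ : ℝ) ≤ Fintype.card B := by exact_mod_cast Finset.card_le_univ B₀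
  gcongr

/-- Few rows have large cross weight at an odd vertex with few neighbours in `Se`. -/
theorem card_heavy_mul_le {Δ : ℕ} (hB : Fintype.card B = Δ) (hm0 : 0 ≤ m)
    (hm : ∀ v, X.even v → v ∉ Se → (hammingNorm (D.R v) : ℝ) ≤ m)
    {u : V} (hodd : ¬ X.even u) {t : ℝ} (H : Finset A)
    (hH : ∀ a ∈ H, t + deg X.col Se u ≤ D.crossWeight u a) :
    #H * t ≤ Δ * m := by
  classical
  refine le_trans ?_ (D.sum_crossWeight_le hB hm0 hm hodd {b | X.col b u ∉ Se} (by simp))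
  have h1 : ∀ a ∈ H,
      t ≤ (#{b ∈ ({b | X.col b u ∉ Se} : Finset B) | D.R (X.col b u) a b ≠ 0} : ℝ) := by
    intro a ha
    have h2 : D.crossWeight u a ≤
        #{b ∈ ({b | X.col b u ∉ Se} : Finset B) | D.R (X.col b u) a b ≠ 0} +
          deg X.col Se u := by
      refine le_trans (Finset.card_le_card fun b hb => ?_) (Finset.card_union_le _ _)
      simp only [Finset.mem_filter, Finset.mem_univ, true_and, Finset.mem_union] at hb ⊢
      tauto
    have h3 : (D.crossWeight u a : ℝ) ≤
        #{b ∈ ({b | X.col b u ∉ Se} : Finset B) | D.R (X.col b u) a b ≠ 0} +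
          deg X.col Se u := by exact_mod_cast h2
    have := hH a ha
    linarith
  calc #H * t = #H • t := (nsmul_eq_mul _ _).symm
    _ ≤ ∑ a ∈ H, (#{b ∈ ({b | X.col b u ∉ Se} : Finset B) | D.R (X.col b u) a b ≠ 0} : ℝ) :=
        Finset.card_nsmul_le_sum _ _ _ h1
    _ ≤ _ := Finset.sum_le_univ_sum_of_nonneg fun a => Nat.cast_nonneg _

variable [Fintype V]

/-- The odd vertices with a nonzero row that is shared with an even vertex outside `Se`. -/
noncomputable def oddRows (Se : Finset V) : Finset V := by
  classical exact {u | ¬ X.even u ∧ ∃ a, X.row a u ∉ Se ∧ D.R u a ≠ 0}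

/-- A vertex of `oddRows` has many active neighbours. -/
theorem le_deg_of_mem_oddRows (hst : D.RowStalled) (hd : d ≤ minDist CB)
    (hS₀ : ∀ v, X.even v → v ∉ S₀ → D.own v = 0)
    (hm : ∀ v, X.even v → v ∉ Se → (hammingNorm (D.C v) : ℝ) ≤ m)
    {u : V} (hu : u ∈ D.oddRows Se) : d / 2 - m ≤ deg X.col S₀ u := by
  classical
  simp only [oddRows, Finset.mem_filter, Finset.mem_univ, true_and] at hu
  obtain ⟨hodd, a, haS, ha⟩ := hu
  have hv : X.even (X.row a u) := (X.even_row a u).2 hodd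
  have h1 := D.minDist_le_of_rowStalled hst hv (a := a) (by rwa [D.R_row]) hd
  have h2 : (hammingNorm fun b => D.foreign (X.row a u) (a, b)) ≤ deg X.col S₀ u := by
    refine Finset.card_le_card fun b hb => ?_
    simp only [Finset.mem_filter, Finset.mem_univ, true_and] at hb ⊢
    rw [foreign_eq_own, ← X.row_col, X.row_row] at hb
    by_contra hn
    rw [hS₀ _ ((X.even_col b u).2 hodd) hn] at hb
    exact hb rfl
  have h3 := hm _ hv haS
  have h4 : ((hammingNorm fun b => D.foreign (X.row a u) (a, b) : ℕ) : ℝ) ≤ deg X.col S₀ u := by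
    exact_mod_cast h2
  push_cast at h1
  linarith

/-- A row of large cross weight at an odd vertex provides its even vertex with many neighbours
in `oddRows`. -/
theorem le_deg_oddRows {v : V} (hv : X.even v) (a : A) :
    (D.crossWeight (X.row a v) a : ℝ) - deg X.col Se (X.row a v) ≤
      deg X.col (D.oddRows Se) v := by
  classical
  have h : D.crossWeight (X.row a v) a ≤
      deg X.col (D.oddRows Se) v + deg X.col Se (X.row a v) := by
    refine le_trans (Finset.card_le_card fun b hb => ?_) (Finset.card_union_le _ _)
    simp only [Finset.mem_filter, Finset.mem_univ, true_and, Finset.mem_union] at hb ⊢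
    by_cases hbS : X.col b (X.row a v) ∈ Se
    · exact Or.inr hbS
    · left
      simp only [oddRows, Finset.mem_filter, Finset.mem_univ, true_and, X.even_col, not_not]
      refine ⟨hv, a, by rwa [X.row_col], ?_⟩
      rw [← D.R_row, X.row_col]
      exact fun h => hb (congrFun h b)
  have : (D.crossWeight (X.row a v) a : ℝ) ≤
      deg X.col (D.oddRows Se) v + deg X.col Se (X.row a v) := by exact_mod_cast h
  linarith

end Rows

end LocalDecomp

/-! ### Minimal decompositions of a stalled mismatch -/

namespace LocalDecomp

variable {V A B : Type*} {X : SquareComplex V A B} {CA : Code A} {CB : Code B}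
  [Fintype A] [Fintype B]

/-- A decomposition of locally minimal norm of a stalled mismatch, together with the relations
between the parameters that hold for large degree `Δ`: the component codes have distance at least
`d` and their dual tensor code is `w`-robust with `P`-resistance to puncturing. The even vertices
whose own part weighs more than `τ` are considered exceptional, and the other ones will have at
most `m` nonzero rows and columns. -/
structure IsStalledMinimal (D : LocalDecomp X CA CB) (Δ : ℕ) (d w P m τ : ℝ) : Prop where
  card_A : Fintype.card A = Δ
  card_B : Fintype.card B = Δ
  dist_A : d ≤ minDist CA
  dist_B : d ≤ minDist CB
  robust : IsRobustPunctured CA CB w P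
  minimal : ∀ v r c, (∀ a, r a ∈ CB) → (∀ b, c b ∈ CA) → arr r c = D.own v →
    hammingNorm (D.R v) + hammingNorm (D.C v) ≤ hammingNorm r + hammingNorm c
  stalled : ∀ v, X.even v → ∀ x ∈ dualTensor CA CB,
    hammingNorm (D.view v) ≤ hammingNorm (D.view v + x)
  P_pos : 0 < P
  w_pos : 0 < w
  P_le : 40 * P ≤ d
  w_le : 2 * w ≤ d * P
  m_nonneg : 0 ≤ m
  m_le : m ≤ P
  mul_m_le : 8 * Δ * m ≤ w
  τ_le : 2 * τ ≤ m * d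
  τ_le_w : τ ≤ w

/-- The even vertices whose own part weighs more than `τ`. -/
noncomputable def exceptional [Fintype V] (D : LocalDecomp X CA CB) (τ : ℝ) : Finset V := by
  classical exact {v | X.even v ∧ τ < hammingNorm (D.own v)}

theorem exceptional_swap [Fintype V] (D : LocalDecomp X CA CB) (τ : ℝ) :
    D.swap.exceptional τ = D.exceptional τ := by
  ext v
  have h2 : D.swap.own v = fun p => D.own v (p.2, p.1) := funext fun p => D.own_swap v _ _
  have h3 : X.swap.even v ↔ X.even v := Iff.rfl
  simp only [exceptional, Finset.mem_filter, Finset.mem_univ, true_and, h2,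
    hammingNorm_comp_swap, h3]

theorem deg_add_card_compl {L : Type*} [Fintype L] (nbr : L → V → V) (T : Finset V) (v : V)
    (S : Finset L) (hS : ∀ l, l ∈ S ↔ nbr l v ∉ T) : deg nbr T v + #S = Fintype.card L := by
  classical
  have : S = ({l | ¬ nbr l v ∈ T} : Finset L) := by
    ext l
    simp [hS]
  rw [this, deg]
  exact Finset.card_filter_add_card_filter_not _

namespace IsStalledMinimal

variable {D : LocalDecomp X CA CB} {Δ : ℕ} {d w P m τ : ℝ}

theorem rowStalled (h : D.IsStalledMinimal Δ d w P m τ) : D.RowStalled := by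
  intro v hv a
  have h1 := h.stalled v hv (singleRow a (D.R v a)) (mem_dualTensor_iff.2
    ⟨fun a' b => singleRow a (D.R v a) (a', b), 0, fun a' => ?_, fun b => CA.zero_mem, ?_⟩)
  · have h2 := hammingNorm_add_singleRow (D.view v) a (D.R v a)
    omega
  · by_cases ha : a' = a
    · simpa [singleRow, ha] using D.mem_R v a
    · simp only [singleRow, ha, if_false]
      exact CB.zero_mem
  · ext p
    simp [arr]

/-- The situation is symmetric under the exchange of rows and columns. -/
theorem swap (h : D.IsStalledMinimal Δ d w P m τ) : D.swap.IsStalledMinimal Δ d w P m τ where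
  card_A := h.card_B
  card_B := h.card_A
  dist_A := h.dist_B
  dist_B := h.dist_A
  robust := h.robust.swap
  minimal := by
    intro v c r hc hr heq
    have h1 := h.minimal v r c hr hc (by
      ext ⟨a, b⟩
      rw [← own_swap, ← heq]
      exact add_comm _ _)
    change hammingNorm (D.C v) + hammingNorm (D.R v) ≤ _
    omega
  stalled := by
    intro v hv x hx
    have h1 := h.stalled v hv _ (mem_dualTensor_swap hx)
    rw [← hammingNorm_comp_swap (D.view v), ← hammingNorm_comp_swap (D.view v + _)] at h1
    have h2 : D.swap.view v = fun p => D.view v (p.2, p.1) := funext fun p => D.view_swap v _ _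
    rw [h2]
    exact h1
  P_pos := h.P_pos
  w_pos := h.w_pos
  P_le := h.P_le
  w_le := h.w_le
  m_nonneg := h.m_nonneg
  m_le := h.m_le
  mul_m_le := h.mul_m_le
  τ_le := h.τ_le
  τ_le_w := h.τ_le_w

/-- Robustness with puncturing, in the form used below: a dual tensor codeword that is light on a
large rectangle is a sum of codewords on few rows and columns. -/
theorem exists_few_rows_cols (h : D.IsStalledMinimal Δ d w P m τ) {A₀ : Finset A} {B₀ : Finset B}
    (hA : (Fintype.card A : ℝ) - #A₀ ≤ P) (hB : (Fintype.card B : ℝ) - #B₀ ≤ P)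
    {x : A × B → ZMod 2} (hx : x ∈ dualTensor CA CB) (hw : (weightOn A₀ B₀ x : ℝ) ≤ w) :
    ∃ (A' : Finset A) (B' : Finset B) (r : A → B → ZMod 2) (c : B → A → ZMod 2),
      (#A' : ℝ) ≤ 2 * P ∧ (#B' : ℝ) ≤ 2 * P ∧ (∀ a, r a ∈ CB) ∧ (∀ b, c b ∈ CA) ∧
      (∀ a, a ∉ A' → r a = 0) ∧ (∀ b, b ∉ B' → c b = 0) ∧ arr r c = x := by
  have hP := h.P_pos
  have hPd := h.P_le
  have hAB : Fintype.card A = Fintype.card B := h.card_A.trans h.card_B.symm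
  obtain ⟨n, hn1, hn2, hn3, hn4⟩ : ∃ n : ℕ, Fintype.card A ≤ #A₀ + n ∧
      Fintype.card B ≤ #B₀ + n ∧ n ≤ Fintype.card A ∧ (n : ℝ) ≤ P := by
    refine ⟨max (Fintype.card A - #A₀) (Fintype.card B - #B₀), by omega, by omega, by omega, ?_⟩
    have h1 : ((Fintype.card A - #A₀ : ℕ) : ℝ) ≤ P := by
      rw [Nat.cast_sub (Finset.card_le_univ A₀)]
      exact hA
    have h2 : ((Fintype.card B - #B₀ : ℕ) : ℝ) ≤ P := by
      rw [Nat.cast_sub (Finset.card_le_univ B₀)]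
      exact hB
    rw [Nat.cast_max]
    exact max_le h1 h2
  obtain ⟨A', B', hA', hB', h0⟩ := exists_cover h.robust hn4 (by linarith) h.dist_A h.dist_B
    hn1 hn2 hn3 (hAB ▸ hn3) hx hw
  have hfrac : (weightOn A₀ B₀ x : ℝ) / (d - n) ≤ P := by
    rw [div_le_iff₀ (by linarith)]
    have := h.w_le
    nlinarith
  have hA2 : (#A' : ℝ) ≤ 2 * P := by linarith
  have hB2 : (#B' : ℝ) ≤ 2 * P := by linarith
  obtain ⟨r, c, hr, hc, rfl⟩ := mem_dualTensor_iff.1 hx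
  have hAd : #A' < minDist CA := by
    have : (#A' : ℝ) < minDist CA := by linarith [h.dist_A]
    exact_mod_cast this
  have hBd : #B' < minDist CB := by
    have : (#B' : ℝ) < minDist CB := by linarith [h.dist_B]
    exact_mod_cast this
  obtain ⟨r', c', hr', hc', hrA, hcB, heq⟩ := exists_rows_cols_of_cover hr hc hAd hBd h0
  exact ⟨A', B', r', c', hA2, hB2, hr', hc', hrA, hcB, heq⟩

/-- By minimality, a vertex whose own part is light on a large rectangle has few nonzero rows and
columns. -/
theorem norm_le_of_weightOn_le (h : D.IsStalledMinimal Δ d w P m τ) {A₀ : Finset A}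
    {B₀ : Finset B} (hA : (Fintype.card A : ℝ) - #A₀ ≤ P) (hB : (Fintype.card B : ℝ) - #B₀ ≤ P)
    {v : V} (hw : (weightOn A₀ B₀ (D.own v) : ℝ) ≤ w) :
    (hammingNorm (D.R v) : ℝ) + hammingNorm (D.C v) ≤ 4 * P := by
  obtain ⟨A', B', r, c, hA', hB', hr, hc, hrA, hcB, heq⟩ :=
    h.exists_few_rows_cols hA hB (D.own_mem v) hw
  have h1 := h.minimal v r c hr hc heq
  have h2 : hammingNorm r ≤ #A' := Finset.card_le_card fun a ha => by
    by_contra hn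
    exact (Finset.mem_filter.1 ha).2 (hrA a hn)
  have h3 : hammingNorm c ≤ #B' := Finset.card_le_card fun a ha => by
    by_contra hn
    exact (Finset.mem_filter.1 ha).2 (hcB a hn)
  have h4 : (hammingNorm (D.R v) : ℝ) + hammingNorm (D.C v) ≤ #A' + #B' := by
    exact_mod_cast h1.trans (add_le_add h2 h3)
  linarith

/-- A dual tensor codeword of weight at most `w` is covered by `|x| / d` rows and columns. -/
theorem exists_cover_of_le (h : D.IsStalledMinimal Δ d w P m τ) {x : A × B → ZMod 2}
    (hx : x ∈ dualTensor CA CB) (hw : (hammingNorm x : ℝ) ≤ w) :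
    ∃ (A' : Finset A) (B' : Finset B), (#A' : ℝ) ≤ hammingNorm x / d ∧
      (#B' : ℝ) ≤ hammingNorm x / d ∧ ∀ a b, a ∉ A' → b ∉ B' → x (a, b) = 0 := by
  have h1 := weightOn_le_hammingNorm Finset.univ Finset.univ x
  have h1' : (weightOn Finset.univ Finset.univ x : ℝ) ≤ hammingNorm x := by exact_mod_cast h1
  have hd : 0 < d := by linarith [h.P_pos, h.P_le]
  obtain ⟨A', B', hA', hB', h0⟩ := exists_cover (n := 0) (A₀ := Finset.univ) (B₀ := Finset.univ)
    h.robust (by simpa using h.P_pos.le) (by simpa using hd) h.dist_A h.dist_B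
    (by simp) (by simp) (by simp) (by simp) hx (h1'.trans hw)
  have h2 : (weightOn Finset.univ Finset.univ x : ℝ) / d ≤ hammingNorm x / d := by gcongr
  simp only [Nat.cast_zero, zero_add, sub_zero] at hA' hB'
  exact ⟨A', B', hA'.trans h2, hB'.trans h2, h0⟩

theorem card_le_m (h : D.IsStalledMinimal Δ d w P m τ) {v : V}
    (hv : (hammingNorm (D.own v) : ℝ) ≤ τ) :
    (hammingNorm (D.R v) : ℝ) + hammingNorm (D.C v) ≤ m := by
  have hd : 0 < d := by linarith [h.P_pos, h.P_le]
  obtain ⟨A', B', hA', hB', h0⟩ := h.exists_cover_of_le (D.own_mem v) (hv.trans h.τ_le_w)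
  have h3 : (hammingNorm (D.own v) : ℝ) / d ≤ m / 2 := by
    rw [div_le_iff₀ hd]
    linarith [h.τ_le]
  have hmP := h.m_le
  have hPd := h.P_le
  have hAd : #A' < minDist CA := by
    have : (#A' : ℝ) < minDist CA := by linarith [h.dist_A, h.P_pos]
    exact_mod_cast this
  have hBd : #B' < minDist CB := by
    have : (#B' : ℝ) < minDist CB := by linarith [h.dist_B, h.P_pos]
    exact_mod_cast this
  obtain ⟨r, c, hr, hc, hrA, hcB, heq⟩ :=
    exists_rows_cols_of_cover (D.mem_R v) (D.mem_C v) hAd hBd h0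
  have h1 := h.minimal v r c hr hc heq
  have h2 : hammingNorm r ≤ #A' := Finset.card_le_card fun a ha => by
    by_contra hn
    exact (Finset.mem_filter.1 ha).2 (hrA a hn)
  have h3 : hammingNorm c ≤ #B' := Finset.card_le_card fun a ha => by
    by_contra hn
    exact (Finset.mem_filter.1 ha).2 (hcB a hn)
  have h4 : (hammingNorm (D.R v) : ℝ) + hammingNorm (D.C v) ≤ #A' + #B' := by
    exact_mod_cast h1.trans (add_le_add h2 h3)
  linarith

/-- The minimum distance of the dual tensor code. -/
theorem le_hammingNorm (h : D.IsStalledMinimal Δ d w P m τ) {x : A × B → ZMod 2}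
    (hx : x ∈ dualTensor CA CB) (h0 : x ≠ 0) (hdw : d ≤ w) : d ≤ hammingNorm x := by
  by_contra! hlt
  have hd : 0 < d := by linarith [h.P_pos, h.P_le]
  obtain ⟨A', B', hA', hB', hz⟩ := h.exists_cover_of_le hx (hlt.le.trans hdw)
  have h1 : (hammingNorm x : ℝ) / d < 1 := by rwa [div_lt_one hd]
  have hA0 : A' = ∅ := by
    have : (#A' : ℝ) < 1 := by linarith
    exact Finset.card_eq_zero.1 (by exact_mod_cast Nat.lt_one_iff.1 (by exact_mod_cast this))
  have hB0 : B' = ∅ := by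
    have : (#B' : ℝ) < 1 := by linarith
    exact Finset.card_eq_zero.1 (by exact_mod_cast Nat.lt_one_iff.1 (by exact_mod_cast this))
  exact h0 (funext fun p => hz p.1 p.2 (by simp [hA0]) (by simp [hB0]))

theorem hammingNorm_own_le (h : D.IsStalledMinimal Δ d w P m τ) {v : V} (hv : X.even v) :
    hammingNorm (D.own v) ≤ 2 * hammingNorm (D.foreign v) := by
  have h1 := h.stalled v hv _ (D.own_mem v)
  have h2 := hammingNorm_add_le (D.view v) (D.foreign v)
  have h3 : D.view v + D.own v = D.foreign v := by
    rw [view, add_comm (D.own v), add_assoc, add_self_zmodTwo, add_zero]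
  have h4 : D.view v + D.foreign v = D.own v := by
    rw [view, add_assoc, add_self_zmodTwo, add_zero]
  rw [h3] at h1
  rw [h4] at h2
  omega

variable [Fintype V]

theorem R_le (h : D.IsStalledMinimal Δ d w P m τ) :
    ∀ v, X.even v → v ∉ D.exceptional τ → (hammingNorm (D.R v) : ℝ) ≤ m := by
  intro v hv hvS
  have h1 : (hammingNorm (D.own v) : ℝ) ≤ τ := by simpa [exceptional, hv] using hvS
  have := h.card_le_m h1
  have h2 : (0 : ℝ) ≤ hammingNorm (D.C v) := Nat.cast_nonneg _
  linarith

theorem C_le (h : D.IsStalledMinimal Δ d w P m τ) :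
    ∀ v, X.even v → v ∉ D.exceptional τ → (hammingNorm (D.C v) : ℝ) ≤ m := by
  rw [← D.exceptional_swap]
  exact h.swap.R_le

/-- At an odd vertex, the foreign part is light on the rectangle of rows and columns shared with
vertices that are not exceptional. -/
theorem weightOn_foreign_le (h : D.IsStalledMinimal Δ d w P m τ) {u : V} (hu : ¬ X.even u)
    {A₀ : Finset A} {B₀ : Finset B} (hA₀ : ∀ a ∈ A₀, X.row a u ∉ D.exceptional τ)
    (hB₀ : ∀ b ∈ B₀, X.col b u ∉ D.exceptional τ) :
    (weightOn A₀ B₀ (D.foreign u) : ℝ) ≤ w / 4 := by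
  classical
  have h1 := D.sum_crossWeight_le h.card_B h.m_nonneg h.R_le hu B₀ hB₀
  have h2 := D.swap.sum_crossWeight_le h.card_A h.m_nonneg h.C_le hu A₀ hA₀
  have h3 : weightOn A₀ B₀ (D.foreign u) ≤ (∑ a, #{b ∈ B₀ | D.R (X.col b u) a b ≠ 0}) +
      ∑ b, #{a ∈ A₀ | D.C (X.row a u) b a ≠ 0} := by
    have h4 : weightOn A₀ B₀ (fun p => D.R (X.col p.2 u) p.1 p.2) ≤
        ∑ a, #{b ∈ B₀ | D.R (X.col b u) a b ≠ 0} := by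
      rw [weightOn, Finset.card_filter, Finset.sum_product]
      simp only [Finset.card_filter]
      exact Finset.sum_le_univ_sum_of_nonneg fun a => Nat.zero_le _
    have h5 : weightOn A₀ B₀ (fun p => D.C (X.row p.1 u) p.2 p.1) ≤
        ∑ b, #{a ∈ A₀ | D.C (X.row a u) b a ≠ 0} := by
      rw [weightOn, Finset.card_filter, Finset.sum_product_right]
      simp only [Finset.card_filter]
      exact Finset.sum_le_univ_sum_of_nonneg fun a => Nat.zero_le _
    exact (weightOn_add_le A₀ B₀ (fun p => D.R (X.col p.2 u) p.1 p.2)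
      fun p => D.C (X.row p.1 u) p.2 p.1).trans (add_le_add h4 h5)
  have h6 : (weightOn A₀ B₀ (D.foreign u) : ℝ) ≤
      (∑ a, #{b ∈ B₀ | D.R (X.col b u) a b ≠ 0} : ℝ) +
      (∑ b, #{a ∈ A₀ | D.C (X.row a u) b a ≠ 0} : ℝ) := by exact_mod_cast h3
  have h7 : (∑ b, #{a ∈ A₀ | D.C (X.row a u) b a ≠ 0} : ℝ) ≤ Δ * m := h2
  have := h.mul_m_le
  linarith

end IsStalledMinimal

/-! ### The first decoding step at a single vertex -/

namespace IsStalledMinimal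

variable [Fintype V] {D : LocalDecomp X CA CB} {Δ : ℕ} {d w P m τ : ℝ}

theorem card_sub_card_inter_le {L : Type*} [Fintype L] [DecidableEq L] {S T : Finset L} {p : ℝ}
    (hS : (Fintype.card L : ℝ) - #S ≤ p / 2) (hT : (Fintype.card L : ℝ) - #T ≤ p / 2) :
    (Fintype.card L : ℝ) - #(S ∩ T) ≤ p := by
  have h1 := Finset.card_union_add_card_inter S T
  have h2 := Finset.card_le_univ (S ∪ T)
  have h3 : (#S + #T : ℝ) ≤ Fintype.card L + #(S ∩ T) := by
    exact_mod_cast (by omega : #S + #T ≤ Fintype.card L + #(S ∩ T))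
  linarith

/-- Few rows at an odd vertex `u` are exceptional or of large cross weight. -/
theorem card_bad_rows_le (h : D.IsStalledMinimal Δ d w P m τ) {u : V} (hu : ¬ X.even u)
    (hrow : (deg X.row (D.exceptional τ) u : ℝ) ≤ P / 2)
    (hcol : (deg X.col (D.exceptional τ) u : ℝ) ≤ P / 2) (H : Finset A)
    (hH : ∀ a ∈ H, X.row a u ∈ D.exceptional τ ∨ d / 4 ≤ D.crossWeight u a) : (#H : ℝ) ≤ P := by
  classical
  have hPd := h.P_le
  have hP := h.P_pos
  have h1 := D.card_heavy_mul_le h.card_B h.m_nonneg h.R_le hu (t := d / 8)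
    {a | d / 4 ≤ D.crossWeight u a} (by
      intro a ha
      simp only [Finset.mem_filter, Finset.mem_univ, true_and] at ha
      linarith)
  have h2 : #H ≤ deg X.row (D.exceptional τ) u + #{a : A | d / 4 ≤ D.crossWeight u a} := by
    refine le_trans (Finset.card_le_card fun a ha => ?_) (Finset.card_union_le _ _)
    simp only [Finset.mem_filter, Finset.mem_univ, true_and, Finset.mem_union]
    exact hH a ha
  have h3 : (#H : ℝ) ≤
      deg X.row (D.exceptional τ) u + #{a : A | d / 4 ≤ D.crossWeight u a} := by
    exact_mod_cast h2
  have h4 : (#{a : A | d / 4 ≤ D.crossWeight u a} : ℝ) ≤ P / 2 := by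
    have h5 := h.mul_m_le
    have h6 := h.w_le
    by_contra! hlt
    nlinarith
  linarith

/-- A row shared with a vertex that is not exceptional on which, together with few columns, the
foreign part weighs half the distance has large cross weight. -/
theorem le_crossWeight_of_foreign (h : D.IsStalledMinimal Δ d w P m τ) {u : V} (hu : ¬ X.even u)
    {B' : Finset B} (hB' : (#B' : ℝ) ≤ 3 * P) (a : A) (ha : X.row a u ∉ D.exceptional τ)
    (h1 : minDist CB ≤ 2 * (hammingNorm (fun b => D.foreign u (a, b)) + #B')) :
    d / 4 ≤ D.crossWeight u a := by
  have h2 := hammingNorm_add_le (fun b => D.R (X.col b u) a b) fun b => D.C (X.row a u) b a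
  have h3 := hammingNorm_apply_le (D.C (X.row a u)) a
  have h4 := h.C_le _ ((X.even_row a u).2 hu) ha
  have h5 : minDist CB ≤
      2 * (D.crossWeight u a + hammingNorm (D.C (X.row a u)) + #B') := by
    refine h1.trans (Nat.mul_le_mul_left _ (Nat.add_le_add_right ?_ _))
    exact h2.trans (Nat.add_le_add_left h3 _)
  have h6 : (minDist CB : ℝ) ≤
      2 * (D.crossWeight u a + hammingNorm (D.C (X.row a u)) + #B') := by exact_mod_cast h5
  have := h.dist_B
  have := h.m_le
  have := h.P_le
  linarith

/-- The rows of the foreign part that are not bad are too light to be corrected. -/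
theorem foreign_row_lt (h : D.IsStalledMinimal Δ d w P m τ) {u : V} (hu : ¬ X.even u)
    {B' : Finset B} (hB' : (#B' : ℝ) ≤ 3 * P) (a : A)
    (ha : ¬ (X.row a u ∈ D.exceptional τ ∨ d / 4 ≤ D.crossWeight u a)) :
    2 * (hammingNorm (fun b => D.foreign u (a, b)) + #B') < minDist CB := by
  rw [not_or, not_le] at ha
  have h2 := hammingNorm_add_le (fun b => D.R (X.col b u) a b) fun b => D.C (X.row a u) b a
  have h3 := hammingNorm_apply_le (D.C (X.row a u)) a
  have h4 := h.C_le _ ((X.even_row a u).2 hu) ha.1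
  have h5 : 2 * (hammingNorm (fun b => D.foreign u (a, b)) + #B') ≤
      2 * (D.crossWeight u a + hammingNorm (D.C (X.row a u)) + #B') :=
    Nat.mul_le_mul_left _ (Nat.add_le_add_right (h2.trans (Nat.add_le_add_left h3 _)) _)
  refine lt_of_le_of_lt h5 ?_
  have h6 : 2 * ((D.crossWeight u a : ℝ) + hammingNorm (D.C (X.row a u)) + #B') <
      minDist CB := by
    have := h.dist_B
    have := h.m_le
    have := h.P_le
    have := h.P_pos
    linarith [ha.2]
  exact_mod_cast h6

/-- The first decoding step at an odd vertex `u` with few exceptional neighbours: the own part of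
`u` is corrected up to rows and columns that are shared with exceptional vertices or have large
cross weight. If the criterion of the decoder is met, robustness shows that the codeword added
agrees with the own part up to few rows and columns, which the cleaning reduces to the claimed
ones. Otherwise the own part itself is light, and the same follows from the decoder being
stalled. -/
theorem exists_residual (h : D.IsStalledMinimal Δ d w P m τ) {ε : ℝ}
    (hP : (Δ : ℝ) ^ (1 - ε) = P) (hw : (Δ : ℝ) ^ (3 / 2 - ε) = w) {u : V} (hu : ¬ X.even u)
    (hrow : (deg X.row (D.exceptional τ) u : ℝ) ≤ P / 2)
    (hcol : (deg X.col (D.exceptional τ) u : ℝ) ≤ P / 2)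
    {inc : A × B → ZMod 2} (hinc : IsTweakedUpdate ε Δ CA CB (D.view u) inc) :
    ∃ (r : A → B → ZMod 2) (c : B → A → ZMod 2), (∀ a, r a ∈ CB) ∧ (∀ b, c b ∈ CA) ∧
      arr r c = D.own u + inc ∧
      (∀ a, X.row a u ∉ D.exceptional τ → r a ≠ 0 → d / 4 ≤ D.crossWeight u a) ∧
      (∀ b, X.col b u ∉ D.exceptional τ → c b ≠ 0 → d / 4 ≤ D.swap.crossWeight u b) := by
  classical
  have hP0 := h.P_pos
  have hPd := h.P_le
  have hmP := h.m_le
  set A₁ : Finset A := {a | X.row a u ∉ D.exceptional τ} with hA₁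
  set B₁ : Finset B := {b | X.col b u ∉ D.exceptional τ} with hB₁
  have hA₁c : (Fintype.card A : ℝ) - #A₁ ≤ P / 2 := by
    have h1 := deg_add_card_compl X.row (D.exceptional τ) u A₁ (by simp [hA₁])
    have h2 : (deg X.row (D.exceptional τ) u : ℝ) + #A₁ = Fintype.card A := by exact_mod_cast h1
    linarith
  have hB₁c : (Fintype.card B : ℝ) - #B₁ ≤ P / 2 := by
    have h1 := deg_add_card_compl X.col (D.exceptional τ) u B₁ (by simp [hB₁])
    have h2 : (deg X.col (D.exceptional τ) u : ℝ) + #B₁ = Fintype.card B := by exact_mod_cast h1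
    linarith
  have hfor := h.weightOn_foreign_le hu (A₀ := A₁) (B₀ := B₁) (by simp [hA₁]) (by simp [hB₁])
  have hsub : ∀ x : A × B → ZMod 2, D.view u + x = D.foreign u + (D.own u + x) := by
    intro x
    simp only [view]
    abel
  rcases hinc with ⟨A₀, B₀, r₀, c₀, hcrit, hclean, hfinal⟩ | ⟨hno, rfl⟩
  · obtain ⟨hA₀, hB₀, hr₀, hc₀, -, -, hlight⟩ := hcrit
    rw [hP] at hA₀ hB₀
    rw [hw] at hlight
    have hrc : D.own u + (r₀ + c₀) ∈ dualTensor CA CB := by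
      refine Submodule.add_mem _ (D.own_mem u) ?_
      rw [add_comm]
      exact Submodule.add_mem_sup hc₀ hr₀
    have hwt : (weightOn (A₀ ∩ A₁) (B₀ ∩ B₁) (D.own u + (r₀ + c₀)) : ℝ) ≤ w := by
      have h1 : D.own u + (r₀ + c₀) = D.foreign u + (D.view u + r₀ + c₀) := by
        rw [add_assoc, hsub, ← add_assoc (D.foreign u) (D.foreign u), add_self_zmodTwo, zero_add]
      have h2 := weightOn_add_le (A₀ ∩ A₁) (B₀ ∩ B₁) (D.foreign u) (D.view u + r₀ + c₀)
      rw [← h1] at h2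
      have h3 := weightOn_mono (Finset.inter_subset_right (s₁ := A₀) (s₂ := A₁))
        (Finset.inter_subset_right (s₁ := B₀) (s₂ := B₁)) (D.foreign u)
      have h4 := weightOn_mono (Finset.inter_subset_left (s₁ := A₀) (s₂ := A₁))
        (Finset.inter_subset_left (s₁ := B₀) (s₂ := B₁)) (D.view u + r₀ + c₀)
      have h5 : (weightOn (A₀ ∩ A₁) (B₀ ∩ B₁) (D.own u + (r₀ + c₀)) : ℝ) ≤
          weightOn A₁ B₁ (D.foreign u) + weightOn A₀ B₀ (D.view u + r₀ + c₀) := by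
        exact_mod_cast h2.trans (add_le_add h3 h4)
      linarith
    obtain ⟨A', B', r, c, hA', hB', hr, hc, hrA, hcB, heq⟩ := h.exists_few_rows_cols
      (card_sub_card_inter_le hA₀ hA₁c) (card_sub_card_inter_le hB₀ hB₁c) hrc hwt
    obtain ⟨HA, hHA⟩ : ∃ HA : Finset A, ∀ a, a ∈ HA ↔
        X.row a u ∈ D.exceptional τ ∨ d / 4 ≤ D.crossWeight u a :=
      ⟨({a | X.row a u ∈ D.exceptional τ ∨ d / 4 ≤ D.crossWeight u a} : Finset A), by simp⟩
    obtain ⟨HB, hHB⟩ : ∃ HB : Finset B, ∀ b, b ∈ HB ↔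
        X.col b u ∈ D.exceptional τ ∨ d / 4 ≤ D.swap.crossWeight u b :=
      ⟨({b | X.col b u ∈ D.exceptional τ ∨ d / 4 ≤ D.swap.crossWeight u b} : Finset B),
        by simp⟩
    have hHAc : (#HA : ℝ) ≤ P := h.card_bad_rows_le hu hrow hcol HA fun a ha => (hHA a).1 ha
    have hHBc : (#HB : ℝ) ≤ P := by
      refine h.swap.card_bad_rows_le hu ?_ ?_ HB fun b hb => ?_ <;> rw [exceptional_swap]
      exacts [hcol, hrow, (hHB b).1 hb]
    have hAc : (#(A' ∪ HA) : ℝ) ≤ 3 * P := by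
      have : (#(A' ∪ HA) : ℝ) ≤ #A' + #HA := by exact_mod_cast Finset.card_union_le _ _
      linarith
    have hBc : (#(B' ∪ HB) : ℝ) ≤ 3 * P := by
      have : (#(B' ∪ HB) : ℝ) ≤ #B' + #HB := by exact_mod_cast Finset.card_union_le _ _
      linarith
    have hcolrow : ∀ b, (fun a => D.swap.foreign u (b, a)) = fun a => D.foreign u (a, b) :=
      fun b => funext fun a => D.foreign_swap u a b
    have hrowlt : ∀ a, a ∉ A' ∪ HA →
        2 * (hammingNorm (fun b => D.foreign u (a, b)) + #(B' ∪ HB)) < minDist CB := by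
      intro a ha
      rw [Finset.mem_union, not_or, hHA] at ha
      exact h.foreign_row_lt hu hBc a ha.2
    have hcollt : ∀ b, b ∉ B' ∪ HB →
        2 * (hammingNorm (fun a => D.foreign u (a, b)) + #(A' ∪ HA)) < minDist CA := by
      intro b hb
      rw [Finset.mem_union, not_or, hHB] at hb
      rw [← hcolrow]
      exact h.swap.foreign_row_lt hu hAc b (by rw [exceptional_swap]; exact hb.2)
    have hstart : D.view u + r₀ + c₀ = D.foreign u + arr r c := by rw [add_assoc, hsub, heq]
    obtain ⟨r', c', hr', hc', hrA', hcB', heq'⟩ := exists_rows_cols_of_clean hrowlt hcollt hclean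
      ⟨r, c, hr, hc, fun a ha => hrA a fun hn => ha (Finset.mem_union_left _ hn),
        fun b hb => hcB b fun hn => hb (Finset.mem_union_left _ hn), hstart⟩
    have hres : arr r' c' = D.own u + inc := by
      have := heq'
      rw [hsub] at this
      exact (add_left_cancel this).symm
    rw [heq'] at hfinal
    refine ⟨r', c', hr', hc', hres, fun a ha h0 => ?_, fun b hb h0 => ?_⟩
    · exact h.le_crossWeight_of_foreign hu hBc a ha
        (minDist_le_of_clean_row hfinal (hr' a) h0 hcB')
    · refine h.swap.le_crossWeight_of_foreign hu hAc b (by rw [exceptional_swap]; exact hb) ?_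
      rw [hcolrow]
      exact minDist_le_of_clean_col hfinal (hc' b) h0 hrA'
  · have hown : (weightOn A₁ B₁ (D.own u) : ℝ) ≤ w := by
      by_contra! hlt
      have h1 := weightOn_add_le A₁ B₁ (D.view u) (D.foreign u)
      have h2 : D.view u + D.foreign u = D.own u := by
        rw [view, add_assoc, add_self_zmodTwo, add_zero]
      rw [h2] at h1
      have h3 : (weightOn A₁ B₁ (D.own u) : ℝ) ≤
          weightOn A₁ B₁ (D.view u) + weightOn A₁ B₁ (D.foreign u) := by exact_mod_cast h1
      have hrc : (fun p => D.R u p.1 p.2) + (fun p => D.C u p.2 p.1) = D.own u := rfl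
      refine hno ⟨A₁, B₁, fun p => D.R u p.1 p.2, fun p => D.C u p.2 p.1, ?_, ?_, D.mem_R u,
        D.mem_C u, ?_, ?_, ?_⟩
      · rwa [hP]
      · rwa [hP]
      · rw [hw]
        linarith
      · rw [hw, hrc]
        exact hlt
      · rw [hw, add_assoc, hrc, hsub, add_self_zmodTwo, add_zero]
        linarith [h.w_pos]
    have hnorm := h.norm_le_of_weightOn_le (by linarith) (by linarith) hown
    refine ⟨D.R u, D.C u, D.mem_R u, D.mem_C u, by rw [add_zero]; rfl, ?_, ?_⟩
    · intro a ha h0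
      have h1 := D.le_crossWeight_of_rowStalled h.rowStalled h.dist_B h.C_le hu ha h0
      have h2 : (0 : ℝ) ≤ hammingNorm (D.R u) := Nat.cast_nonneg _
      linarith
    · intro b hb h0
      have h1 := D.swap.le_crossWeight_of_rowStalled h.swap.rowStalled h.dist_A
        (Se := D.exceptional τ) h.R_le hu hb h0
      have h2 : (0 : ℝ) ≤ hammingNorm (D.C u) := Nat.cast_nonneg _
      have h3 : (hammingNorm (D.swap.C u) : ℝ) = hammingNorm (D.R u) := rfl
      linarith

end IsStalledMinimal

end LocalDecomp

/-! ### Counting active vertices -/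

namespace LocalDecomp

variable {V A B : Type*} {X : SquareComplex V A B} {CA : Code A} {CB : Code B}
  [Fintype A] [Fintype B] [Fintype V]

/-- The even vertices with a nonzero own part. -/
noncomputable def activeSet (D : LocalDecomp X CA CB) : Finset V := by
  classical exact {v | X.even v ∧ D.own v ≠ 0}

theorem own_eq_zero_of_notMem {D : LocalDecomp X CA CB} {v : V} (hv : X.even v)
    (h : v ∉ D.activeSet) : D.own v = 0 := by
  simpa [activeSet, hv] using h

theorem activeSet_swap (D : LocalDecomp X CA CB) : D.swap.activeSet = D.activeSet := by
  ext v
  have h1 : D.swap.own v = 0 ↔ D.own v = 0 := by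
    constructor <;> intro h <;> ext ⟨a, b⟩
    · rw [← own_swap, h]; rfl
    · rw [own_swap, h]; rfl
  have h3 : X.swap.even v ↔ X.even v := Iff.rfl
  simp only [activeSet, Finset.mem_filter, Finset.mem_univ, true_and, ne_eq, h1, h3]

theorem hammingNorm_foreign_le (D : LocalDecomp X CA CB) {v : V} (hv : X.even v) :
    hammingNorm (D.foreign v) ≤
      deg (fun p : A × B => X.row p.1 ∘ X.col p.2) D.activeSet v := by
  classical
  refine Finset.card_le_card fun p hp => ?_
  simp only [Finset.mem_filter, Finset.mem_univ, true_and, Function.comp_apply] at hp ⊢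
  by_contra hn
  have heven : X.even (X.row p.1 (X.col p.2 v)) := by
    rw [X.even_row, X.even_col, not_not]
    exact hv
  rw [D.foreign_eq_own v p.1 p.2, own_eq_zero_of_notMem heven hn] at hp
  exact hp rfl

/-- The odd vertices with more than `P / 2` exceptional neighbours of one kind. -/
noncomputable def badSet (D : LocalDecomp X CA CB) (τ P : ℝ) : Finset V := by
  classical exact {u | ¬ X.even u ∧
    (P / 2 < deg X.row (D.exceptional τ) u ∨ P / 2 < deg X.col (D.exceptional τ) u)}

theorem badSet_swap (D : LocalDecomp X CA CB) (τ P : ℝ) :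
    D.swap.badSet τ P = D.badSet τ P := by
  ext u
  have h3 : X.swap.even u ↔ X.even u := Iff.rfl
  simp only [badSet, Finset.mem_filter, Finset.mem_univ, true_and, exceptional_swap, h3]
  exact and_congr_right fun _ => or_comm

theorem deg_le_of_notMem_badSet {D : LocalDecomp X CA CB} {τ P : ℝ} {u : V} (hu : ¬ X.even u)
    (h : u ∉ D.badSet τ P) : (deg X.row (D.exceptional τ) u : ℝ) ≤ P / 2 ∧
      (deg X.col (D.exceptional τ) u : ℝ) ≤ P / 2 := by
  simpa [badSet, hu] using h

/-- The first decoding step leaves, at the odd vertices that are not bad, only wrong rows that are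
shared with exceptional vertices or have large cross weight. -/
def RowResidual (D D' : LocalDecomp X CA CB) (d P τ : ℝ) : Prop :=
  ∀ u, ¬ X.even u → u ∉ D.badSet τ P → ∀ a, X.row a u ∉ D.exceptional τ → D'.R u a ≠ 0 →
    d / 4 ≤ D.crossWeight u a

/-- The even vertices, not exceptional, that see a wrong row at an odd vertex that is not bad. -/
noncomputable def residualRows (D D' : LocalDecomp X CA CB) (τ P : ℝ) : Finset V := by
  classical exact {v | X.even v ∧ v ∉ D.exceptional τ ∧
    ∃ a, X.row a v ∉ D.badSet τ P ∧ D'.R v a ≠ 0}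

/-- After the first step, an active vertex is exceptional, or adjacent to a bad vertex, or sees a
wrong row or column. -/
theorem card_activeSet_le (D D' : LocalDecomp X CA CB) (τ P : ℝ) {Δ : ℕ}
    (hA : Fintype.card A = Δ) (hB : Fintype.card B = Δ) :
    #D'.activeSet ≤ #(D.exceptional τ) + 2 * Δ * #(D.badSet τ P) +
      #(D.residualRows D' τ P) + #(D.swap.residualRows D'.swap τ P) := by
  classical
  set U := D.badSet τ P with hU
  have hsub : D'.activeSet ⊆ D.exceptional τ ∪
      ((U ×ˢ Finset.univ).image (fun p : V × A => X.row p.2 p.1) ∪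
        (U ×ˢ Finset.univ).image (fun p : V × B => X.col p.2 p.1)) ∪
      D.residualRows D' τ P ∪ D.swap.residualRows D'.swap τ P := by
    intro v hv
    simp only [activeSet, Finset.mem_filter, Finset.mem_univ, true_and] at hv
    obtain ⟨hev, h0⟩ := hv
    by_contra hn
    simp only [Finset.mem_union, not_or] at hn
    obtain ⟨⟨⟨h1, h2, h3⟩, h4⟩, h5⟩ := hn
    refine h0 (funext fun p => ?_)
    have hR : D'.R v p.1 = 0 := by
      by_contra hR
      simp only [residualRows, Finset.mem_filter, Finset.mem_univ, true_and, not_and,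
        not_exists] at h4
      refine h4 hev h1 p.1 (fun hmem => h2 ?_) hR
      exact Finset.mem_image.2 ⟨(X.row p.1 v, p.1), by simpa using hmem, X.row_row _ _⟩
    have hC : D'.C v p.2 = 0 := by
      by_contra hC
      simp only [residualRows, Finset.mem_filter, Finset.mem_univ, true_and, not_and,
        not_exists, exceptional_swap, badSet_swap] at h5
      refine h5 hev h1 p.2 (fun hmem => h3 ?_) hC
      exact Finset.mem_image.2 ⟨(X.col p.2 v, p.2), Finset.mem_product.2 ⟨hmem, by simp⟩,
        X.col_col _ _⟩
    simp [own, arr, hR, hC]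
  have h1 := Finset.card_le_card hsub
  have h2 := Finset.card_union_le (D.exceptional τ ∪
      ((U ×ˢ Finset.univ).image (fun p : V × A => X.row p.2 p.1) ∪
        (U ×ˢ Finset.univ).image (fun p : V × B => X.col p.2 p.1)) ∪
      D.residualRows D' τ P) (D.swap.residualRows D'.swap τ P)
  have h3 := Finset.card_union_le (D.exceptional τ ∪
      ((U ×ˢ Finset.univ).image (fun p : V × A => X.row p.2 p.1) ∪
        (U ×ˢ Finset.univ).image (fun p : V × B => X.col p.2 p.1)))
      (D.residualRows D' τ P)
  have h4 := Finset.card_union_le (D.exceptional τ)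
      ((U ×ˢ Finset.univ).image (fun p : V × A => X.row p.2 p.1) ∪
        (U ×ˢ Finset.univ).image (fun p : V × B => X.col p.2 p.1))
  have h5 := Finset.card_union_le ((U ×ˢ Finset.univ).image (fun p : V × A => X.row p.2 p.1))
        ((U ×ˢ Finset.univ).image (fun p : V × B => X.col p.2 p.1))
  have h6 : #((U ×ˢ Finset.univ).image (fun p : V × A => X.row p.2 p.1)) ≤ #U * Δ := by
    refine Finset.card_image_le.trans ?_
    rw [Finset.card_product, Finset.card_univ, hA]
  have h7 : #((U ×ˢ Finset.univ).image (fun p : V × B => X.col p.2 p.1)) ≤ #U * Δ := by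
    refine Finset.card_image_le.trans ?_
    rw [Finset.card_product, Finset.card_univ, hB]
  have h8 : 2 * Δ * #U = #U * Δ + #U * Δ := by ring
  omega

namespace IsStalledMinimal

variable {D : LocalDecomp X CA CB} {Δ : ℕ} {d w P m τ θ : ℝ}

theorem card_exceptional_mul_le (h : D.IsStalledMinimal Δ d w P m τ)
    (hsq : Expands (fun p : A × B => X.row p.1 ∘ X.col p.2) (Δ * θ) (16 * Δ ^ 2)) (hτ : 0 < τ)
    (hS : Δ * θ * #D.activeSet ≤ τ / 4) :
    #(D.exceptional τ) * (τ / 2) ^ 2 ≤ 64 * (Δ : ℝ) ^ 2 * #D.activeSet := by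
  have := hsq.card_le (S := D.exceptional τ) (T := D.activeSet) (k := τ / 2) (by linarith) (by
    intro v hv
    simp only [exceptional, Finset.mem_filter, Finset.mem_univ, true_and] at hv
    have h1 := (h.hammingNorm_own_le hv.1).trans
      (Nat.mul_le_mul_left 2 (D.hammingNorm_foreign_le hv.1))
    have h2 : (hammingNorm (D.own v) : ℝ) ≤
        2 * deg (fun p : A × B => X.row p.1 ∘ X.col p.2) D.activeSet v := by exact_mod_cast h1
    linarith [hv.2]) (by linarith)
  linarith

theorem card_oddRows_mul_le (h : D.IsStalledMinimal Δ d w P m τ)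
    (hcol : Expands X.col θ (4 * Δ)) (hS : θ * #D.activeSet ≤ d / 8) :
    #(D.oddRows (D.exceptional τ)) * (d / 4) ^ 2 ≤ 16 * (Δ : ℝ) * #D.activeSet := by
  have hPd := h.P_le
  have hP := h.P_pos
  have hm := h.m_le
  have := hcol.card_le (S := D.oddRows (D.exceptional τ)) (T := D.activeSet) (k := d / 4)
    (by linarith) (by
    intro u hu
    have := D.le_deg_of_mem_oddRows h.rowStalled h.dist_B
      (fun v hv hn => own_eq_zero_of_notMem hv hn) h.C_le hu
    linarith) (by linarith)
  linarith

theorem card_badSet_mul_le (h : D.IsStalledMinimal Δ d w P m τ)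
    (hrow : Expands X.row θ (4 * Δ)) (hcol : Expands X.col θ (4 * Δ))
    (hS : θ * #(D.exceptional τ) ≤ P / 4) :
    #(D.badSet τ P) * (P / 2) ^ 2 ≤ 32 * (Δ : ℝ) * #(D.exceptional τ) := by
  classical
  have hP := h.P_pos
  have h1 := hrow.card_le (S := {u | P / 2 < deg X.row (D.exceptional τ) u})
    (T := D.exceptional τ) (k := P / 2) (by linarith)
    (fun u hu => (Finset.mem_filter.1 hu).2.le) (by linarith)
  have h2 := hcol.card_le (S := {u | P / 2 < deg X.col (D.exceptional τ) u})
    (T := D.exceptional τ) (k := P / 2) (by linarith)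
    (fun u hu => (Finset.mem_filter.1 hu).2.le) (by linarith)
  have h3 : #(D.badSet τ P) ≤ #{u | P / 2 < deg X.row (D.exceptional τ) u} +
      #{u | P / 2 < deg X.col (D.exceptional τ) u} := by
    refine le_trans (Finset.card_le_card fun u hu => ?_) (Finset.card_union_le _ _)
    simp only [badSet, Finset.mem_filter, Finset.mem_univ, true_and, Finset.mem_union] at hu ⊢
    exact hu.2
  have h4 : (#(D.badSet τ P) : ℝ) ≤ #{u | P / 2 < deg X.row (D.exceptional τ) u} +
      #{u | P / 2 < deg X.col (D.exceptional τ) u} := by exact_mod_cast h3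
  have h5 := mul_le_mul_of_nonneg_right h4 (sq_nonneg (P / 2))
  linarith

theorem card_residualRows_mul_le (h : D.IsStalledMinimal Δ d w P m τ)
    (hcol : Expands X.col θ (4 * Δ)) (hS : θ * #(D.oddRows (D.exceptional τ)) ≤ d / 16)
    {D' : LocalDecomp X CA CB} (hres : D.RowResidual D' d P τ) :
    #(D.residualRows D' τ P) * (d / 8) ^ 2 ≤
      16 * (Δ : ℝ) * #(D.oddRows (D.exceptional τ)) := by
  have hPd := h.P_le
  have hP := h.P_pos
  have := hcol.card_le (S := D.residualRows D' τ P) (T := D.oddRows (D.exceptional τ))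
    (k := d / 8) (by linarith) (by
    intro v hv
    simp only [residualRows, Finset.mem_filter, Finset.mem_univ, true_and] at hv
    obtain ⟨hev, hvS, a, ha, h0⟩ := hv
    have hodd : ¬ X.even (X.row a v) := by
      rw [X.even_row, not_not]
      exact hev
    have h1 := hres _ hodd ha a (by rwa [X.row_row]) (by rwa [D'.R_row])
    have h2 := D.le_deg_oddRows (Se := D.exceptional τ) hev a
    have h3 := (deg_le_of_notMem_badSet hodd ha).2
    linarith) (by linarith)
  linarith

/-- The second decoding step corrects the own part `D'.own v` of an even vertex exactly, unless the
foreign part weighs at least half of the minimum distance; in any case at most twice the weight of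
the foreign part remains. By expansion the foreign parts are rarely that heavy. -/
theorem sum_residual_mul_le (h : D.IsStalledMinimal Δ d w P m τ) (hdw : d ≤ w)
    (hsq : Expands (fun p : A × B => X.row p.1 ∘ X.col p.2) (Δ * θ) (16 * Δ ^ 2))
    {D' : LocalDecomp X CA CB} (hS : Δ * θ * #D'.activeSet ≤ d / 4) {E : Finset V}
    (hE : ∀ v ∈ E, X.even v) (inc : V → A × B → ZMod 2)
    (hmem : ∀ v ∈ E, inc v ∈ dualTensor CA CB)
    (hbest : ∀ v ∈ E, ∀ x ∈ dualTensor CA CB,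
      hammingNorm (D'.view v + inc v) ≤ hammingNorm (D'.view v + x)) :
    d * (∑ v ∈ E, hammingNorm (D'.own v + inc v) : ℕ) ≤ 256 * (Δ : ℝ) ^ 2 * #D'.activeSet := by
  classical
  set sq := fun p : A × B => X.row p.1 ∘ X.col p.2 with hsqdef
  have hle : ∀ v ∈ E, (hammingNorm (D'.own v + inc v) : ℝ) ≤ 2 * deg sq D'.activeSet v := by
    intro v hv
    have h1 := hbest v hv _ (D'.own_mem v)
    have h2 := hammingNorm_add_le (D'.view v + inc v) (D'.foreign v)
    have h3 : D'.view v + D'.own v = D'.foreign v := by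
      rw [view, add_comm (D'.own v), add_assoc, add_self_zmodTwo, add_zero]
    have h4 : D'.view v + inc v + D'.foreign v = D'.own v + inc v := by
      rw [view, add_right_comm, add_assoc (D'.own v), add_self_zmodTwo, add_zero]
    have h5 : hammingNorm (D'.foreign v) ≤ deg sq D'.activeSet v :=
      D'.hammingNorm_foreign_le (hE v hv)
    rw [h3] at h1
    rw [h4] at h2
    have : hammingNorm (D'.own v + inc v) ≤ 2 * deg sq D'.activeSet v := by omega
    exact_mod_cast this
  have hzero : ∀ v ∈ E, v ∉ E.filter (fun v => d / 2 ≤ deg sq D'.activeSet v) →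
      (hammingNorm (D'.own v + inc v) : ℝ) = 0 := by
    intro v hv hn
    have hlt : (deg sq D'.activeSet v : ℝ) < d / 2 := by
      simpa [hv] using hn
    by_contra h0
    have hne : D'.own v + inc v ≠ 0 := by
      intro h1
      rw [h1, hammingNorm_zero] at h0
      exact h0 Nat.cast_zero
    have h1 := h.le_hammingNorm (Submodule.add_mem _ (D'.own_mem v) (hmem v hv)) hne hdw
    have h2 := hle v hv
    linarith
  have h1 := hsq.sum_deg_le (S := E.filter (fun v => d / 2 ≤ deg sq D'.activeSet v))
    (T := D'.activeSet) (k := d / 2) (fun v hv => (Finset.mem_filter.1 hv).2) (by linarith)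
  have h2 : ((∑ v ∈ E, hammingNorm (D'.own v + inc v) : ℕ) : ℝ) ≤
      2 * ∑ v ∈ E.filter (fun v => d / 2 ≤ deg sq D'.activeSet v),
        (deg sq D'.activeSet v : ℝ) := by
    push_cast
    rw [← Finset.sum_subset (Finset.filter_subset _ E) hzero, Finset.mul_sum]
    exact Finset.sum_le_sum fun v hv => hle v (Finset.filter_subset _ E hv)
  have hd : 0 ≤ d := by linarith [h.P_le, h.P_pos]
  have h3 := mul_le_mul_of_nonneg_left h2 hd
  linarith

/-- Each active vertex that is not exceptional has a nonzero row or column, leading to an odd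
vertex. An odd vertex receiving more than `4 P` of them has a heavy local view unless it is bad,
so the active vertices bound the weight of the mismatch from below. -/
theorem card_active_le (h : D.IsStalledMinimal Δ d w P m τ) :
    (#D.activeSet : ℝ) ≤ #(D.exceptional τ) + 2 * Δ * #(D.badSet τ P) +
      4 * P * (#(D.oddRows (D.exceptional τ)) + #(D.swap.oddRows (D.exceptional τ))) +
      8 * Δ / (3 * w) * ∑ u, (hammingNorm (D.view u) : ℝ) := by
  classical
  set Se := D.exceptional τ with hSe
  set U := D.badSet τ P with hU
  have hP := h.P_pos
  have hw := h.w_pos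
  let eR : V → ℕ := fun u => #{a | ¬ X.even u ∧ X.row a u ∉ Se ∧ D.R u a ≠ 0}
  let eC : V → ℕ := fun u => #{b | ¬ X.even u ∧ X.col b u ∉ Se ∧ D.C u b ≠ 0}
  have hcount : #D.activeSet ≤ #Se + ((∑ u, eR u) + ∑ u, eC u) := by
    have hR : (∑ u, eR u) =
        #{p : V × A | ¬ X.even p.1 ∧ X.row p.2 p.1 ∉ Se ∧ D.R p.1 p.2 ≠ 0} := by
      simp only [eR, Finset.card_filter, Fintype.sum_prod_type]
    have hC : (∑ u, eC u) =
        #{p : V × B | ¬ X.even p.1 ∧ X.col p.2 p.1 ∉ Se ∧ D.C p.1 p.2 ≠ 0} := by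
      simp only [eC, Finset.card_filter, Fintype.sum_prod_type]
    rw [hR, hC]
    refine le_trans (Finset.card_le_card (t := Se ∪ (Finset.image (fun p => X.row p.2 p.1)
        {p : V × A | ¬ X.even p.1 ∧ X.row p.2 p.1 ∉ Se ∧ D.R p.1 p.2 ≠ 0} ∪
      Finset.image (fun p => X.col p.2 p.1)
        {p : V × B | ¬ X.even p.1 ∧ X.col p.2 p.1 ∉ Se ∧ D.C p.1 p.2 ≠ 0})) ?_)
      ((Finset.card_union_le _ _).trans (Nat.add_le_add_left ((Finset.card_union_le _ _).trans
        (add_le_add Finset.card_image_le Finset.card_image_le)) _))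
    intro v hv
    simp only [activeSet, Finset.mem_filter, Finset.mem_univ, true_and] at hv
    obtain ⟨hev, h0⟩ := hv
    by_contra hn
    simp only [Finset.mem_union, not_or] at hn
    obtain ⟨h1, h2, h3⟩ := hn
    refine h0 (funext fun p => ?_)
    have hR : D.R v p.1 = 0 := by
      by_contra hR
      refine h2 (Finset.mem_image.2 ⟨(X.row p.1 v, p.1), ?_, X.row_row _ _⟩)
      simp only [Finset.mem_filter, Finset.mem_univ, true_and, X.even_row, not_not, X.row_row,
        D.R_row]
      exact ⟨hev, h1, hR⟩
    have hC : D.C v p.2 = 0 := by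
      by_contra hC
      refine h3 (Finset.mem_image.2 ⟨(X.col p.2 v, p.2), ?_, X.col_col _ _⟩)
      simp only [Finset.mem_filter, Finset.mem_univ, true_and, X.even_col, not_not, X.col_col,
        D.C_col]
      exact ⟨hev, h1, hC⟩
    simp [own, arr, hR, hC]
  have hpt : ∀ u, ((eR u : ℝ) + eC u) ≤ (if u ∈ U then 2 * Δ else 0 : ℝ) +
      ((if u ∈ D.oddRows Se then 4 * P else 0) + if u ∈ D.swap.oddRows Se then 4 * P else 0) +
      8 * Δ / (3 * w) * hammingNorm (D.view u) := by
    intro u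
    have heR : eR u ≤ Δ := (Finset.card_le_univ _).trans h.card_A.le
    have heC : eC u ≤ Δ := (Finset.card_le_univ _).trans h.card_B.le
    have heR' : (eR u : ℝ) ≤ Δ := by exact_mod_cast heR
    have heC' : (eC u : ℝ) ≤ Δ := by exact_mod_cast heC
    have hlast : 0 ≤ 8 * Δ / (3 * w) * (hammingNorm (D.view u) : ℝ) := by positivity
    have hmid1 : (0 : ℝ) ≤ if u ∈ D.oddRows Se then 4 * P else 0 := by
      split_ifs <;> linarith
    have hmid2 : (0 : ℝ) ≤ if u ∈ D.swap.oddRows Se then 4 * P else 0 := by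
      split_ifs <;> linarith
    by_cases hev : X.even u
    · have h1 : eR u = 0 := by simp [eR, hev]
      have h2 : eC u = 0 := by simp [eC, hev]
      rw [h1, h2]
      have : (0 : ℝ) ≤ if u ∈ U then 2 * (Δ : ℝ) else 0 := by split_ifs <;> positivity
      push_cast
      linarith
    by_cases huU : u ∈ U
    · rw [if_pos huU]
      linarith
    rw [if_neg huU]
    obtain ⟨hdr, hdc⟩ := deg_le_of_notMem_badSet hev huU
    set A₁ : Finset A := {a | X.row a u ∉ Se} with hA₁
    set B₁ : Finset B := {b | X.col b u ∉ Se} with hB₁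
    have hA₁c : (Fintype.card A : ℝ) - #A₁ ≤ P / 2 := by
      have h1 := deg_add_card_compl X.row Se u A₁ (by simp [hA₁])
      have h2 : (deg X.row Se u : ℝ) + #A₁ = Fintype.card A := by exact_mod_cast h1
      linarith
    have hB₁c : (Fintype.card B : ℝ) - #B₁ ≤ P / 2 := by
      have h1 := deg_add_card_compl X.col Se u B₁ (by simp [hB₁])
      have h2 : (deg X.col Se u : ℝ) + #B₁ = Fintype.card B := by exact_mod_cast h1
      linarith
    by_cases hlight : (weightOn A₁ B₁ (D.own u) : ℝ) ≤ w
    · have h1 := h.norm_le_of_weightOn_le (by linarith) (by linarith) hlight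
      have h2 : eR u ≤ hammingNorm (D.R u) := Finset.card_le_card fun a ha => by
        simp only [Finset.mem_filter, Finset.mem_univ, true_and] at ha ⊢
        exact ha.2.2
      have h3 : eC u ≤ hammingNorm (D.C u) := Finset.card_le_card fun a ha => by
        simp only [Finset.mem_filter, Finset.mem_univ, true_and] at ha ⊢
        exact ha.2.2
      have h4 : (eR u : ℝ) + eC u ≤ 4 * P := by
        have : (eR u : ℝ) + eC u ≤ hammingNorm (D.R u) + hammingNorm (D.C u) := by
          exact_mod_cast add_le_add h2 h3
        linarith
      by_cases hmR : u ∈ D.oddRows Se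
      · rw [if_pos hmR]
        linarith
      by_cases hmC : u ∈ D.swap.oddRows Se
      · rw [if_pos hmC]
        linarith
      have h5 : eR u = 0 := by
        rw [Finset.card_eq_zero, Finset.filter_eq_empty_iff]
        intro a _ ha
        exact hmR (Finset.mem_filter.2 ⟨Finset.mem_univ _, hev, a, ha.2⟩)
      have h6 : eC u = 0 := by
        rw [Finset.card_eq_zero, Finset.filter_eq_empty_iff]
        intro b _ hb
        exact hmC (Finset.mem_filter.2 ⟨Finset.mem_univ _, hev, b, hb.2⟩)
      rw [h5, h6]
      push_cast
      linarith
    · have hfor := h.weightOn_foreign_le hev (A₀ := A₁) (B₀ := B₁) (by simp [hA₁, hSe])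
        (by simp [hB₁, hSe])
      have h1 := weightOn_add_le A₁ B₁ (D.view u) (D.foreign u)
      have h2 : D.view u + D.foreign u = D.own u := by
        rw [view, add_assoc, add_self_zmodTwo, add_zero]
      rw [h2] at h1
      have h3 := weightOn_le_hammingNorm A₁ B₁ (D.view u)
      have h4 : (weightOn A₁ B₁ (D.own u) : ℝ) ≤
          hammingNorm (D.view u) + weightOn A₁ B₁ (D.foreign u) := by
        exact_mod_cast h1.trans (Nat.add_le_add_right h3 _)
      have h5 : 3 * w / 4 ≤ hammingNorm (D.view u) := by
        push Not at hlight
        linarith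
      have h6 : 2 * (Δ : ℝ) ≤ 8 * Δ / (3 * w) * hammingNorm (D.view u) := by
        calc 2 * (Δ : ℝ) = 8 * Δ / (3 * w) * (3 * w / 4) := by field_simp; ring
          _ ≤ _ := by gcongr
      linarith
  have hsum := Finset.sum_le_sum fun u (_ : u ∈ Finset.univ) => hpt u
  simp only [Finset.sum_add_distrib, ← Finset.mul_sum, Finset.sum_ite_mem, Finset.univ_inter,
    Finset.sum_const, nsmul_eq_mul] at hsum
  have hcount' : (#D.activeSet : ℝ) ≤ #Se + ((∑ u, (eR u : ℝ)) + ∑ u, (eC u : ℝ)) := by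
    exact_mod_cast hcount
  linarith

end IsStalledMinimal

end LocalDecomp

/-! ### The bounds in terms of the degree -/

namespace LocalDecomp

/-- The constant in the bound for the number of exceptional vertices. -/
noncomputable def excConst (δ : ℝ) : ℝ := 65536 / δ ^ 2

/-- The constant in the bound for the number of active vertices after the first step. -/
noncomputable def actConst (δ : ℝ) : ℝ := 257 * excConst δ + 524288 / δ ^ 4

theorem excConst_pos {δ : ℝ} (hδ : 0 < δ) : 0 < excConst δ := by
  unfold excConst
  positivity

theorem actConst_pos {δ : ℝ} (hδ : 0 < δ) : 0 < actConst δ := by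
  have := excConst_pos hδ
  unfold actConst
  positivity

/-- The relations between `s = √Δ` and `c = Δ ^ ε` that hold for large `Δ`. -/
structure LargeDegree (δ s c : ℝ) : Prop where
  δ_pos : 0 < δ
  δ_le : δ ≤ 1
  c_ge : 16 ≤ c
  δc_ge : 40 ≤ δ * c
  δδc_ge : 16384 ≤ δ ^ 2 * c
  s_ge : 16 * c ≤ s
  exc_le : 2048 * excConst δ * c ^ 4 ≤ s ^ 2
  act_le : actConst δ * c ^ 4 ≤ s ^ 2

variable {V A B : Type*} {X : SquareComplex V A B} {CA : Code A} {CB : Code B}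
  [Fintype A] [Fintype B]

/-- The properties of the parameters of `IsStalledMinimal` hold for large degree. -/
theorem isStalledMinimal_of_largeDegree {D : LocalDecomp X CA CB} {Δ : ℕ} {δ s c : ℝ}
    (hs : LargeDegree δ s c) (hΔ : (Δ : ℝ) = s ^ 2) (hA : Fintype.card A = Δ)
    (hB : Fintype.card B = Δ) (hdA : δ * s ^ 2 ≤ minDist CA) (hdB : δ * s ^ 2 ≤ minDist CB)
    (hrob : IsRobustPunctured CA CB (s ^ 3 / c) (s ^ 2 / c))
    (hmin : ∀ v r c, (∀ a, r a ∈ CB) → (∀ b, c b ∈ CA) → arr r c = D.own v →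
      hammingNorm (D.R v) + hammingNorm (D.C v) ≤ hammingNorm r + hammingNorm c)
    (hst : ∀ v, X.even v → ∀ x ∈ dualTensor CA CB,
      hammingNorm (D.view v) ≤ hammingNorm (D.view v + x)) :
    D.IsStalledMinimal Δ (δ * s ^ 2) (s ^ 3 / c) (s ^ 2 / c) (s / (8 * c))
      (δ * s ^ 3 / (16 * c)) := by
  have hδ := hs.δ_pos
  have hδ1 := hs.δ_le
  have hc : 0 < c := by linarith [hs.c_ge]
  have hs0 : 0 < s := by linarith [hs.s_ge]
  have hs1 : 1 ≤ s := by linarith [hs.s_ge, hs.c_ge]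
  have hδs : 2 ≤ δ * s := by nlinarith [hs.δc_ge, hs.s_ge]
  refine ⟨hA, hB, hdA, hdB, hrob, hmin, hst, by positivity, by positivity, ?_, ?_, by positivity,
    ?_, ?_, ?_, ?_⟩
  · rw [← mul_div_assoc, div_le_iff₀ hc]
    nlinarith [hs.δc_ge, sq_nonneg s]
  · rw [← mul_div_assoc, ← mul_div_assoc]
    gcongr ?_ / c
    have : 0 ≤ s ^ 3 := by positivity
    nlinarith
  · rw [div_le_div_iff₀ (by positivity) hc]
    have : 0 ≤ s * c := by positivity
    nlinarith
  · rw [hΔ]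
    apply le_of_eq
    field_simp
  · apply le_of_eq
    field_simp
    norm_num
  · rw [div_le_div_iff₀ (by positivity) hc]
    have : 0 ≤ s ^ 3 * c := by positivity
    nlinarith

namespace IsStalledMinimal

variable [Fintype V] {D : LocalDecomp X CA CB} {Δ : ℕ} {δ s c θ : ℝ}

/-- Bounds for the numbers of exceptional vertices, of odd vertices meeting active rows or columns,
and of bad vertices. -/
theorem card_bounds (hs : LargeDegree δ s c) (hΔ : (Δ : ℝ) = s ^ 2)
    (h : D.IsStalledMinimal Δ (δ * s ^ 2) (s ^ 3 / c) (s ^ 2 / c) (s / (8 * c))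
      (δ * s ^ 3 / (16 * c)))
    (hrow : Expands X.row θ (4 * Δ)) (hcol : Expands X.col θ (4 * Δ))
    (hsq : Expands (fun p : A × B => X.row p.1 ∘ X.col p.2) (Δ * θ) (16 * Δ ^ 2))
    (hθ0 : 0 ≤ θ) (hθ : θ * #D.activeSet ≤ δ / 4) :
    #(D.exceptional (δ * s ^ 3 / (16 * c))) * s ^ 2 ≤ excConst δ * c ^ 2 * #D.activeSet ∧
    #(D.oddRows (D.exceptional (δ * s ^ 3 / (16 * c)))) * (δ ^ 2 * s ^ 2) ≤
      256 * #D.activeSet ∧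
    #(D.swap.oddRows (D.exceptional (δ * s ^ 3 / (16 * c)))) * (δ ^ 2 * s ^ 2) ≤
      256 * #D.activeSet ∧
    #(D.badSet (δ * s ^ 3 / (16 * c)) (s ^ 2 / c)) * s ^ 4 ≤
      128 * excConst δ * c ^ 4 * #D.activeSet := by
  have hδ := hs.δ_pos
  have hδ1 := hs.δ_le
  have hc : 0 < c := by linarith [hs.c_ge]
  have hs0 : 0 < s := by linarith [hs.s_ge]
  have hs1 : 1 ≤ s := by linarith [hs.s_ge, hs.c_ge]
  have ha : (0 : ℝ) ≤ #D.activeSet := Nat.cast_nonneg _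
  have hE : (#(D.exceptional (δ * s ^ 3 / (16 * c))) : ℝ) * s ^ 2 ≤
      excConst δ * c ^ 2 * #D.activeSet := by
    have h1 := h.card_exceptional_mul_le hsq (by positivity) (by
      rw [hΔ]
      have h2 : s ^ 2 * θ * #D.activeSet ≤ s ^ 2 * (δ / 4) := by
        rw [mul_assoc]
        gcongr
      refine h2.trans ?_
      rw [div_div, mul_div_assoc', div_le_div_iff₀ (by norm_num) (by positivity)]
      have h3 : 0 ≤ s ^ 2 * δ := by positivity
      nlinarith [hs.s_ge])
    rw [hΔ] at h1
    have h2 : (#(D.exceptional (δ * s ^ 3 / (16 * c))) : ℝ) * s ^ 2 =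
        (#(D.exceptional (δ * s ^ 3 / (16 * c))) * (δ * s ^ 3 / (16 * c) / 2) ^ 2) *
          (1024 * c ^ 2 / (δ ^ 2 * s ^ 4)) := by
      field_simp
      ring
    rw [h2]
    refine (mul_le_mul_of_nonneg_right h1 (by positivity)).trans (le_of_eq ?_)
    unfold excConst
    field_simp
    ring
  have hT : (#(D.oddRows (D.exceptional (δ * s ^ 3 / (16 * c)))) : ℝ) * (δ ^ 2 * s ^ 2) ≤
      256 * #D.activeSet ∧
    (#(D.swap.oddRows (D.exceptional (δ * s ^ 3 / (16 * c)))) : ℝ) * (δ ^ 2 * s ^ 2) ≤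
      256 * #D.activeSet := by
    have hcond : θ * #D.activeSet ≤ δ * s ^ 2 / 8 := by
      refine hθ.trans ?_
      have : 2 ≤ s ^ 2 := by nlinarith [hs.s_ge, hs.c_ge]
      nlinarith
    have h1 := h.card_oddRows_mul_le hcol hcond
    have h2 := h.swap.card_oddRows_mul_le hrow (by rwa [activeSet_swap])
    rw [exceptional_swap, activeSet_swap] at h2
    rw [hΔ] at h1 h2
    have hs2 : 0 < s ^ 2 := by positivity
    constructor
    · refine le_of_mul_le_mul_right ?_ hs2
      linarith
    · refine le_of_mul_le_mul_right ?_ hs2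
      linarith
  refine ⟨hE, hT.1, hT.2, ?_⟩
  have hle : (#(D.exceptional (δ * s ^ 3 / (16 * c))) : ℝ) ≤ #D.activeSet := by
    have : D.exceptional (δ * s ^ 3 / (16 * c)) ⊆ D.activeSet := by
      intro v hv
      simp only [exceptional, activeSet, Finset.mem_filter, Finset.mem_univ, true_and] at hv ⊢
      refine ⟨hv.1, fun h0 => ?_⟩
      rw [h0, hammingNorm_zero, Nat.cast_zero] at hv
      exact absurd hv.2 (not_lt.2 (by positivity))
    exact_mod_cast Finset.card_le_card this
  have h1 := h.card_badSet_mul_le hrow hcol (by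
    refine (mul_le_mul_of_nonneg_left hle hθ0).trans (hθ.trans ?_)
    gcongr
    rw [le_div_iff₀ hc]
    nlinarith [hs.s_ge])
  rw [hΔ] at h1
  have h2 : (#(D.badSet (δ * s ^ 3 / (16 * c)) (s ^ 2 / c)) : ℝ) * s ^ 4 =
      (#(D.badSet (δ * s ^ 3 / (16 * c)) (s ^ 2 / c)) * (s ^ 2 / c / 2) ^ 2) * (4 * c ^ 2) := by
    field_simp
    norm_num
  rw [h2]
  refine (mul_le_mul_of_nonneg_right h1 (by positivity)).trans ?_
  have h3 := mul_le_mul_of_nonneg_left hE (by positivity : 0 ≤ 128 * c ^ 2)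
  linarith

/-- The first decoding step leaves few active vertices. -/
theorem card_activeSet_after_le (hs : LargeDegree δ s c) (hΔ : (Δ : ℝ) = s ^ 2)
    (h : D.IsStalledMinimal Δ (δ * s ^ 2) (s ^ 3 / c) (s ^ 2 / c) (s / (8 * c))
      (δ * s ^ 3 / (16 * c)))
    (hrow : Expands X.row θ (4 * Δ)) (hcol : Expands X.col θ (4 * Δ))
    (hsq : Expands (fun p : A × B => X.row p.1 ∘ X.col p.2) (Δ * θ) (16 * Δ ^ 2))
    (hθ0 : 0 ≤ θ) (hθ : θ * #D.activeSet ≤ δ / 4) {D' : LocalDecomp X CA CB}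
    (hres : D.RowResidual D' (δ * s ^ 2) (s ^ 2 / c) (δ * s ^ 3 / (16 * c)))
    (hres' : D.swap.RowResidual D'.swap (δ * s ^ 2) (s ^ 2 / c) (δ * s ^ 3 / (16 * c))) :
    #D'.activeSet * s ^ 2 ≤ actConst δ * c ^ 4 * #D.activeSet := by
  have hδ := hs.δ_pos
  have hc1 : 1 ≤ c := by linarith [hs.c_ge]
  have hs1 : 1 ≤ s := by linarith [hs.s_ge, hs.c_ge]
  have ha : (0 : ℝ) ≤ #D.activeSet := Nat.cast_nonneg _
  obtain ⟨hE, hTr, hTc, hU⟩ := h.card_bounds hs hΔ hrow hcol hsq hθ0 hθ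
  set Tr : ℝ := (#(D.oddRows (D.exceptional (δ * s ^ 3 / (16 * c)))) : ℝ) with hTr'
  set Tc : ℝ := (#(D.swap.oddRows (D.exceptional (δ * s ^ 3 / (16 * c)))) : ℝ) with hTc'
  set a : ℝ := (#D.activeSet : ℝ) with ha'
  have hcond : ∀ T : ℝ, 0 ≤ T → T * (δ ^ 2 * s ^ 2) ≤ 256 * a → θ * T ≤ δ * s ^ 2 / 16 := by
    intro T hT0 hT
    have h1 : θ * T * (δ ^ 2 * s ^ 2) ≤ 64 * δ := by
      have := mul_le_mul_of_nonneg_left hT hθ0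
      linarith
    have h2 : 40 ≤ δ * s := by nlinarith [hs.δc_ge, hs.s_ge]
    have h3 : 64 * δ ≤ δ * s ^ 2 / 16 * (δ ^ 2 * s ^ 2) := by
      have h4 : 1600 ≤ δ ^ 2 * s ^ 2 := by nlinarith
      have h5 : 1 ≤ s ^ 2 := one_le_pow₀ hs1
      have h6 : δ * 1600 ≤ δ * s ^ 2 * (δ ^ 2 * s ^ 2) :=
        mul_le_mul (by nlinarith) h4 (by norm_num) (by positivity)
      linarith
    exact le_of_mul_le_mul_right (h1.trans h3) (by positivity)
  have hW : ∀ W T : ℝ, 0 ≤ W → W * (δ * s ^ 2 / 8) ^ 2 ≤ 16 * s ^ 2 * T →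
      T * (δ ^ 2 * s ^ 2) ≤ 256 * a → W * s ^ 2 ≤ 262144 / δ ^ 4 * c ^ 4 * a := by
    intro W T hW0 h1 h2
    have h3 : W * (δ ^ 2 * s ^ 2) ≤ 1024 * T := by
      refine le_of_mul_le_mul_right ?_ (by positivity : 0 < s ^ 2)
      linarith
    have h4 : W * s ^ 2 * (δ ^ 4 * s ^ 2) ≤ 262144 * a := by
      have := mul_le_mul_of_nonneg_right h3 (by positivity : 0 ≤ δ ^ 2 * s ^ 2)
      linarith
    have h5 : W * s ^ 2 * δ ^ 4 ≤ 262144 * a := by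
      refine le_trans ?_ h4
      have h6 : 0 ≤ W * s ^ 2 * δ ^ 4 := by positivity
      have h7 : 1 ≤ s ^ 2 := one_le_pow₀ hs1
      nlinarith
    have h8 : W * s ^ 2 ≤ 262144 / δ ^ 4 * a := by
      rw [div_mul_eq_mul_div, le_div_iff₀ (by positivity)]
      exact h5
    refine h8.trans ?_
    have h9 : 0 ≤ 262144 / δ ^ 4 * a := by positivity
    have h10 : 1 ≤ c ^ 4 := one_le_pow₀ hc1
    nlinarith
  have hWr := h.card_residualRows_mul_le hcol (hcond Tr (Nat.cast_nonneg _) hTr) hres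
  have hWc := h.swap.card_residualRows_mul_le hrow
    (by rw [exceptional_swap]; exact hcond Tc (Nat.cast_nonneg _) hTc) hres'
  rw [exceptional_swap] at hWc
  rw [hΔ] at hWr hWc
  have hWr' := hW _ Tr (Nat.cast_nonneg _) hWr hTr
  have hWc' := hW _ Tc (Nat.cast_nonneg _) hWc hTc
  have hcard := D.card_activeSet_le D' (δ * s ^ 3 / (16 * c)) (s ^ 2 / c) h.card_A h.card_B
  have hcard' : (#D'.activeSet : ℝ) ≤ #(D.exceptional (δ * s ^ 3 / (16 * c))) +
      2 * Δ * #(D.badSet (δ * s ^ 3 / (16 * c)) (s ^ 2 / c)) +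
      #(D.residualRows D' (δ * s ^ 3 / (16 * c)) (s ^ 2 / c)) +
      #(D.swap.residualRows D'.swap (δ * s ^ 3 / (16 * c)) (s ^ 2 / c)) := by
    exact_mod_cast hcard
  rw [hΔ] at hcard'
  have hmul := mul_le_mul_of_nonneg_right hcard' (by positivity : 0 ≤ s ^ 2)
  have hE' : excConst δ * c ^ 2 * a ≤ excConst δ * c ^ 4 * a := by
    have := (excConst_pos hδ).le
    gcongr
    norm_num
  unfold actConst
  have hsplit : (257 * excConst δ + 524288 / δ ^ 4) * c ^ 4 * a =
      excConst δ * c ^ 4 * a + 256 * excConst δ * c ^ 4 * a +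
        2 * (262144 / δ ^ 4 * c ^ 4 * a) := by ring
  rw [hsplit]
  linarith

/-- The weight that remains after both decoding steps. -/
theorem sum_residual_le (hs : LargeDegree δ s c) (hΔ : (Δ : ℝ) = s ^ 2)
    (h : D.IsStalledMinimal Δ (δ * s ^ 2) (s ^ 3 / c) (s ^ 2 / c) (s / (8 * c))
      (δ * s ^ 3 / (16 * c)))
    (hrow : Expands X.row θ (4 * Δ)) (hcol : Expands X.col θ (4 * Δ))
    (hsq : Expands (fun p : A × B => X.row p.1 ∘ X.col p.2) (Δ * θ) (16 * Δ ^ 2))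
    (hθ0 : 0 ≤ θ) (hθ : θ * #D.activeSet ≤ δ / 4) {D' : LocalDecomp X CA CB}
    (hres : D.RowResidual D' (δ * s ^ 2) (s ^ 2 / c) (δ * s ^ 3 / (16 * c)))
    (hres' : D.swap.RowResidual D'.swap (δ * s ^ 2) (s ^ 2 / c) (δ * s ^ 3 / (16 * c)))
    {E : Finset V} (hE : ∀ v ∈ E, X.even v) (inc : V → A × B → ZMod 2)
    (hmem : ∀ v ∈ E, inc v ∈ dualTensor CA CB)
    (hbest : ∀ v ∈ E, ∀ x ∈ dualTensor CA CB,
      hammingNorm (D'.view v + inc v) ≤ hammingNorm (D'.view v + x)) :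
    (∑ v ∈ E, hammingNorm (D'.own v + inc v) : ℕ) ≤
      256 * actConst δ / δ * #D.activeSet * c ^ 4 := by
  have hδ := hs.δ_pos
  have hc : 0 < c := by linarith [hs.c_ge]
  have hs0 : 0 < s := by linarith [hs.s_ge]
  have hafter := h.card_activeSet_after_le hs hΔ hrow hcol hsq hθ0 hθ hres hres'
  have hF := (actConst_pos hδ).le
  have h1 := h.sum_residual_mul_le (by
    rw [le_div_iff₀ hc]
    have : δ * c ≤ s := by nlinarith [hs.s_ge, hs.δ_le]
    have h2 : 0 ≤ s ^ 2 := by positivity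
    nlinarith) hsq (D' := D') (by
      rw [hΔ]
      have h2 := mul_le_mul_of_nonneg_left hafter hθ0
      have h3 := mul_le_mul_of_nonneg_left hθ (by positivity : 0 ≤ actConst δ * c ^ 4)
      have h4 := mul_le_mul_of_nonneg_right hs.act_le (by positivity : 0 ≤ δ / 4)
      linarith) hE inc hmem hbest
  rw [hΔ] at h1
  have h2 : 256 * (s ^ 2) ^ 2 * (#D'.activeSet : ℝ) ≤
      256 * s ^ 2 * (actConst δ * c ^ 4 * #D.activeSet) := by
    have := mul_le_mul_of_nonneg_left hafter (by positivity : 0 ≤ 256 * s ^ 2)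
    linarith
  have h3 : 256 * actConst δ / δ * #D.activeSet * c ^ 4 =
      256 * s ^ 2 * (actConst δ * c ^ 4 * #D.activeSet) / (δ * s ^ 2) := by
    field_simp
  rw [h3, le_div_iff₀ (by positivity)]
  linarith

/-- The weight of the mismatch before the decoding steps. -/
theorem le_sum_view (hs : LargeDegree δ s c) (hΔ : (Δ : ℝ) = s ^ 2)
    (h : D.IsStalledMinimal Δ (δ * s ^ 2) (s ^ 3 / c) (s ^ 2 / c) (s / (8 * c))
      (δ * s ^ 3 / (16 * c)))
    (hrow : Expands X.row θ (4 * Δ)) (hcol : Expands X.col θ (4 * Δ))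
    (hsq : Expands (fun p : A × B => X.row p.1 ∘ X.col p.2) (Δ * θ) (16 * Δ ^ 2))
    (hθ0 : 0 ≤ θ) (hθ : θ * #D.activeSet ≤ δ / 4) :
    #D.activeSet * (s / c) ≤ 8 * ∑ u, (hammingNorm (D.view u) : ℝ) := by
  have hδ := hs.δ_pos
  have hc : 0 < c := by linarith [hs.c_ge]
  have hc1 : 1 ≤ c := by linarith [hs.c_ge]
  have hs0 : 0 < s := by linarith [hs.s_ge]
  have ha : (0 : ℝ) ≤ #D.activeSet := Nat.cast_nonneg _
  have hX := (excConst_pos hδ).le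
  obtain ⟨hE, hTr, hTc, hU⟩ := h.card_bounds hs hΔ hrow hcol hsq hθ0 hθ
  have hmain := h.card_active_le
  set Se : ℝ := (#(D.exceptional (δ * s ^ 3 / (16 * c))) : ℝ) with hSe
  set U : ℝ := (#(D.badSet (δ * s ^ 3 / (16 * c)) (s ^ 2 / c)) : ℝ) with hU'
  set Tr : ℝ := (#(D.oddRows (D.exceptional (δ * s ^ 3 / (16 * c)))) : ℝ) with hTr'
  set Tc : ℝ := (#(D.swap.oddRows (D.exceptional (δ * s ^ 3 / (16 * c)))) : ℝ) with hTc'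
  set a : ℝ := (#D.activeSet : ℝ) with ha'
  set Y : ℝ := ∑ u, (hammingNorm (D.view u) : ℝ) with hY
  have hs2 : 0 < s ^ 2 := by positivity
  have h24 : c ^ 2 ≤ c ^ 4 := pow_le_pow_right₀ hc1 (by norm_num)
  have hSe8 : Se ≤ a / 8 := by
    refine le_of_mul_le_mul_right ?_ hs2
    have h1 : excConst δ * c ^ 2 * a ≤ excConst δ * c ^ 4 * a := by gcongr
    have h2 := mul_le_mul_of_nonneg_right hs.exc_le ha
    have h3 : 0 ≤ excConst δ * c ^ 4 * a := by positivity
    linarith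
  have hU8 : 2 * Δ * U ≤ a / 8 := by
    rw [hΔ]
    refine le_of_mul_le_mul_right ?_ hs2
    have h2 := mul_le_mul_of_nonneg_right hs.exc_le ha
    linarith
  have hT8 : 4 * (s ^ 2 / c) * (Tr + Tc) ≤ a / 8 := by
    have h1 : (Tr + Tc) * s ^ 2 ≤ 512 * a / δ ^ 2 := by
      rw [le_div_iff₀ (by positivity)]
      linarith
    have h2 : 4 * (s ^ 2 / c) * (Tr + Tc) = 4 * ((Tr + Tc) * s ^ 2) / c := by ring
    rw [h2, div_le_iff₀ hc]
    have h3 : 512 * a / δ ^ 2 ≤ a * c / 32 := by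
      rw [div_le_iff₀ (by positivity)]
      have := mul_le_mul_of_nonneg_right hs.δδc_ge ha
      linarith
    linarith
  have hlast : 8 * (Δ : ℝ) / (3 * (s ^ 3 / c)) * Y = 8 / 3 * (Y / (s / c)) := by
    rw [hΔ]
    field_simp
  rw [hlast] at hmain
  have h5 : a ≤ 8 * (Y / (s / c)) := by
    have : 0 ≤ Y / (s / c) := by
      have : 0 ≤ Y := Finset.sum_nonneg fun u _ => Nat.cast_nonneg _
      positivity
    linarith
  rw [← mul_div_assoc, le_div_iff₀ (by positivity)] at h5
  exact h5

end IsStalledMinimal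

end LocalDecomp

/-! ### The left-right Cayley complex -/

section Concrete

variable {G : Type*} [Group G] {A B : Finset G}

/-- The neighbourhood structure of the quadripartite left-right Cayley complex. -/
def cayleyComplex (A B : Finset G) : SquareComplex (Vertex G) A B where
  row a v := (if v.2.2 then (a : G)⁻¹ * v.1 else a * v.1, v.2.1, !v.2.2)
  col b v := (if v.2.1 then v.1 * (b : G)⁻¹ else v.1 * b, !v.2.1, v.2.2)
  even v := v.2.1 = v.2.2
  row_row := by rintro a ⟨g, i, j⟩; cases j <;> simp
  col_col := by rintro b ⟨g, i, j⟩; cases i <;> simp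
  row_col := by rintro a b ⟨g, i, j⟩; cases i <;> cases j <;> simp [mul_assoc]
  even_row := by rintro a ⟨g, i, j⟩; cases i <;> cases j <;> simp
  even_col := by rintro b ⟨g, i, j⟩; cases i <;> cases j <;> simp

theorem phi_row (a : A) (b : B) (v : Vertex G) :
    phi ((cayleyComplex A B).row a v) (a, b) = phi v (a, b) := by
  obtain ⟨g, i, j⟩ := v
  cases i <;> cases j <;> simp [cayleyComplex, phi]

theorem phi_col (a : A) (b : B) (v : Vertex G) :
    phi ((cayleyComplex A B).col b v) (a, b) = phi v (a, b) := by
  obtain ⟨g, i, j⟩ := v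
  cases i <;> cases j <;> simp [cayleyComplex, phi, mul_assoc]

theorem localView_pad_self (v : Vertex G) (u : A × B → ZMod 2) : localView v (pad v u) = u := by
  ext p
  have h := (phi_eq_iff v p _).1 rfl
  simp [localView, pad, h.1, h.2]

theorem localView_pad_of_ne {v v' : Vertex G} (h : v ≠ v') (h2 : v.2 = v'.2)
    (u : A × B → ZMod 2) : localView v (pad v' u) = 0 := by
  ext p
  have h1 := ((phi_eq_iff v p _).1 rfl).1
  rw [h2] at h1
  simp [localView, pad, h1, h]

theorem localView_add (v : Vertex G) (x y : Square A B → ZMod 2) :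
    localView v (x + y) = localView v x + localView v y := rfl

/-- A row of the local view of a vector padded from `v` is a row of that vector or zero. -/
theorem localView_pad_row {v u : Vertex G} (h : u.2.1 = v.2.1) (t : A × B → ZMod 2) (a : A) :
    (∀ b, localView u (pad v t) (a, b) = t (a, b)) ∨ ∀ b, localView u (pad v t) (a, b) = 0 := by
  by_cases hj : u.2.2 = v.2.2
  · by_cases huv : u = v
    · subst huv
      exact Or.inl fun b => by rw [localView_pad_self]
    · exact Or.inr fun b => by rw [localView_pad_of_ne huv (Prod.ext h hj)]; rfl
  · have key : ∀ b, localView u (pad v t) (a, b) =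
        localView ((cayleyComplex A B).row a u) (pad v t) (a, b) := by
      intro b
      simp only [localView, phi_row]
    have h2 : ((cayleyComplex A B).row a u).2 = v.2 :=
      Prod.ext h (by
        change (!u.2.2) = v.2.2
        revert hj
        cases u.2.2 <;> cases v.2.2 <;> simp)
    by_cases huv : (cayleyComplex A B).row a u = v
    · left
      intro b
      rw [key, huv, localView_pad_self]
    · right
      intro b
      rw [key, localView_pad_of_ne huv h2]
      rfl

/-- A column of the local view of a vector padded from `v` is a column of that vector or zero. -/
theorem localView_pad_col {v u : Vertex G} (h : u.2.2 = v.2.2) (t : A × B → ZMod 2) (b : B) :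
    (∀ a, localView u (pad v t) (a, b) = t (a, b)) ∨ ∀ a, localView u (pad v t) (a, b) = 0 := by
  by_cases hj : u.2.1 = v.2.1
  · by_cases huv : u = v
    · subst huv
      exact Or.inl fun a => by rw [localView_pad_self]
    · exact Or.inr fun a => by rw [localView_pad_of_ne huv (Prod.ext hj h)]; rfl
  · have key : ∀ a, localView u (pad v t) (a, b) =
        localView ((cayleyComplex A B).col b u) (pad v t) (a, b) := by
      intro a
      simp only [localView, phi_col]
    have h2 : ((cayleyComplex A B).col b u).2 = v.2 :=
      Prod.ext (by
        change (!u.2.1) = v.2.1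
        revert hj
        cases u.2.1 <;> cases v.2.1 <;> simp) h
    by_cases huv : (cayleyComplex A B).col b u = v
    · left
      intro a
      rw [key, huv, localView_pad_self]
    · right
      intro a
      rw [key, localView_pad_of_ne huv h2]
      rfl

namespace Decomp

variable {CA : Code A} {CB : Code B} (Z : Decomp CA CB)

theorem localView_R_mem (v : Vertex G) (a : A) :
    (fun b => localView v (Z.R v.2.1) (a, b)) ∈ CB := by
  obtain ⟨g, i, j⟩ := v
  by_cases h : j = !i
  · subst h
    exact Z.mem_R i g a
  · have hj : (!j) = !i := by
      revert h
      cases i <;> cases j <;> simp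
    have h1 := Z.mem_R i ((cayleyComplex A B).row a (g, i, j)).1 a
    have h2 : ((((cayleyComplex A B).row a (g, i, j)).1, i, !i) : Vertex G) =
        (cayleyComplex A B).row a (g, i, j) := by
      rw [← hj]
      rfl
    rw [h2] at h1
    simpa only [localView, phi_row] using h1

theorem localView_C_mem (v : Vertex G) (b : B) :
    (fun a => localView v (Z.C v.2.2) (a, b)) ∈ CA := by
  obtain ⟨g, i, j⟩ := v
  by_cases h : i = !j
  · subst h
    exact Z.mem_C j g b
  · have hj : (!i) = !j := by
      revert h
      cases i <;> cases j <;> simp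
    have h1 := Z.mem_C j ((cayleyComplex A B).col b (g, i, j)).1 b
    have h2 : ((((cayleyComplex A B).col b (g, i, j)).1, !j, j) : Vertex G) =
        (cayleyComplex A B).col b (g, i, j) := by
      rw [← hj]
      rfl
    rw [h2] at h1
    simpa only [localView, phi_col] using h1

/-- The local views of a decomposition. -/
def toLocal : LocalDecomp (cayleyComplex A B) CA CB where
  R v a b := localView v (Z.R v.2.1) (a, b)
  C v b a := localView v (Z.C v.2.2) (a, b)
  mem_R := Z.localView_R_mem
  mem_C := Z.localView_C_mem
  R_row a v := by
    ext b
    change localView ((cayleyComplex A B).row a v) (Z.R v.2.1) (a, b) = _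
    simp only [localView, phi_row]
  C_col b v := by
    ext a
    change localView ((cayleyComplex A B).col b v) (Z.C v.2.2) (a, b) = _
    simp only [localView, phi_col]

theorem own_toLocal (v : Vertex G) :
    Z.toLocal.own v = localView v (Z.R v.2.1 + Z.C v.2.2) := rfl

theorem view_toLocal (v : Vertex G) : Z.toLocal.view v = localView v Z.mismatch := by
  ext ⟨a, b⟩
  have h1 : Z.toLocal.foreign v (a, b) =
      localView v (Z.R (!v.2.1)) (a, b) + localView v (Z.C (!v.2.2)) (a, b) := by
    change localView ((cayleyComplex A B).col b v) (Z.R (!v.2.1)) (a, b) +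
      localView ((cayleyComplex A B).row a v) (Z.C (!v.2.2)) (a, b) = _
    simp only [localView, phi_row, phi_col]
  rw [LocalDecomp.view, Pi.add_apply, h1, own_toLocal]
  obtain ⟨g, i, j⟩ := v
  cases i <;> cases j <;> simp [mismatch, localView] <;> ring

theorem numRows_eq (v : Vertex G) :
    numRows (localView v (Z.R v.2.1)) = hammingNorm (Z.toLocal.R v) := by
  classical
  unfold numRows hammingNorm
  congr 1
  ext a
  simp only [Finset.mem_filter, Finset.mem_univ, true_and, Function.ne_iff]
  rfl

theorem numCols_eq (v : Vertex G) :
    numCols (localView v (Z.C v.2.2)) = hammingNorm (Z.toLocal.C v) := by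
  classical
  unfold numCols hammingNorm
  congr 1
  ext a
  simp only [Finset.mem_filter, Finset.mem_univ, true_and, Function.ne_iff]
  rfl

end Decomp

variable [Fintype G]

theorem sum_localView (f : ZMod 2 → ℕ) (x : Square A B → ZMod 2) (i j : Bool) :
    ∑ q, f (x q) = ∑ g, ∑ p, f (localView (g, i, j) x p) := by
  have e : Function.Bijective (fun y : G × A × B => (phi (y.1, i, j) y.2 : Square A B)) := by
    constructor
    · rintro ⟨g, p⟩ ⟨g', p'⟩ h
      have h1 := (phi_eq_iff (g, i, j) p _).1 h
      have h2 := (phi_eq_iff (g', i, j) p' _).1 rfl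
      have h3 : ((g, i, j) : Vertex G) = (g', i, j) := h1.1.symm.trans h2.1
      exact Prod.ext (Prod.ext_iff.1 h3).1 (h1.2.symm.trans h2.2)
    · intro q
      refine ⟨((corner q i j).1, q.2), ?_⟩
      have : corner q i j = ((corner q i j).1, i, j) := by cases i <;> cases j <;> rfl
      exact (phi_eq_iff _ _ _).2 ⟨this, rfl⟩
  rw [← Fintype.sum_prod_type']
  exact (Fintype.sum_bijective _ e _ _ fun y => rfl).symm

theorem hammingNorm_eq_sum_localView (x : Square A B → ZMod 2) (i j : Bool) :
    hammingNorm x = ∑ g, hammingNorm (localView (g, i, j) x) := by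
  have := sum_localView (fun t => if t ≠ 0 then 1 else 0) x i j
  simpa only [hammingNorm, Finset.card_filter] using this

theorem sum_hammingNorm_localView (x : Square A B → ZMod 2) :
    ∑ v, hammingNorm (localView v x) = 4 * hammingNorm x := by
  have h1 : ∑ v : Vertex G, hammingNorm (localView v x) =
      ∑ ij : Bool × Bool, ∑ g, hammingNorm (localView (g, ij) x) :=
    Fintype.sum_prod_type_right _
  rw [h1]
  have h2 : ∀ ij : Bool × Bool, ∑ g, hammingNorm (localView (g, ij) x) = hammingNorm x :=
    fun ij => (hammingNorm_eq_sum_localView x ij.1 ij.2).symm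
  simp [h2]

theorem hammingNorm_add_pad (z : Square A B → ZMod 2) (v : Vertex G) (u : A × B → ZMod 2) :
    hammingNorm (z + pad v u) + hammingNorm (localView v z) =
      hammingNorm z + hammingNorm (localView v z + u) := by
  classical
  obtain ⟨g, i, j⟩ := v
  rw [hammingNorm_eq_sum_localView _ i j, hammingNorm_eq_sum_localView z i j,
    ← Finset.add_sum_erase _ _ (Finset.mem_univ g),
    ← Finset.add_sum_erase _ (fun g => hammingNorm (localView (g, i, j) z)) (Finset.mem_univ g)]
  have h1 : ∀ g' ∈ Finset.univ.erase g, hammingNorm (localView (g', i, j) (z + pad (g, i, j) u)) =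
      hammingNorm (localView (g', i, j) z) := by
    intro g' hg'
    have hne : ((g', i, j) : Vertex G) ≠ (g, i, j) :=
      fun h => (Finset.mem_erase.1 hg').1 (Prod.ext_iff.1 h).1
    rw [localView_add, localView_pad_of_ne hne rfl, add_zero]
  rw [Finset.sum_congr rfl h1, localView_add, localView_pad_self]
  ring

theorem hammingNorm_pad (v : Vertex G) (u : A × B → ZMod 2) :
    hammingNorm (pad v u : Square A B → ZMod 2) = hammingNorm u := by
  have h := hammingNorm_add_pad (0 : Square A B → ZMod 2) v u
  have h0 : localView v (0 : Square A B → ZMod 2) = 0 := rfl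
  simpa [h0] using h

theorem sum_pad_V1 (u : Vertex G → A × B → ZMod 2) (q : Square A B) :
    (∑ v ∈ V1 G, pad v (u v)) q =
      u (corner q false true) q.2 + u (corner q true false) q.2 := by
  classical
  have h1 : corner q false true ∈ V1 G := by simp [V1, corner]
  have h2 : corner q true false ∈ (V1 G).erase (corner q false true) := by simp [V1, corner]
  rw [Finset.sum_apply, ← Finset.add_sum_erase _ _ h1, ← Finset.add_sum_erase _ _ h2,
    Finset.sum_eq_zero, add_zero]
  · simp [pad, corner]
  · rintro ⟨g, i, j⟩ hv
    simp only [Finset.mem_erase, V1, Finset.mem_filter] at hv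
    have : corner q i j ≠ (g, i, j) := by
      intro h
      cases i <;> cases j <;> simp_all
    simp [pad, this]

theorem sum_pad_V0 (u : Vertex G → A × B → ZMod 2) (q : Square A B) :
    (∑ v ∈ V0 G, pad v (u v)) q =
      u (corner q false false) q.2 + u (corner q true true) q.2 := by
  classical
  have h1 : corner q false false ∈ V0 G := by simp [V0, corner]
  have h2 : corner q true true ∈ (V0 G).erase (corner q false false) := by simp [V0, corner]
  rw [Finset.sum_apply, ← Finset.add_sum_erase _ _ h1, ← Finset.add_sum_erase _ _ h2,
    Finset.sum_eq_zero, add_zero]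
  · simp [pad, corner]
  · rintro ⟨g, i, j⟩ hv
    simp only [Finset.mem_erase, V0, Finset.mem_filter] at hv
    have : corner q i j ≠ (g, i, j) := by
      intro h
      cases i <;> cases j <;> simp_all
    simp [pad, this]

/-! ### Local minimality -/

/-- The total number of nonzero rows is the same at both ends of the row edges. -/
theorem sum_numRows (x : Square A B → ZMod 2) (i j j' : Bool) :
    ∑ g, numRows (localView (g, i, j) x) = ∑ g, numRows (localView (g, i, j') x) := by
  classical
  suffices h : ∀ j, ∑ g, numRows (localView (g, i, j) x) =
      ∑ g, numRows (localView (g, i, !j) x) by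
    by_cases hj : j = j'
    · rw [hj]
    · rw [h j]
      congr 1
      ext g
      revert hj
      cases j <;> cases j' <;> simp
  intro j
  simp only [numRows, Finset.card_filter]
  rw [Finset.sum_comm, Finset.sum_comm (s := Finset.univ (α := G))]
  refine Finset.sum_congr rfl fun a _ => ?_
  refine Fintype.sum_equiv (if j then Equiv.mulLeft (a : G)⁻¹ else Equiv.mulLeft (a : G))
    _ _ fun g => ?_
  have h1 : ((if j then Equiv.mulLeft (a : G)⁻¹ else Equiv.mulLeft (a : G)) g, i, !j) =
      (cayleyComplex A B).row a (g, i, j) := by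
    cases j <;> simp [cayleyComplex]
  rw [h1]
  simp only [localView, phi_row]
  congr

theorem sum_numCols (x : Square A B → ZMod 2) (i i' j : Bool) :
    ∑ g, numCols (localView (g, i, j) x) = ∑ g, numCols (localView (g, i', j) x) := by
  classical
  suffices h : ∀ i, ∑ g, numCols (localView (g, i, j) x) =
      ∑ g, numCols (localView (g, !i, j) x) by
    by_cases hj : i = i'
    · rw [hj]
    · rw [h i]
      congr 1
      ext g
      revert hj
      cases i <;> cases i' <;> simp
  intro i
  simp only [numCols, Finset.card_filter]
  rw [Finset.sum_comm, Finset.sum_comm (s := Finset.univ (α := G))]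
  refine Finset.sum_congr rfl fun b _ => ?_
  refine Fintype.sum_equiv (if i then Equiv.mulRight (b : G)⁻¹ else Equiv.mulRight (b : G))
    _ _ fun g => ?_
  have h1 : ((if i then Equiv.mulRight (b : G)⁻¹ else Equiv.mulRight (b : G)) g, !i, j) =
      (cayleyComplex A B).col b (g, i, j) := by
    cases i <;> simp [cayleyComplex]
  rw [h1]
  simp only [localView, phi_col]
  congr

namespace Decomp

variable {CA : Code A} {CB : Code B} (Z : Decomp CA CB)

theorem activeSet_toLocal : Z.toLocal.activeSet = Z.active := by
  ext v
  simp only [LocalDecomp.activeSet, active, V0, Finset.mem_filter, Finset.mem_univ, true_and]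
  exact Iff.rfl

theorem sum_bool_eq (f : Bool → ℕ) (i : Bool) : ∑ k, f k = f i + f (!i) := by
  cases i <;> simp [add_comm]

/-- The norm, with the rows and columns of one kind counted at an arbitrary class of vertices. -/
theorem norm_eq (i j : Bool) :
    Z.norm = (∑ g, numRows (localView (g, i, j) (Z.R i)) +
        ∑ g, numCols (localView (g, i, j) (Z.C j))) +
      (∑ g, numRows (localView (g, !i, i) (Z.R !i)) +
        ∑ g, numCols (localView (g, j, !j) (Z.C !j))) := by
  rw [norm, Finset.sum_add_distrib, sum_bool_eq _ j, sum_bool_eq _ i, sum_numRows _ i (!i) j,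
    sum_numCols _ (!j) i j]
  simp only [Bool.not_not]
  ring

/-- A decomposition of minimal norm has locally minimal norm: at each vertex the rows and columns
may be exchanged for others with the same sum. -/
theorem IsMinimal.local_le {Z : Decomp CA CB} (hZ : Z.IsMinimal) (v : Vertex G)
    (r : A → B → ZMod 2) (c : B → A → ZMod 2) (hr : ∀ a, r a ∈ CB) (hc : ∀ b, c b ∈ CA)
    (h : arr r c = Z.toLocal.own v) :
    hammingNorm (Z.toLocal.R v) + hammingNorm (Z.toLocal.C v) ≤
      hammingNorm r + hammingNorm c := by
  classical
  let t : A × B → ZMod 2 := fun p => Z.toLocal.R v p.1 p.2 + r p.1 p.2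
  have ht : ∀ a b, t (a, b) = Z.toLocal.C v b a + c b a := by
    intro a b
    have h1 : r a b + c b a = Z.toLocal.R v a b + Z.toLocal.C v b a := congrFun h (a, b)
    have h2 : Z.toLocal.R v a b = r a b + c b a + Z.toLocal.C v b a := by
      rw [h1, add_assoc, CharTwo.add_self_eq_zero, add_zero]
    change Z.toLocal.R v a b + r a b = _
    rw [h2]
    linear_combination CharTwo.add_self_eq_zero (r a b)
  have htr : ∀ a, (fun b => t (a, b)) ∈ CB := fun a => CB.add_mem (Z.toLocal.mem_R v a) (hr a)
  have htc : ∀ b, (fun a => t (a, b)) ∈ CA := by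
    intro b
    have : (fun a => t (a, b)) = Z.toLocal.C v b + c b := funext fun a => ht a b
    rw [this]
    exact CA.add_mem (Z.toLocal.mem_C v b) (hc b)
  let Y : Decomp CA CB :=
    { C := Function.update Z.C v.2.2 (Z.C v.2.2 + pad v t)
      R := Function.update Z.R v.2.1 (Z.R v.2.1 + pad v t)
      mem_C := by
        intro j g b
        by_cases hj : j = v.2.2
        · subst hj
          rw [Function.update_self]
          refine CA.add_mem (Z.mem_C _ g b) ?_
          rcases localView_pad_col (v := v) (u := (g, !v.2.2, v.2.2)) rfl t b with h | h
          · have : (fun a => localView (g, !v.2.2, v.2.2) (pad v t) (a, b)) =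
              fun a => t (a, b) := funext h
            exact this ▸ htc b
          · have : (fun a => localView (g, !v.2.2, v.2.2) (pad v t) (a, b)) = 0 := funext h
            exact this ▸ CA.zero_mem
        · rw [Function.update_of_ne hj]
          exact Z.mem_C j g b
      mem_R := by
        intro i g a
        by_cases hi : i = v.2.1
        · subst hi
          rw [Function.update_self]
          refine CB.add_mem (Z.mem_R _ g a) ?_
          rcases localView_pad_row (v := v) (u := (g, v.2.1, !v.2.1)) rfl t a with h | h
          · have : (fun b => localView (g, v.2.1, !v.2.1) (pad v t) (a, b)) =
              fun b => t (a, b) := funext h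
            exact this ▸ htr a
          · have : (fun b => localView (g, v.2.1, !v.2.1) (pad v t) (a, b)) = 0 := funext h
            exact this ▸ CB.zero_mem
        · rw [Function.update_of_ne hi]
          exact Z.mem_R i g a }
  have hYm : Y.mismatch = Z.mismatch := by
    have h2 := add_self_zmodTwo (pad v t)
    obtain ⟨g, i, j⟩ := v
    cases i <;> cases j <;> simp [Y, mismatch] <;> linear_combination h2
  have hle := hZ Y hYm
  obtain ⟨g, i, j⟩ := v
  rw [Z.norm_eq i j, Y.norm_eq i j] at hle
  have hYR : Y.R i = Z.R i + pad (g, i, j) t := Function.update_self ..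
  have hYC : Y.C j = Z.C j + pad (g, i, j) t := Function.update_self ..
  have hYR' : Y.R (!i) = Z.R (!i) := Function.update_of_ne (by simp) _ _
  have hYC' : Y.C (!j) = Z.C (!j) := Function.update_of_ne (by simp) _ _
  rw [hYR', hYC', hYR, hYC,
    ← Finset.add_sum_erase _ _ (Finset.mem_univ g),
    ← Finset.add_sum_erase _ (fun g' => numCols (localView (g', i, j) (Z.C j)))
      (Finset.mem_univ g),
    ← Finset.add_sum_erase _
      (fun g' => numRows (localView (g', i, j) (Z.R i + pad (g, i, j) t))) (Finset.mem_univ g),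
    ← Finset.add_sum_erase _
      (fun g' => numCols (localView (g', i, j) (Z.C j + pad (g, i, j) t)))
      (Finset.mem_univ g)] at hle
  have hother : ∀ x : Square A B → ZMod 2, ∀ g' ∈ Finset.univ.erase g,
      localView (g', i, j) (x + pad (g, i, j) t) = localView (g', i, j) x := by
    intro x g' hg'
    have hne : ((g', i, j) : Vertex G) ≠ (g, i, j) :=
      fun h => (Finset.mem_erase.1 hg').1 (Prod.ext_iff.1 h).1
    rw [localView_add, localView_pad_of_ne hne rfl, add_zero]
  rw [Finset.sum_congr rfl fun g' hg' => congrArg numRows (hother (Z.R i) g' hg'),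
    Finset.sum_congr rfl fun g' hg' => congrArg numCols (hother (Z.C j) g' hg'),
    localView_add, localView_add, localView_pad_self] at hle
  have hR1 : numRows (localView (g, i, j) (Z.R i) + t) = hammingNorm r := by
    unfold numRows hammingNorm
    congr 1
    ext a
    have : ∀ b, (localView (g, i, j) (Z.R i) + t) (a, b) = r a b := by
      intro b
      change Z.toLocal.R (g, i, j) a b + (Z.toLocal.R (g, i, j) a b + r a b) = r a b
      rw [← add_assoc, CharTwo.add_self_eq_zero, zero_add]
    simp only [Finset.mem_filter, Finset.mem_univ, true_and, Function.ne_iff, this]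
    rfl
  have hC1 : numCols (localView (g, i, j) (Z.C j) + t) = hammingNorm c := by
    unfold numCols hammingNorm
    congr 1
    ext b
    have : ∀ a, (localView (g, i, j) (Z.C j) + t) (a, b) = c b a := by
      intro a
      change Z.toLocal.C (g, i, j) b a + t (a, b) = c b a
      rw [ht, ← add_assoc, CharTwo.add_self_eq_zero, zero_add]
    simp only [Finset.mem_filter, Finset.mem_univ, true_and, Function.ne_iff, this]
    rfl
  have hR0 := Z.numRows_eq (g, i, j)
  have hC0 := Z.numCols_eq (g, i, j)
  dsimp only at hR0 hC0
  rw [hR1, hC1, hR0, hC0] at hle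
  omega

end Decomp

end Concrete

/-! ### Expansion of the left-right Cayley complex -/

section SignedSums

variable {G : Type*} [Group G] {A B : Finset G}

theorem sum_inv_eq (hinv : ∀ a ∈ A, a⁻¹ ∈ A) (f : G → ℝ) :
    ∑ a : A, f (a : G)⁻¹ = ∑ a : A, f a := by
  refine Fintype.sum_bijective (fun a : A => (⟨(a : G)⁻¹, hinv _ a.2⟩ : A)) ?_ _ _ fun a => rfl
  refine Function.Involutive.bijective fun a => ?_
  simp

theorem sum_leftNbr (hAi : ∀ a ∈ A, a⁻¹ ∈ A) (f : G → ℝ) (j : Bool) (g : G) :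
    ∑ a : A, f (if j then (a : G)⁻¹ * g else a * g) = ∑ a : A, f (a * g) := by
  cases j
  · simp
  · simpa using sum_inv_eq hAi fun x => f (x * g)

theorem sum_rightNbr (hBi : ∀ b ∈ B, b⁻¹ ∈ B) (f : G → ℝ) (i : Bool) (g : G) :
    ∑ b : B, f (if i then g * (b : G)⁻¹ else g * b) = ∑ b : B, f (g * b) := by
  cases i
  · simp
  · simpa using sum_inv_eq hBi fun x => f (g * x)

end SignedSums

section ComplexExpansion

variable {G : Type*} [Group G] [Fintype G] {A B : Finset G} {Δ : ℕ}

/-- Expansion of a graph on the vertices of the complex that maps classes `V_{ij}` to classes, from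
a norm bound for functions of mean zero on each class. -/
theorem expands_of_classes {L : Type*} [Fintype L] {nbr : L → Vertex G → Vertex G} {Λ : ℝ}
    (σ : Bool × Bool ≃ Bool × Bool) (ψ : L → Bool × Bool → G → G)
    (hnbr : ∀ l g ij, nbr l (g, ij) = (ψ l ij g, σ ij)) (hΛ : 0 ≤ Λ)
    (h : ∀ ij (f : G → ℝ), ∑ g, f g = 0 →
      ∑ g, (∑ l, f (ψ l ij g)) ^ 2 ≤ Λ * ∑ g, f g ^ 2) :
    Expands nbr (Fintype.card L / Fintype.card G) Λ := by
  classical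
  intro T
  let f : Bool × Bool → G → ℝ := fun ij g => if (g, ij) ∈ T then 1 else 0
  let μ : Bool × Bool → ℝ := fun ij => (∑ g, f ij g) / Fintype.card G
  have hn : (0 : ℝ) < Fintype.card G := by exact_mod_cast Fintype.card_pos
  have hT : ∑ ij, ∑ g, f ij g = #T := by
    rw [← Fintype.sum_prod_type_right' (f := fun g ij => f ij g)]
    simp [f]
  have hf0 : ∀ ij, 0 ≤ ∑ g, f ij g := fun ij => Finset.sum_nonneg fun g _ => by
    simp only [f]
    split_ifs <;> norm_num
  refine ⟨fun v => Fintype.card L * μ (σ v.2), fun v => ?_, ?_⟩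
  · have h1 : ∑ g, f (σ v.2) g ≤ #T := by
      rw [← hT]
      exact Finset.single_le_sum (f := fun ij => ∑ g, f ij g) (fun ij _ => hf0 ij)
        (Finset.mem_univ _)
    simp only [μ]
    rw [mul_div_assoc', div_mul_eq_mul_div]
    gcongr
  · have hdeg : ∀ g ij, (deg nbr T (g, ij) : ℝ) - Fintype.card L * μ (σ ij) =
        ∑ l, (f (σ ij) (ψ l ij g) - μ (σ ij)) := by
      intro g ij
      rw [Finset.sum_sub_distrib, Finset.sum_const, nsmul_eq_mul, Finset.card_univ]
      congr 1
      simp only [deg, f, hnbr, Finset.card_filter]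
      push_cast
      rfl
    have hcls : ∀ ij, ∑ g, ((deg nbr T (g, ij) : ℝ) - Fintype.card L * μ (σ ij)) ^ 2 ≤
        Λ * ∑ g, f (σ ij) g := by
      intro ij
      simp only [hdeg]
      have hμ : ∑ g, f (σ ij) g = Fintype.card G * μ (σ ij) := by
        simp only [μ]
        field_simp
      refine (h ij (fun g => f (σ ij) g - μ (σ ij)) ?_).trans ?_
      · rw [Finset.sum_sub_distrib, Finset.sum_const, nsmul_eq_mul, Finset.card_univ, hμ, sub_self]
      · gcongr Λ * ?_
        have h1 : ∀ g, (f (σ ij) g - μ (σ ij)) ^ 2 =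
            f (σ ij) g - 2 * μ (σ ij) * f (σ ij) g + μ (σ ij) ^ 2 := by
          intro g
          have : f (σ ij) g ^ 2 = f (σ ij) g := by
            simp only [f]
            split_ifs <;> norm_num
          linear_combination this
        simp only [h1]
        rw [Finset.sum_add_distrib, Finset.sum_sub_distrib, ← Finset.mul_sum, Finset.sum_const,
          nsmul_eq_mul, Finset.card_univ, hμ]
        have : 0 ≤ (Fintype.card G : ℝ) * μ (σ ij) ^ 2 := by positivity
        linarith
    calc ∑ v, ((deg nbr T v : ℝ) - Fintype.card L * μ (σ v.2)) ^ 2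
        = ∑ ij, ∑ g, ((deg nbr T (g, ij) : ℝ) - Fintype.card L * μ (σ ij)) ^ 2 :=
          Fintype.sum_prod_type_right _
      _ ≤ ∑ ij, Λ * ∑ g, f (σ ij) g := Finset.sum_le_sum fun ij _ => hcls ij
      _ = Λ * #T := by
          rw [← Finset.mul_sum, Equiv.sum_comp σ fun ij => ∑ g, f ij g, hT]

theorem expands_row (hΔ : 1 ≤ Δ) (hA : #A = Δ) (hAi : ∀ a ∈ A, a⁻¹ ∈ A)
    (hAR : IsNonbipartiteRamanujan (leftCayley A) Δ) :
    Expands (cayleyComplex A B).row (Δ / Fintype.card G) (4 * Δ) := by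
  have h := expands_of_classes (nbr := (cayleyComplex A B).row) (Λ := 4 * Δ)
    ((Equiv.refl Bool).prodCongr Equiv.boolNot)
    (fun a ij g => if ij.2 then (a : G)⁻¹ * g else a * g) (fun _ _ _ => rfl) (by positivity) (by
      intro ij f hf
      simp only [sum_leftNbr hAi]
      exact sum_sq_left_le hΔ hA hAi hAR f hf)
  rwa [Fintype.card_coe, hA] at h

theorem expands_col (hΔ : 1 ≤ Δ) (hB : #B = Δ) (hBi : ∀ b ∈ B, b⁻¹ ∈ B)
    (hBR : IsNonbipartiteRamanujan (rightCayley B) Δ) :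
    Expands (cayleyComplex A B).col (Δ / Fintype.card G) (4 * Δ) := by
  have h := expands_of_classes (nbr := (cayleyComplex A B).col) (Λ := 4 * Δ)
    (Equiv.boolNot.prodCongr (Equiv.refl Bool))
    (fun b ij g => if ij.1 then g * (b : G)⁻¹ else g * b) (fun _ _ _ => rfl) (by positivity) (by
      intro ij f hf
      simp only [sum_rightNbr hBi]
      exact sum_sq_right_le hΔ hB hBi hBR f hf)
  rwa [Fintype.card_coe, hB] at h

/-- The graph joining the opposite vertices of squares inherits expansion from both Cayley
graphs. -/
theorem expands_square (hΔ : 1 ≤ Δ) (hA : #A = Δ) (hB : #B = Δ) (hAi : ∀ a ∈ A, a⁻¹ ∈ A)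
    (hBi : ∀ b ∈ B, b⁻¹ ∈ B) (hAR : IsNonbipartiteRamanujan (leftCayley A) Δ)
    (hBR : IsNonbipartiteRamanujan (rightCayley B) Δ) :
    Expands (fun p : A × B => (cayleyComplex A B).row p.1 ∘ (cayleyComplex A B).col p.2)
      (Δ * (Δ / Fintype.card G)) (16 * Δ ^ 2) := by
  have h := expands_of_classes
    (nbr := fun p : A × B => (cayleyComplex A B).row p.1 ∘ (cayleyComplex A B).col p.2)
    (Λ := 16 * (Δ : ℝ) ^ 2) (Equiv.boolNot.prodCongr Equiv.boolNot)
    (fun p ij g => if ij.2 then (p.1 : G)⁻¹ * (if ij.1 then g * (p.2 : G)⁻¹ else g * p.2)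
      else p.1 * (if ij.1 then g * (p.2 : G)⁻¹ else g * p.2)) (fun _ _ _ => rfl) (by positivity) (by
      intro ij f hf
      let h : G → ℝ := fun x => ∑ a : A, f (a * x)
      have hsum : ∀ g, ∑ p : A × B,
          f (if ij.2 then (p.1 : G)⁻¹ * (if ij.1 then g * (p.2 : G)⁻¹ else g * p.2)
            else p.1 * (if ij.1 then g * (p.2 : G)⁻¹ else g * p.2)) = ∑ b : B, h (g * b) := by
        intro g
        rw [Fintype.sum_prod_type_right, ← sum_rightNbr hBi h ij.1 g]
        exact Finset.sum_congr rfl fun b _ => sum_leftNbr hAi f ij.2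
          (if ij.1 then g * (b : G)⁻¹ else g * b)
      simp only [hsum]
      have h0 : ∑ g, h g = 0 := by
        simp only [h]
        rw [Finset.sum_comm]
        refine Finset.sum_eq_zero fun a _ => ?_
        rw [← hf]
        exact Equiv.sum_comp (Equiv.mulLeft (a : G)) f
      have h1 := sum_sq_right_le hΔ hB hBi hBR h h0
      have h2 := mul_le_mul_of_nonneg_left (sum_sq_left_le hΔ hA hAi hAR f hf)
        (by positivity : 0 ≤ 4 * (Δ : ℝ))
      linarith)
  rw [Fintype.card_prod, Fintype.card_coe, Fintype.card_coe, hA, hB] at h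
  rw [mul_div_assoc']
  exact_mod_cast h

end ComplexExpansion

/-! ### The decoder on the complex -/

section Decoder

theorem add_mem_of_cleanStep {ι κ : Type*} [Fintype ι] [Fintype κ] {CA : Code ι} {CB : Code κ}
    {z z' : ι × κ → ZMod 2} (h : CleanStep CA CB z z') : z + z' ∈ dualTensor CA CB := by
  classical
  obtain ⟨⟨a, r, hr, rfl⟩ | ⟨b, c, hc, rfl⟩, -⟩ := h
  · rw [← add_assoc, add_self_zmodTwo, zero_add]
    refine mem_dualTensor_iff.2 ⟨fun a' => if a' = a then r else 0, 0, fun a' => ?_,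
      fun b => CA.zero_mem, ?_⟩
    · change (if a' = a then r else 0) ∈ CB
      split_ifs
      exacts [hr, CB.zero_mem]
    · ext ⟨a', b'⟩
      by_cases h : a' = a <;> simp [singleRow, arr, h]
  · rw [← add_assoc, add_self_zmodTwo, zero_add]
    refine mem_dualTensor_iff.2 ⟨0, fun b' => if b' = b then c else 0, fun a => CB.zero_mem,
      fun b' => ?_, ?_⟩
    · change (if b' = b then c else 0) ∈ CA
      split_ifs
      exacts [hc, CA.zero_mem]
    · ext ⟨a', b'⟩
      by_cases h : b' = b <;> simp [singleCol, arr, h]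

theorem IsTweakedUpdate.mem_dualTensor {ι κ : Type*} [Fintype ι] [Fintype κ] {ε : ℝ} {Δ : ℕ}
    {CA : Code ι} {CB : Code κ} {z x : ι × κ → ZMod 2} (h : IsTweakedUpdate ε Δ CA CB z x) :
    x ∈ dualTensor CA CB := by
  rcases h with ⟨A₀, B₀, r, c, hcrit, hchain, -⟩ | ⟨-, rfl⟩
  · have key : ∀ y, Relation.ReflTransGen (CleanStep CA CB) (z + r + c) y →
        z + y ∈ dualTensor CA CB := by
      intro y hy
      induction hy with
      | refl =>
        rw [add_assoc, ← add_assoc z z, add_self_zmodTwo, zero_add, add_comm]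
        exact Submodule.add_mem_sup hcrit.2.2.2.1 hcrit.2.2.1
      | @tail y₁ y₂ _ hstep ih =>
        have h1 := Submodule.add_mem _ ih (add_mem_of_cleanStep hstep)
        rwa [add_assoc, ← add_assoc y₁ y₁, add_self_zmodTwo, zero_add] at h1
    have h1 := key _ hchain
    rwa [← add_assoc, add_self_zmodTwo, zero_add] at h1
  · exact Submodule.zero_mem _

variable {G : Type*} [Group G] [Fintype G] {A B : Finset G} {CA : Code A} {CB : Code B}

theorem IsStalled.local_le {z : Square A B → ZMod 2} (h : IsStalled CA CB z) {v : Vertex G}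
    (hv : v ∈ V0 G) {x : A × B → ZMod 2} (hx : x ∈ dualTensor CA CB) :
    hammingNorm (localView v z) ≤ hammingNorm (localView v z + x) := by
  obtain ⟨c, hc, r, hr, rfl⟩ := Submodule.mem_sup.1 hx
  have h1 := h v hv c hc r hr
  have h2 := hammingNorm_add_pad z v (c + r)
  omega

/-- The local views of the mismatch after the first step, when `D'` is the decomposition corrected
by the increments `u` at the odd vertices. -/
theorem localView_firstStep {Z : Decomp CA CB} {u : Vertex G → A × B → ZMod 2}
    {D' : LocalDecomp (cayleyComplex A B) CA CB}
    (hD' : ∀ v, ¬ (cayleyComplex A B).even v → D'.own v = Z.toLocal.own v + u v)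
    {v : Vertex G} (hv : (cayleyComplex A B).even v) :
    localView v (Z.mismatch + ∑ w ∈ V1 G, pad w (u w)) = D'.view v := by
  ext ⟨a, b⟩
  have hrow : ¬ (cayleyComplex A B).even ((cayleyComplex A B).row a v) := by
    rw [(cayleyComplex A B).even_row, not_not]
    exact hv
  have hcol : ¬ (cayleyComplex A B).even ((cayleyComplex A B).col b v) := by
    rw [(cayleyComplex A B).even_col, not_not]
    exact hv
  have h1 : localView v Z.mismatch (a, b) = Z.toLocal.view v (a, b) := by rw [Z.view_toLocal]
  have hq := (phi_eq_iff v (a, b) _).1 rfl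
  have h2 : (∑ w ∈ V1 G, pad w (u w)) (phi v (a, b)) =
      u ((cayleyComplex A B).row a v) (a, b) + u ((cayleyComplex A B).col b v) (a, b) := by
    rw [sum_pad_V1, hq.2]
    obtain ⟨g, i, j⟩ := v
    have hij : i = j := hv
    subst hij
    cases i
    · rfl
    · rw [add_comm]
      simp [corner, phi, cayleyComplex, mul_assoc]
  change localView v Z.mismatch (a, b) + (∑ w ∈ V1 G, pad w (u w)) (phi v (a, b)) = _
  rw [h1, h2, LocalDecomp.view_eq, LocalDecomp.view_eq, hD' _ hrow, hD' _ hcol]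
  simp only [Pi.add_apply]
  ring

/-- A mismatch with local decomposition `D'` is the sum of the own parts of the even vertices. -/
theorem eq_sum_own {z : Square A B → ZMod 2} {D' : LocalDecomp (cayleyComplex A B) CA CB}
    (h : ∀ v, (cayleyComplex A B).even v → localView v z = D'.view v) :
    z = ∑ v ∈ V0 G, pad v (D'.own v) := by
  ext q
  rw [sum_pad_V0]
  obtain ⟨g, a, b⟩ := q
  have h1 := congrFun (h (g, false, false) rfl) (a, b)
  rw [LocalDecomp.view, Pi.add_apply, LocalDecomp.foreign_eq_own] at h1
  have h2 : (cayleyComplex A B).row a ((cayleyComplex A B).col b (g, false, false)) =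
      (corner (g, a, b) true true : Vertex G) := by
    simp [cayleyComplex, corner, mul_assoc]
  rw [h2] at h1
  exact h1

/-- The weight after the second step. -/
theorem hammingNorm_secondStep_le {z : Square A B → ZMod 2}
    {D' : LocalDecomp (cayleyComplex A B) CA CB}
    (h : ∀ v, (cayleyComplex A B).even v → localView v z = D'.view v)
    (u : Vertex G → A × B → ZMod 2) :
    hammingNorm (z + ∑ v ∈ V0 G, pad v (u v)) ≤
      ∑ v ∈ V0 G, hammingNorm (D'.own v + u v) := by
  classical
  have h1 : z + ∑ v ∈ V0 G, pad v (u v) = ∑ v ∈ V0 G, pad v (D'.own v + u v) := by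
    conv_lhs => rw [eq_sum_own h]
    rw [← Finset.sum_add_distrib]
    refine Finset.sum_congr rfl fun v _ => ?_
    ext q
    simp only [pad, Pi.add_apply]
    split_ifs <;> simp
  rw [h1]
  have key : ∀ S : Finset (Vertex G), hammingNorm (∑ v ∈ S, pad v (D'.own v + u v)) ≤
      ∑ v ∈ S, hammingNorm (D'.own v + u v) := by
    intro S
    induction S using Finset.induction_on with
    | empty => simp
    | insert v S hv ih =>
      rw [Finset.sum_insert hv, Finset.sum_insert hv]
      refine (hammingNorm_add_le _ _).trans (add_le_add ?_ ih)
      rw [hammingNorm_pad]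
  exact key _

theorem IsBestUpdate.mem {z : Square A B → ZMod 2} {v : Vertex G} {u : A × B → ZMod 2}
    (h : IsBestUpdate CA CB z v u) : u ∈ dualTensor CA CB := by
  rcases h with h | ⟨-, rfl⟩
  exacts [h.1, Submodule.zero_mem _]

theorem IsBestUpdate.le {z : Square A B → ZMod 2} {v : Vertex G} {u : A × B → ZMod 2}
    (h : IsBestUpdate CA CB z v u) {x : A × B → ZMod 2} (hx : x ∈ dualTensor CA CB) :
    hammingNorm (localView v z + u) ≤ hammingNorm (localView v z + x) := by
  have h1 := hammingNorm_add_pad z v u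
  have h2 := hammingNorm_add_pad z v x
  rcases h with ⟨-, -, h⟩ | ⟨h, rfl⟩
  · have := h x hx
    omega
  · have := h x hx
    rw [add_zero]
    omega

theorem card_V0 (G : Type*) [Fintype G] : #(V0 G) = 2 * Fintype.card G := by
  classical
  have : V0 G = Finset.univ.image (fun p : Bool × G => ((p.2, p.1, p.1) : Vertex G)) := by
    ext ⟨g, i, j⟩
    simp only [V0, Finset.mem_filter, Finset.mem_univ, true_and, Finset.mem_image, Prod.exists,
      Prod.mk.injEq]
    constructor
    · rintro rfl
      exact ⟨i, g, rfl, rfl, rfl⟩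
    · rintro ⟨k, g', rfl, rfl, h⟩
      exact h
  rw [this, Finset.card_image_of_injective]
  · simp
  · rintro ⟨i, g⟩ ⟨i', g'⟩ h
    simp_all

end Decoder

/-! ### Large degree -/

/-- For large degree `Δ`, the parameters `s = √Δ` and `c = Δ ^ ε` are in the required range. -/
theorem exists_largeDegree {δ ε : ℝ} (hδ : 0 < δ) (hε : 0 < ε) (hε' : ε < 1 / 4) :
    ∃ Δ₀ : ℕ, ∀ Δ : ℕ, Δ₀ ≤ Δ → 1 ≤ Δ ∧
      (δ ≤ 1 → LocalDecomp.LargeDegree δ (√(Δ : ℝ)) ((Δ : ℝ) ^ ε)) := by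
  obtain ⟨K, hK⟩ : ∃ K : ℝ, K = max 16 (max (40 / δ) (16384 / δ ^ 2)) := ⟨_, rfl⟩
  obtain ⟨M, hM⟩ : ∃ M : ℝ, M = max 1 (max (2048 * LocalDecomp.excConst δ)
    (LocalDecomp.actConst δ)) := ⟨_, rfl⟩
  have t1 : Filter.Tendsto (fun n : ℕ => (n : ℝ) ^ ε) Filter.atTop Filter.atTop :=
    (tendsto_rpow_atTop hε).comp tendsto_natCast_atTop_atTop
  have t2 : Filter.Tendsto (fun n : ℕ => (n : ℝ) ^ (1 - 4 * ε)) Filter.atTop Filter.atTop :=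
    (tendsto_rpow_atTop (by linarith)).comp tendsto_natCast_atTop_atTop
  obtain ⟨N, hN⟩ := Filter.eventually_atTop.1
    ((t1.eventually_ge_atTop K).and ((t2.eventually_ge_atTop M).and
      (Filter.eventually_ge_atTop 1)))
  refine ⟨N, fun Δ hΔ => ?_⟩
  obtain ⟨h1, h2, h3⟩ := hN Δ hΔ
  have hΔpos : (0 : ℝ) < Δ := by exact_mod_cast h3
  refine ⟨h3, fun hδ1 => ?_⟩
  set c : ℝ := (Δ : ℝ) ^ ε with hc
  set s : ℝ := √(Δ : ℝ) with hs
  have hs2 : s ^ 2 = Δ := Real.sq_sqrt hΔpos.le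
  have hs0 : 0 ≤ s := Real.sqrt_nonneg _
  have hc4 : M * c ^ 4 ≤ s ^ 2 := by
    have h4 : (Δ : ℝ) ^ (1 - 4 * ε) * c ^ 4 = s ^ 2 := by
      rw [hc, ← Real.rpow_natCast, ← Real.rpow_mul hΔpos.le, ← Real.rpow_add hΔpos, hs2]
      conv_rhs => rw [← Real.rpow_one (Δ : ℝ)]
      congr 1
      push_cast
      ring
    rw [← h4]
    gcongr
  have hK1 : 16 ≤ c := (hK ▸ le_max_left _ _ : (16 : ℝ) ≤ K).trans h1
  have hK2 : 40 / δ ≤ c :=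
    ((le_max_left _ _).trans (hK ▸ le_max_right _ _ : _ ≤ K)).trans h1
  have hK3 : 16384 / δ ^ 2 ≤ c :=
    ((le_max_right _ _).trans (hK ▸ le_max_right _ _ : _ ≤ K)).trans h1
  have hM1 : 1 ≤ M := hM ▸ le_max_left _ _
  have hM2 : 2048 * LocalDecomp.excConst δ ≤ M :=
    (le_max_left _ _).trans (hM ▸ le_max_right _ _ : _ ≤ M)
  have hM3 : LocalDecomp.actConst δ ≤ M :=
    (le_max_right _ _).trans (hM ▸ le_max_right _ _ : _ ≤ M)
  have hc0 : 0 ≤ c ^ 4 := by positivity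
  refine ⟨hδ, hδ1, hK1, ?_, ?_, ?_, ?_, ?_⟩
  · rwa [div_le_iff₀ hδ, mul_comm] at hK2
  · rwa [div_le_iff₀ (by positivity), mul_comm] at hK3
  · refine le_of_sq_le_sq ?_ hs0
    nlinarith [mul_le_mul_of_nonneg_right hM1 hc0, sq_nonneg (c ^ 2 - 256)]
  · exact (mul_le_mul_of_nonneg_right hM2 hc0).trans hc4
  · exact (mul_le_mul_of_nonneg_right hM3 hc0).trans hc4

/-! ### Both decoding steps -/

/-- The decomposition obtained from a first decoding step. At an odd vertex that is not bad its rows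
and columns are those left over by the decoder, at a bad one they are arbitrary. -/
theorem LocalDecomp.IsStalledMinimal.exists_corrected {V A B : Type*} {X : SquareComplex V A B}
    {CA : Code A} {CB : Code B} [Fintype A] [Fintype B] [Fintype V] {D : LocalDecomp X CA CB}
    {Δ : ℕ} {d w P m τ ε : ℝ} (h : D.IsStalledMinimal Δ d w P m τ)
    (hP : (Δ : ℝ) ^ (1 - ε) = P) (hw : (Δ : ℝ) ^ (3 / 2 - ε) = w) {u : V → A × B → ZMod 2}
    (hu : ∀ v, ¬ X.even v → IsTweakedUpdate ε Δ CA CB (D.view v) (u v)) :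
    ∃ D' : LocalDecomp X CA CB, (∀ v, ¬ X.even v → D'.own v = D.own v + u v) ∧
      D.RowResidual D' d P τ ∧ D.swap.RowResidual D'.swap d P τ := by
  have key : ∀ v, ∃ (r : A → B → ZMod 2) (c : B → A → ZMod 2), (∀ a, r a ∈ CB) ∧
      (∀ b, c b ∈ CA) ∧ (¬ X.even v → arr r c = D.own v + u v) ∧
      (¬ X.even v → v ∉ D.badSet τ P →
        (∀ a, X.row a v ∉ D.exceptional τ → r a ≠ 0 → d / 4 ≤ D.crossWeight v a) ∧
        ∀ b, X.col b v ∉ D.exceptional τ → c b ≠ 0 → d / 4 ≤ D.swap.crossWeight v b) := by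
    intro v
    by_cases hev : X.even v
    · exact ⟨0, 0, fun _ => CB.zero_mem, fun _ => CA.zero_mem, fun h => absurd hev h,
        fun h => absurd hev h⟩
    by_cases hbad : v ∈ D.badSet τ P
    · obtain ⟨r, c, hr, hc, hrc⟩ := mem_dualTensor_iff.1
        (Submodule.add_mem _ (D.own_mem v) (hu v hev).mem_dualTensor)
      exact ⟨r, c, hr, hc, fun _ => hrc.symm, fun _ hn => absurd hbad hn⟩
    · obtain ⟨hdr, hdc⟩ := deg_le_of_notMem_badSet hev hbad
      obtain ⟨r, c, hr, hc, hrc, h1, h2⟩ := h.exists_residual hP hw hev hdr hdc (hu v hev)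
      exact ⟨r, c, hr, hc, fun _ => hrc, fun _ _ => ⟨h1, h2⟩⟩
  choose r c hr hc hrc hres using key
  obtain ⟨D', hD'⟩ := exists_of_odd (X := X) r c hr hc
  refine ⟨D', fun v hv => ?_, fun v hv hbad a ha h0 => ?_, fun v hv hbad b hb h0 => ?_⟩
  · rw [← hrc v hv, own, (hD' v hv).1, (hD' v hv).2]
  · rw [(hD' v hv).1] at h0
    exact (hres v hv hbad).1 a ha h0
  · rw [badSet_swap] at hbad
    rw [exceptional_swap] at hb
    have h1 : D'.C v b ≠ 0 := h0
    rw [(hD' v hv).2] at h1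
    exact (hres v hv hbad).2 b hb h1

theorem rpow_eq_of_sq {Δ : ℕ} (hΔ : 1 ≤ Δ) {ε s c : ℝ} (hs : s = √(Δ : ℝ))
    (hc : c = (Δ : ℝ) ^ ε) (k : ℕ) (l : ℤ) :
    (Δ : ℝ) ^ (k / 2 + l * ε) = s ^ k * c ^ l := by
  have hΔpos : (0 : ℝ) < Δ := by exact_mod_cast hΔ
  rw [Real.rpow_add hΔpos, hs, Real.sqrt_eq_rpow, hc, ← Real.rpow_natCast, ← Real.rpow_intCast,
    ← Real.rpow_mul hΔpos.le, ← Real.rpow_mul hΔpos.le]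
  congr 2 <;> ring

/-- The bounds for the two decoding steps in terms of `s = √Δ` and `c = Δ ^ ε`. -/
theorem decoding_bounds {G : Type*} [Group G] [Fintype G] {A B : Finset G} {CA : Code A}
    {CB : Code B} {Δ : ℕ} {ρ δ ε s c : ℝ} (hs : LocalDecomp.LargeDegree δ s c) (hΔ1 : 1 ≤ Δ)
    (hΔ : (Δ : ℝ) = s ^ 2) (hP : (Δ : ℝ) ^ (1 - ε) = s ^ 2 / c)
    (hw : (Δ : ℝ) ^ (3 / 2 - ε) = s ^ 3 / c) (hA : #A = Δ) (hB : #B = Δ)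
    (hAi : ∀ a ∈ A, a⁻¹ ∈ A) (hBi : ∀ b ∈ B, b⁻¹ ∈ B)
    (hAR : IsNonbipartiteRamanujan (leftCayley A) Δ)
    (hBR : IsNonbipartiteRamanujan (rightCayley B) Δ) (hC : GoodCodes ρ δ ε (1 - ε) Δ CA CB)
    {Z : Decomp CA CB} (hZ : Z.IsMinimal) (hst : IsStalled CA CB Z.mismatch)
    (hact : (#Z.active : ℝ) ≤ δ / (8 * Δ) * #(V0 G)) {z' z'' : Square A B → ZMod 2}
    (h1 : FirstStep ε Δ CA CB Z.mismatch z') (h2 : SecondStep CA CB z' z'') :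
    (hammingNorm z'' : ℝ) ≤ 256 * LocalDecomp.actConst δ / δ * #Z.active * c ^ 4 ∧
      #Z.active * (s / c) ≤ 32 * hammingNorm Z.mismatch := by
  have hΔpos : (0 : ℝ) < Δ := by exact_mod_cast hΔ1
  have hn : (0 : ℝ) < Fintype.card G := by exact_mod_cast Fintype.card_pos
  have hdA := hC.dist_A
  have hdB := hC.dist_B
  have hrob := hC.robust_one
  rw [hP, hw] at hrob
  rw [hΔ] at hdA hdB
  have hV1 : ∀ v : Vertex G, ¬ (cayleyComplex A B).even v → v ∈ V1 G := fun v hv =>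
    Finset.mem_filter.2 ⟨Finset.mem_univ _, hv⟩
  have hV0 : ∀ v : Vertex G, v ∈ V0 G ↔ (cayleyComplex A B).even v := fun v => by
    simp only [V0, Finset.mem_filter, Finset.mem_univ, true_and]
    exact Iff.rfl
  have h := LocalDecomp.isStalledMinimal_of_largeDegree (D := Z.toLocal) hs hΔ
    (by rw [Fintype.card_coe, hA]) (by rw [Fintype.card_coe, hB]) hdA hdB hrob hZ.local_le
    (fun v hv x hx => by
      rw [Z.view_toLocal]
      exact hst.local_le ((hV0 v).2 hv) hx)
  have hrow := expands_row (B := B) hΔ1 hA hAi hAR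
  have hcol := expands_col (A := A) hΔ1 hB hBi hBR
  have hsq := expands_square hΔ1 hA hB hAi hBi hAR hBR
  have hθ0 : (0 : ℝ) ≤ Δ / Fintype.card G := by positivity
  have hθ : (Δ / Fintype.card G : ℝ) * #Z.toLocal.activeSet ≤ δ / 4 := by
    rw [Z.activeSet_toLocal]
    refine (mul_le_mul_of_nonneg_left hact hθ0).trans (le_of_eq ?_)
    rw [card_V0]
    push_cast
    field_simp
    ring
  obtain ⟨u, hu, rfl⟩ := h1
  obtain ⟨inc, hinc, rfl⟩ := h2
  constructor
  · obtain ⟨D', hD', hres, hres'⟩ := h.exists_corrected hP hw (u := u) fun v hv => by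
      rw [Z.view_toLocal]
      exact hu v (hV1 v hv)
    have hview : ∀ v, (cayleyComplex A B).even v →
        localView v (Z.mismatch + ∑ w ∈ V1 G, pad w (u w)) = D'.view v :=
      fun v hv => localView_firstStep hD' hv
    have h3 := h.sum_residual_le hs hΔ hrow hcol hsq hθ0 hθ hres hres' (E := V0 G)
      (fun v hv => (hV0 v).1 hv) inc (fun v hv => (hinc v hv).mem) (fun v hv x hx => by
        rw [← hview v ((hV0 v).1 hv)]
        exact (hinc v hv).le hx)
    rw [Z.activeSet_toLocal] at h3
    refine le_trans ?_ h3
    exact_mod_cast hammingNorm_secondStep_le hview inc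
  -- each square is counted in the local views of its four vertices
  · have h3 := h.le_sum_view hs hΔ hrow hcol hsq hθ0 hθ
    have h4 : ∑ v, (hammingNorm (Z.toLocal.view v) : ℝ) = 4 * hammingNorm Z.mismatch := by
      simp only [Z.view_toLocal]
      exact_mod_cast sum_hammingNorm_localView Z.mismatch
    rw [h4, Z.activeSet_toLocal] at h3
    linarith

end QTanner

theorem theorem4 (δ : ℝ) (hδ : 0 < δ) :
    ∃ κ κ' : ℝ, 0 < κ ∧ 0 < κ' ∧
      ∀ ρ ε : ℝ, 0 < ρ → ρ < 1 / 2 → 0 < ε → ε < 1 / 4 →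
      ∃ Δ₀ : ℕ, ∀ Δ : ℕ, Δ₀ ≤ Δ →
      ∀ (G : Type u) [Group G] [Fintype G] (A B : Finset G),
        #A = Δ → #B = Δ → (∀ a ∈ A, a⁻¹ ∈ A) → (∀ b ∈ B, b⁻¹ ∈ B) →
        IsNonbipartiteRamanujan (leftCayley A) Δ →
        IsNonbipartiteRamanujan (rightCayley B) Δ →
      ∀ (CA : Code A) (CB : Code B), GoodCodes ρ δ ε (1 - ε) Δ CA CB →
      ∀ Z : Decomp CA CB, Z.IsMinimal → IsStalled CA CB Z.mismatch →
        (#Z.active : ℝ) ≤ δ / (8 * Δ) * #(V0 G) →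
      ∀ z' z'' : Square A B → ZMod 2,
        FirstStep ε Δ CA CB Z.mismatch z' → SecondStep CA CB z' z'' →
        (hammingNorm z'' : ℝ) ≤ κ * #Z.active * (Δ : ℝ) ^ (4 * ε) ∧
        κ' * #Z.active * (Δ : ℝ) ^ (1 / 2 - ε) ≤ hammingNorm Z.mismatch ∧
        (hammingNorm z'' : ℝ) ≤
          κ / κ' * hammingNorm Z.mismatch / (Δ : ℝ) ^ (1 / 2 - 5 * ε) := by
  have hκ : 0 < 256 * LocalDecomp.actConst δ / δ := by
    have := LocalDecomp.actConst_pos hδ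
    positivity
  refine ⟨256 * LocalDecomp.actConst δ / δ, 1 / 32, hκ, by norm_num,
    fun ρ ε _ _ hε hε' => ?_⟩
  obtain ⟨Δ₀, hΔ₀⟩ := exists_largeDegree hδ hε hε'
  refine ⟨Δ₀, fun Δ hle G _ _ A B hA hB hAi hBi hAR hBR CA CB hC Z hZ hst hact z' z'' h1 h2 => ?_⟩
  obtain ⟨hΔ1, hlarge⟩ := hΔ₀ Δ hle
  have hΔpos : (0 : ℝ) < Δ := by exact_mod_cast hΔ1
  -- a code of positive minimum distance has a codeword of that weight, at most its length
  have hδ1 : δ ≤ 1 := by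
    have hd : 0 < minDist CA := by
      have h3 := (mul_pos hδ hΔpos).trans_le hC.dist_A
      exact_mod_cast h3
    obtain ⟨x, -, -, hx⟩ := exists_hammingNorm_eq_minDist hd
    have h3 : minDist CA ≤ Δ := by
      rw [← hx]
      refine hammingNorm_le_card_fintype.trans ?_
      rw [Fintype.card_coe, hA]
    have h4 : (minDist CA : ℝ) ≤ Δ := by exact_mod_cast h3
    exact le_of_mul_le_mul_right (by linarith [hC.dist_A]) hΔpos
  have hs := hlarge hδ1
  have hpow := rpow_eq_of_sq hΔ1 (ε := ε) rfl rfl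
  set s : ℝ := √(Δ : ℝ) with hs_def
  set c : ℝ := (Δ : ℝ) ^ ε with hc_def
  have hc : 0 < c := Real.rpow_pos_of_pos hΔpos _
  have hs0 : 0 < s := Real.sqrt_pos.2 hΔpos
  have e1 : (Δ : ℝ) ^ (1 - ε) = s ^ 2 / c := by
    have h3 := hpow 2 (-1)
    rw [zpow_neg_one, ← div_eq_mul_inv] at h3
    rw [← h3]
    congr 1
    push_cast
    ring
  have e2 : (Δ : ℝ) ^ (3 / 2 - ε) = s ^ 3 / c := by
    have h3 := hpow 3 (-1)
    rw [zpow_neg_one, ← div_eq_mul_inv] at h3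
    rw [← h3]
    congr 1
    push_cast
    ring
  have e3 : (Δ : ℝ) ^ (1 / 2 - ε) = s / c := by
    have h3 := hpow 1 (-1)
    rw [zpow_neg_one, ← div_eq_mul_inv, pow_one] at h3
    rw [← h3]
    congr 1
    push_cast
    ring
  have e4 : (Δ : ℝ) ^ (4 * ε) = c ^ 4 := by
    have h3 := hpow 0 4
    rw [pow_zero, one_mul] at h3
    have h4 : c ^ (4 : ℤ) = c ^ 4 := by norm_cast
    rw [← h4, ← h3]
    congr 1
    push_cast
    ring
  have e5 : (Δ : ℝ) ^ (1 / 2 - 5 * ε) = s / c / c ^ 4 := by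
    rw [← e3, ← e4, ← Real.rpow_sub hΔpos]
    congr 1
    ring
  obtain ⟨h3, h4⟩ := decoding_bounds hs hΔ1 (Real.sq_sqrt hΔpos.le).symm e1 e2 hA hB hAi hBi
    hAR hBR hC hZ hst hact h1 h2
  rw [e3, e4, e5]
  refine ⟨h3, by linarith, h3.trans ?_⟩
  rw [le_div_iff₀ (by positivity)]
  have h5 := mul_le_mul_of_nonneg_left h4 hκ.le
  calc 256 * LocalDecomp.actConst δ / δ * #Z.active * c ^ 4 * (s / c / c ^ 4)
      = 256 * LocalDecomp.actConst δ / δ * (#Z.active * (s / c)) := by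
        field_simp
    _ ≤ _ := h5
    _ = _ := by ring
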